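/- An instance $\mathcal I$ of \emph{Polytree Learning} consists of a node set $V$ with $|V| = n$ and, for each $v \in V$, a family $\mathcal F_v \ni \emptyset$ of potential parent sets $S \subseteq V \setminus \{v\}$ with local scores $f_v(S) \in \mathbb{Q}$, normalized so that $f_v(\emptyset) = 0$; put $f_v(S) = -\infty$ for $S \notin \mathcal F_v$. The input lists $n$ and, for each $v$, the sets in $\mathcal F_v$ with their scores (numerator and denominator), and $|\mathcal I|$ is the length of this encoding in bits. A \emph{polytree} on $V$ is a directed acyclic graph $D$ whose underlying undirected graph is a forest; writing $D_v$ for the set of parents of $v$ in $D$, its score is $f(D) = \sum_{v \in V} f_v(D_v)$. The task is to output a polytree on $V$ of maximum score. In the problem with in-degree bound $k$, it is guaranteed that all sets in all families $\mathcal F_v$ have at most $k$ elements. \textbf{Theorem.} For every constant in-degree bound $k$ and every $\varepsilon > 0$, Polytree Learning with in-degree bound $k$ can be solved in time $(2+\varepsilon)^n \cdot |\mathcal I|^{\mathcal O(1)}$. Precisely, there is an absolute constant $c$ such that for every $k \in \mathbb{N}$ and every $\varepsilon > 0$ there are a program of a random access machine and a constant $C = C(k,\varepsilon)$ such that, on every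 instance $\mathcal I$ with in-degree bound $k$, the program outputs a polytree of maximum score after a computation of cost at most $C \cdot (2+\varepsilon)^n \cdot |\mathcal I|^{c}$. Here the random access machine works on integers, and the cost of a computation is the sum of the costs of its steps: each step costs the sum of the bit lengths of the integers (and of the address) that it handles, and the product of the bit lengths of the operands for a multiplication or division. -/

import Mathlib

/-! ### Polytrees

A directed graph on `V` is given by its parent sets: `D v` is the set of parents of `v`,
so `u → v` is an arc exactly if `u ∈ D v`. -/

namespace Polytree

variable {V : Type*}

/-- `u → v` is an arc of the directed graph with parent sets `D`. -/
def Arc (D : V → Finset V) (u v : V) : Prop := u ∈ D v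

/-- No directed cycles (in particular no loops and no pairs of opposite arcs). -/
def IsDAG (D : V → Finset V) : Prop := ∀ v, ¬ Relation.TransGen (Arc D) v v

/-- The underlying undirected graph. -/
def skeleton (D : V → Finset V) : SimpleGraph V := SimpleGraph.fromRel (Arc D)

/-- A polytree is a directed acyclic graph whose skeleton is a forest. -/
def IsPolytree (D : V → Finset V) : Prop := IsDAG D ∧ (skeleton D).IsAcyclic

/-- An instance of Polytree Learning on the nodes `0, …, n - 1`. The value `⊥` stands for the score
`-∞` of the parent sets whose local score is not specified in the input; the potential parent sets
of `v` are those `S` with `f v S ≠ ⊥`. -/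
structure Instance where
  /-- number of nodes -/
  n : ℕ
  /-- local scores -/
  f : Fin n → Finset (Fin n) → WithBot ℚ
  /-- a potential parent set of `v` does not contain `v` -/
  f_self : ∀ v S, v ∈ S → f v S = ⊥
  /-- the local scores are normalized -/
  f_empty : ∀ v, f v ∅ = 0

/-- The score of a directed graph: the sum of the local scores of its parent sets. -/
def Instance.score (I : Instance) (D : Fin I.n → Finset (Fin I.n)) : WithBot ℚ :=
  ∑ v, I.f v (D v)

/-- Every parent set with a specified score has at most `k` elements. -/
def Instance.InDegreeLE (I : Instance) (k : ℕ) : Prop :=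
  ∀ v S, I.f v S ≠ ⊥ → S.card ≤ k

/-- `D` is a polytree of maximum score. -/
def Instance.IsOptimal (I : Instance) (D : Fin I.n → Finset (Fin I.n)) : Prop :=
  IsPolytree D ∧ ∀ D' : Fin I.n → Finset (Fin I.n), IsPolytree D' → I.score D' ≤ I.score D

/-! ### Encodings by lists of integers -/

/-- A list of nodes, written as its length followed by its elements. -/
def encodeNodes {n : ℕ} (L : List (Fin n)) : List ℤ :=
  (L.length : ℤ) :: L.map (fun i => ((i : ℕ) : ℤ))

/-- A parent set (given by the list `L` of its elements) together with its local score `q`,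
written as numerator and denominator. -/
def encodeEntry {n : ℕ} (L : List (Fin n)) (q : ℚ) : List ℤ :=
  encodeNodes L ++ [q.num, (q.den : ℤ)]

/-- `w` is an encoding of the instance `I`: the number of nodes, followed, for each node `v`, by the
number of potential parent sets of `v` and by the list of these sets with their local scores.
Each potential parent set is listed exactly once; the order of the sets in the list, and of the
elements in each set, is arbitrary. -/
def Instance.Encodes (I : Instance) (w : List ℤ) : Prop :=
  ∃ fam : Fin I.n → List (List (Fin I.n)),
    (∀ v, ∀ L ∈ fam v, L.Nodup) ∧
    (∀ v, ((fam v).map List.toFinset).Nodup) ∧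
    (∀ v S, S ∈ (fam v).map List.toFinset ↔ I.f v S ≠ ⊥) ∧
    w = (I.n : ℤ) :: (List.finRange I.n).flatMap fun v =>
      ((fam v).length : ℤ) ::
        (fam v).flatMap fun L => encodeEntry L ((I.f v L.toFinset).unbotD 0)

/-- `w` is an encoding of the directed graph `D`: the parent sets of `0, …, n - 1` one after the
other, each as a list without repetitions. -/
def EncodesGraph {n : ℕ} (D : Fin n → Finset (Fin n)) (w : List ℤ) : Prop :=
  ∃ par : Fin n → List (Fin n),
    (∀ v, (par v).Nodup ∧ (par v).toFinset = D v) ∧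
    w = (List.finRange n).flatMap fun v => encodeNodes (par v)

end Polytree

/-! ### Random access machines with logarithmic cost

Registers `0, 1, 2, …` and memory cells hold arbitrary integers, and each operation is charged
according to the bit lengths of the integers that it handles. -/

namespace RAM

/-- The length of an integer in bits, with one bit for the sign. -/
def len (z : ℤ) : ℕ := z.natAbs.size + 1

/-- The total length in bits of a list of integers. -/
def size (w : List ℤ) : ℕ := (w.map len).sum

/-- Arithmetic operations. -/
inductive Op
  | add | sub | mul | div

/-- The value of an operation. Division is integer division, with `x / 0 = 0`. -/
def Op.eval : Op → ℤ → ℤ → ℤ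
  | add, x, y => x + y
  | sub, x, y => x - y
  | mul, x, y => x * y
  | div, x, y => x / y

/-- The cost of an operation: linear in the bit lengths for addition and subtraction,
and their product (as in the school methods) for multiplication and division. -/
def Op.cost : Op → ℤ → ℤ → ℕ
  | add, x, y => len x + len y
  | sub, x, y => len x + len y
  | mul, x, y => len x * len y
  | div, x, y => len x * len y

/-- Programs. -/
inductive Prog
  /-- do nothing -/
  | skip
  /-- `reg r := z` -/
  | const (r : ℕ) (z : ℤ)
  /-- `reg r := o (reg a) (reg b)` -/
  | arith (o : Op) (r a b : ℕ)
  /-- `reg r := mem (reg a)` -/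
  | load (r a : ℕ)
  /-- `mem (reg a) := reg r` -/
  | store (a r : ℕ)
  /-- first `p`, then `q` -/
  | seq (p q : Prog)
  /-- if `0 < reg r` then `p` else `q` -/
  | ite (r : ℕ) (p q : Prog)
  /-- while `0 < reg r` do `p` -/
  | loop (r : ℕ) (p : Prog)

/-- The contents of the registers and of the memory. -/
structure State where
  /-- registers -/
  reg : ℕ → ℤ
  /-- memory cells, addressed by integers -/
  mem : ℤ → ℤ

/-- `Exec p s t s'`: started in the state `s`, the program `p` halts in the state `s'`
after a computation of cost `t`. -/
inductive Exec : Prog → State → ℕ → State → Prop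
  | skip (s : State) : Exec .skip s 1 s
  | const (s : State) (r : ℕ) (z : ℤ) :
      Exec (.const r z) s (len z) { s with reg := Function.update s.reg r z }
  | arith (s : State) (o : Op) (r a b : ℕ) :
      Exec (.arith o r a b) s (o.cost (s.reg a) (s.reg b))
        { s with reg := Function.update s.reg r (o.eval (s.reg a) (s.reg b)) }
  | load (s : State) (r a : ℕ) :
      Exec (.load r a) s (len (s.reg a) + len (s.mem (s.reg a)))
        { s with reg := Function.update s.reg r (s.mem (s.reg a)) }
  | store (s : State) (a r : ℕ) :
      Exec (.store a r) s (len (s.reg a) + len (s.reg r))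
        { s with mem := Function.update s.mem (s.reg a) (s.reg r) }
  | seq {p q : Prog} {s s' s'' : State} {t t' : ℕ} :
      Exec p s t s' → Exec q s' t' s'' → Exec (.seq p q) s (t + t') s''
  | ite_pos {r : ℕ} {p q : Prog} {s s' : State} {t : ℕ} :
      0 < s.reg r → Exec p s t s' → Exec (.ite r p q) s (len (s.reg r) + t) s'
  | ite_neg {r : ℕ} {p q : Prog} {s s' : State} {t : ℕ} :
      ¬ 0 < s.reg r → Exec q s t s' → Exec (.ite r p q) s (len (s.reg r) + t) s'
  | loop_stop {r : ℕ} {p : Prog} {s : State} :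
      ¬ 0 < s.reg r → Exec (.loop r p) s (len (s.reg r)) s
  | loop_step {r : ℕ} {p : Prog} {s s' s'' : State} {t t' : ℕ} :
      0 < s.reg r → Exec p s t s' → Exec (.loop r p) s' t' s'' →
      Exec (.loop r p) s (len (s.reg r) + t + t') s''

/-- The initial state on input `w`: the input is stored in the memory cells `0, 1, …`, its number
of entries in register `0`, and everything else is `0`. -/
def State.init (w : List ℤ) : State where
  reg := fun r => if r = 0 then (w.length : ℤ) else 0
  mem := fun a => if 0 ≤ a then w.getD a.toNat 0 else 0

/-- The output `w` is read from the memory cells `0, 1, …`, its number of entries from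
register `0`. -/
def State.HasOutput (s : State) (w : List ℤ) : Prop :=
  s.reg 0 = (w.length : ℤ) ∧ ∀ (i : ℕ) (hi : i < w.length), s.mem (i : ℤ) = w[i]

end RAM

/-! ### A cost calculus for programs with named variables and compound expressions. -/

namespace RAM

/-! The algorithm is a dynamic program over ways of building a polytree node by node. When a node v
is visited, its whole parent set P is chosen, and v is joined by at most one edge to an earlier node
p: either p is one of the chosen parents of v, or v is a parent for which p is still waiting. What
has to be remembered is the set S of visited nodes and a few slots, each holding a node together
with its parents still to come. A slot may be reused once nothing is pending in it.

Soundness (`Realized.next`, `Realized.isPolytree`): each visit adds an isolated node and at most one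
edge, so the arcs realized so far form a forest, and integer ranks show that they are acyclic. If P
contains an already visited node other than p, that node stays pending forever and the run cannot
succeed. When all nodes are visited and nothing is pending, the chosen graph equals the realized
one.

Completeness with logarithmically many slots (`SmallComps.smallTree`, `SmallTree.smallComps_succ`,
`exists_visits`): put the root of a tree with fewer than 2^(d+1) nodes into slot d. At most one
component of the rest has 2^d or more nodes. Visit everything else first, recursively, with the
slots below d. Then the root can only be waiting for the root of the large component, which may
therefore take over slot d. Hence n < 2^d nodes need only d + 1 slots.

Counting (`length_le_cfgBound`, `exists_cfgBound`): S contributes 2^n, and a slot has at most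
(n+1)(n+1)^k contents because pending sets are subsets of potential parent sets. With O(log n) slots
there are 2^n · n^(O(k log n)) configurations, and the second factor is at most C(1+ε/2)^n.

Optimality (`Layer.next`, `exists_isOptimal`): the possible continuations depend only on the
configuration, so one best score per configuration is enough, and configurations are treated in
layers by the size of S. All successful configurations are merged into one, whose record is an
optimal polytree.

The rest is implementation. A configuration is a number in base 2^n, used as an address in tables;
scores are unreduced fractions. All integers have polynomially many bits (`params`), and the
Hoare-style judgement `Runs` bounds the cost by the number of elementary steps times a polynomial.
Neither the program nor the exponent depends on k or ε; only the constant does. -/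

theorem len_pos (z : ℤ) : 1 ≤ len z := by unfold len; omega

theorem len_le_of_lt {z : ℤ} {a : ℕ} (h : |z| < 2 ^ a) : len z ≤ a + 1 := by
  unfold len
  have : z.natAbs < 2 ^ a := by
    zify; exact h
  have := Nat.size_le.2 this
  omega

theorem abs_lt_of_len (z : ℤ) : |z| < 2 ^ len z := by
  have h : z.natAbs < 2 ^ z.natAbs.size := Nat.lt_size_self _
  have h2 : z.natAbs < 2 ^ len z := h.trans_le (Nat.pow_le_pow_right (by norm_num) (by unfold len; omega))
  zify at h2; exact h2

/-- Subadditivity, uniform in the four operations, keeps the length of a compound expression linear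
in its size, see `Ex.len_eval_le`. -/
theorem len_op_le (o : Op) (x y : ℤ) : len (o.eval x y) ≤ len x + len y := by
  have hx : x.natAbs < 2 ^ x.natAbs.size := Nat.lt_size_self _
  have hy : y.natAbs < 2 ^ y.natAbs.size := Nat.lt_size_self _
  have key : ∀ z : ℤ, z.natAbs ≤ x.natAbs + y.natAbs → len z ≤ len x + len y := by
    intro z hz
    have h1 : 2 ^ x.natAbs.size ≤ 2 ^ (x.natAbs.size + y.natAbs.size) :=
      Nat.pow_le_pow_right (by norm_num) (by omega)
    have h2 : 2 ^ y.natAbs.size ≤ 2 ^ (x.natAbs.size + y.natAbs.size) :=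
      Nat.pow_le_pow_right (by norm_num) (by omega)
    have : z.natAbs < 2 ^ (x.natAbs.size + y.natAbs.size + 1) := by
      rw [pow_succ]; omega
    have := Nat.size_le.2 this
    unfold len; omega
  cases o with
  | add => exact key _ (Int.natAbs_add_le _ _)
  | sub => exact key _ (Int.natAbs_sub_le _ _)
  | mul =>
    simp only [Op.eval, len, Int.natAbs_mul]
    have : x.natAbs * y.natAbs < 2 ^ (x.natAbs.size + y.natAbs.size) := by
      rw [pow_add]; exact Nat.mul_lt_mul'' hx hy
    have := Nat.size_le.2 this
    omega
  | div => exact key _ ((Int.natAbs_ediv_le_natAbs _ _).trans (by omega))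

theorem op_cost_le (o : Op) (x y : ℤ) : o.cost x y ≤ 2 * (len x * len y) := by
  have hx := len_pos x
  have hy := len_pos y
  cases o <;> simp only [Op.cost] <;> nlinarith

/-- The program variables. -/
inductive Var
  | o | n | W | WL | L | E | head | tail | bd | rd
  | x | dx | nx | hx | e | u | P | en | ed | wv | i | wi | j | wj | a | b | c | d | y | g
  | pos | cnt | ln | pw
  deriving DecidableEq

/-- The contents of the program variables and of the memory. -/
structure St where
  (o n W WL L E head tail bd rd x dx nx hx e u P en ed wv i wi j wj a b c d y g pos cnt ln pw : ℤ)
  mem : ℤ → ℤ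

/-- The value of a variable. -/
def St.get (s : St) : Var → ℤ
  | .o => s.o | .n => s.n | .W => s.W | .WL => s.WL | .L => s.L | .E => s.E | .head => s.head
  | .tail => s.tail | .bd => s.bd | .rd => s.rd | .x => s.x | .dx => s.dx | .nx => s.nx
  | .hx => s.hx | .e => s.e | .u => s.u | .P => s.P | .en => s.en | .ed => s.ed | .wv => s.wv
  | .i => s.i | .wi => s.wi | .j => s.j | .wj => s.wj | .a => s.a | .b => s.b | .c => s.c
  | .d => s.d | .y => s.y | .g => s.g | .pos => s.pos | .cnt => s.cnt | .ln => s.ln | .pw => s.pw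

/-- Assignment to a variable. -/
def St.set (s : St) (v : Var) (z : ℤ) : St :=
  match v with
  | .o => { s with o := z } | .n => { s with n := z } | .W => { s with W := z }
  | .WL => { s with WL := z } | .L => { s with L := z } | .E => { s with E := z }
  | .head => { s with head := z } | .tail => { s with tail := z } | .bd => { s with bd := z }
  | .rd => { s with rd := z } | .x => { s with x := z } | .dx => { s with dx := z }
  | .nx => { s with nx := z } | .hx => { s with hx := z } | .e => { s with e := z }
  | .u => { s with u := z } | .P => { s with P := z } | .en => { s with en := z }
  | .ed => { s with ed := z } | .wv => { s with wv := z } | .i => { s with i := z }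
  | .wi => { s with wi := z } | .j => { s with j := z } | .wj => { s with wj := z }
  | .a => { s with a := z } | .b => { s with b := z } | .c => { s with c := z }
  | .d => { s with d := z } | .y => { s with y := z } | .g => { s with g := z }
  | .pos => { s with pos := z } | .cnt => { s with cnt := z } | .ln => { s with ln := z }
  | .pw => { s with pw := z }

theorem St.set_mem (s : St) (v : Var) (z : ℤ) : (s.set v z).mem = s.mem := by cases v <;> rfl

theorem St.get_set_self (s : St) (v : Var) (z : ℤ) : (s.set v z).get v = z := by cases v <;> rfl

set_option maxHeartbeats 1000000 in
theorem St.get_set_ne (s : St) {v v' : Var} (z : ℤ) (h : v' ≠ v) : (s.set v z).get v' = s.get v' := by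
  cases v <;> cases v' <;> first | rfl | exact absurd rfl h

/-- The register of a variable. -/
def Var.idx (v : Var) : ℕ := v.ctorIdx

theorem Var.idx_lt (v : Var) : v.idx < 40 := by cases v <;> decide

theorem Var.idx_inj {v v' : Var} (h : v.idx = v'.idx) : v = v' := by
  have h1 : Var.ofNat v.ctorIdx = Var.ofNat v'.ctorIdx := congrArg Var.ofNat h
  have h2 : ∀ v : Var, Var.ofNat v.ctorIdx = v := by intro v; cases v <;> rfl
  rwa [h2, h2] at h1

/-- The registers and the memory of `σ` contain the values in `s`. -/
def Rep (s : St) (σ : State) : Prop := (∀ v : Var, σ.reg v.idx = s.get v) ∧ σ.mem = s.mem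

/-- Expressions. -/
inductive Ex
  | var (v : Var)
  | lit (z : ℕ)
  | op (o : Op) (a b : Ex)
  | ld (a : Ex)

instance : Add Ex := ⟨Ex.op .add⟩
instance : Sub Ex := ⟨Ex.op .sub⟩
instance : Mul Ex := ⟨Ex.op .mul⟩
instance : Div Ex := ⟨Ex.op .div⟩
instance : Coe Var Ex := ⟨Ex.var⟩
instance (m : ℕ) : OfNat Ex m := ⟨Ex.lit m⟩

/-- The value of an expression. -/
def Ex.eval (s : St) : Ex → ℤ
  | var v => s.get v
  | lit z => z
  | op o a b => o.eval (a.eval s) (b.eval s)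
  | ld a => s.mem (a.eval s)

/-- The size of an expression. -/
def Ex.sz : Ex → ℕ
  | var _ => 1
  | lit z => len z
  | op _ a b => a.sz + b.sz + 1
  | ld a => a.sz + 1

@[simp] theorem Ex.eval_add (s : St) (a b : Ex) : (a + b).eval s = a.eval s + b.eval s := rfl
@[simp] theorem Ex.eval_sub (s : St) (a b : Ex) : (a - b).eval s = a.eval s - b.eval s := rfl
@[simp] theorem Ex.eval_mul (s : St) (a b : Ex) : (a * b).eval s = a.eval s * b.eval s := rfl
@[simp] theorem Ex.eval_div (s : St) (a b : Ex) : (a / b).eval s = a.eval s / b.eval s := rfl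
@[simp] theorem Ex.eval_var (s : St) (v : Var) : (Ex.var v).eval s = s.get v := rfl
@[simp] theorem Ex.eval_ld (s : St) (a : Ex) : (Ex.ld a).eval s = s.mem (a.eval s) := rfl
@[simp] theorem Ex.eval_two (s : St) : (2 : Ex).eval s = 2 := rfl
@[simp] theorem Ex.eval_zero (s : St) : (0 : Ex).eval s = 0 := rfl
@[simp] theorem Ex.eval_one (s : St) : (1 : Ex).eval s = 1 := rfl

/-- Evaluation of an expression into the register `t`, with work space above `t`. -/
def Ex.compile : Ex → ℕ → Prog
  | var v, t => .seq (.const t 0) (.arith .add t v.idx t)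
  | lit z, t => .const t z
  | op o a b, t => .seq (a.compile t) (.seq (b.compile (t + 1)) (.arith o t t (t + 1)))
  | ld a, t => .seq (a.compile t) (.load t t)

/-- All values in `s` have less than `l` bits. -/
def St.Bdd (l : ℕ) (s : St) : Prop := (∀ v, |s.get v| < 2 ^ l) ∧ ∀ a, |s.mem a| < 2 ^ l

theorem Ex.len_eval_le {l : ℕ} {s : St} (hs : s.Bdd l) (e : Ex) :
    len (e.eval s) ≤ e.sz * (l + 1) := by
  induction e with
  | var v => simpa [Ex.sz] using len_le_of_lt (hs.1 v)
  | lit z => simp only [Ex.eval, Ex.sz]; exact Nat.le_mul_of_pos_right _ (by omega)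
  | op o a b iha ihb =>
    refine (len_op_le o _ _).trans ?_
    simp only [Ex.sz]; nlinarith
  | ld a ih =>
    refine (len_le_of_lt (hs.2 _)).trans ?_
    simp only [Ex.sz]; nlinarith

theorem Ex.sz_pos (e : Ex) : 1 ≤ e.sz := by
  cases e <;> simp only [Ex.sz] <;> first | omega | exact len_pos _

/-- Registers below t survive, so the first operand can wait in t while the second is evaluated from
t + 1 on. The cube of the size leaves room for the costs of both operands and for the product of
their lengths. -/
theorem Ex.exec_compile {l : ℕ} {s : St} (hs : s.Bdd l) (e : Ex) (t : ℕ) (ht : 40 ≤ t) (σ : State)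
    (hσ : Rep s σ) :
    ∃ m reg, Exec (e.compile t) σ m { σ with reg := reg } ∧ m ≤ 4 * e.sz ^ 3 * (l + 1) ^ 2 ∧
      reg t = e.eval s ∧ ∀ r, r < t → reg r = σ.reg r := by
  induction e generalizing t σ with
  | var v =>
    -- The machine has no copy instruction: a register is copied by adding it to 0.
    refine ⟨_, _, .seq (.const _ _ _) (.arith _ _ _ _ _), ?_, ?_, ?_⟩
    · have hv : v.idx ≠ t := by have := v.idx_lt; omega
      simp only [Function.update_self, Function.update_of_ne hv, Op.cost, hσ.1, Ex.sz]
      have := len_le_of_lt (hs.1 v)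
      have h0 : len 0 = 1 := by simp [len]
      rw [h0]; nlinarith
    · have hv : v.idx ≠ t := by have := v.idx_lt; omega
      simp [Function.update_of_ne hv, Op.eval, hσ.1, Ex.eval]
    · intro r hr
      simp [Function.update_of_ne (show r ≠ t by omega)]
  | lit z =>
    refine ⟨_, _, .const _ _ _, ?_, by simp [Ex.eval], ?_⟩
    · simp only [Ex.sz]
      have h := len_pos z
      calc len z ≤ len z * (4 * len z ^ 2 * (l + 1) ^ 2) := Nat.le_mul_of_pos_right _ (by positivity)
        _ = _ := by ring
    · intro r hr
      simp [Function.update_of_ne (show r ≠ t by omega)]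
  | op o a b iha ihb =>
    obtain ⟨m₁, r₁, h₁, hm₁, hr₁, hf₁⟩ := iha t ht σ hσ
    obtain ⟨m₂, r₂, h₂, hm₂, hr₂, hf₂⟩ := ihb (t + 1) (by omega) { σ with reg := r₁ }
      ⟨fun v => by rw [← hσ.1 v]; exact hf₁ _ (by have := v.idx_lt; omega), hσ.2⟩
    refine ⟨_, _, .seq h₁ (.seq h₂ (.arith _ _ _ _ _)), ?_, ?_, ?_⟩
    · have e1 : r₂ t = a.eval s := by rw [hf₂ t (by omega)]; exact hr₁
      simp only [e1, hr₂, Ex.sz]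
      have c := op_cost_le o (a.eval s) (b.eval s)
      have la := a.len_eval_le hs
      have lb := b.len_eval_le hs
      have lab : len (a.eval s) * len (b.eval s) ≤ (a.sz * (l + 1)) * (b.sz * (l + 1)) :=
        Nat.mul_le_mul la lb
      have pa := a.sz_pos
      have pb := b.sz_pos
      have : 4 * a.sz ^ 3 + 4 * b.sz ^ 3 + 2 * (a.sz * b.sz) ≤ 4 * (a.sz + b.sz + 1) ^ 3 := by
        have h : a.sz * b.sz ≤ (a.sz + b.sz) * (a.sz * b.sz) := Nat.le_mul_of_pos_left _ (by omega)
        nlinarith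
      have := Nat.mul_le_mul_right ((l + 1) ^ 2) this
      nlinarith
    · simp only [Function.update_self, Ex.eval, hr₂]
      rw [hf₂ t (by omega)]; simp only [hr₁]
    · intro r hr
      simp only [Function.update_of_ne (show r ≠ t by omega)]
      rw [hf₂ r (by omega)]; exact hf₁ r hr
  | ld a ih =>
    obtain ⟨m₁, r₁, h₁, hm₁, hr₁, hf₁⟩ := ih t ht σ hσ
    refine ⟨_, _, .seq h₁ (.load _ _ _), ?_, ?_, ?_⟩
    · simp only [hr₁, Ex.sz, hσ.2]
      have la := a.len_eval_le hs
      have lm := len_le_of_lt (hs.2 (a.eval s))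
      have pa := a.sz_pos
      have : 4 * a.sz ^ 3 + a.sz + 1 ≤ 4 * (a.sz + 1) ^ 3 := by nlinarith
      have := Nat.mul_le_mul_right ((l + 1) ^ 2) this
      nlinarith
    · simp [Ex.eval, hr₁, hσ.2]
    · intro r hr
      simp only [Function.update_of_ne (show r ≠ t by omega)]
      exact hf₁ r hr

/-- `v := e` -/
def setP (v : Var) (e : Ex) : Prog :=
  .seq (e.compile 40) (.seq (.const 41 0) (.arith .add v.idx 40 41))

/-- `mem a := e` -/
def storeP (a e : Ex) : Prog := .seq (a.compile 40) (.seq (e.compile 41) (.store 40 41))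

/-- if `0 < e` then `p` else `q` -/
def iteP (e : Ex) (p q : Prog) : Prog := .seq (e.compile 40) (.ite 40 p q)

/-- while `0 < e` do `p` -/
def whileP (e : Ex) (p : Prog) : Prog :=
  .seq (e.compile 40) (.loop 40 (.seq p (e.compile 40)))

/-- The cost of an elementary step when all values have less than `l` bits. -/
def unit (l : ℕ) : ℕ := 12 * 100 ^ 3 * (l + 1) ^ 2

/-- Started with the values `s`, all having less than `l` bits, the program `p` halts with values
satisfying `Q`, again having less than `l` bits, and its cost is that of at most `m` elementary
steps. -/
def Runs (l : ℕ) (p : Prog) (s : St) (m : ℕ) (Q : St → Prop) : Prop :=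
  s.Bdd l → ∀ σ, Rep s σ → ∃ t σ' s', Exec p σ t σ' ∧ Rep s' σ' ∧ s'.Bdd l ∧ t ≤ m * unit l ∧ Q s'

variable {l : ℕ} {p q : Prog} {s : St} {m m' : ℕ} {Q Q' : St → Prop}

theorem Runs.mono (h : Runs l p s m Q) (hm : m ≤ m') (hQ : ∀ s, Q s → Q' s) : Runs l p s m' Q' := by
  intro hs σ hσ
  obtain ⟨t, σ', s', h1, h2, h3, h4, h5⟩ := h hs σ hσ
  exact ⟨t, σ', s', h1, h2, h3, h4.trans (Nat.mul_le_mul_right _ hm), hQ _ h5⟩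

/-- Values that are merely copied or loaded need no bound of their own; they inherit it from the
state. -/
theorem Runs.with_bdd (h : s.Bdd l → Runs l p s m Q) : Runs l p s m Q := fun hs => h hs hs

theorem Runs.skip (h : Q s) : Runs l .skip s 1 Q := fun hs σ hσ =>
  ⟨_, _, s, .skip _, hσ, hs, Nat.succ_le_of_lt (by unfold unit; positivity), h⟩

theorem Runs.seq {m₁ m₂ : ℕ} (h : Runs l p s m₁ fun s' => Runs l q s' m₂ Q) :
    Runs l (.seq p q) s (m₁ + m₂) Q := by
  intro hs σ hσ
  obtain ⟨t, σ', s', h1, h2, h3, h4, h5⟩ := h hs σ hσ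
  obtain ⟨t', σ'', s'', g1, g2, g3, g4, g5⟩ := h5 h3 σ' h2
  exact ⟨_, _, _, .seq h1 g1, g2, g3, by rw [add_mul]; omega, g5⟩

theorem cube_bound {a : ℕ} (ha : a ≤ 100) :
    4 * a ^ 3 * (l + 1) ^ 2 ≤ 4 * 100 ^ 3 * (l + 1) ^ 2 := by gcongr

theorem len_bound {a : ℕ} (ha : a ≤ 100) : a * (l + 1) ≤ 100 * (l + 1) ^ 2 := by
  nlinarith [Nat.mul_le_mul_right (l + 1) ha]

theorem Rep.set {σ : State} (h : Rep s σ) (v : Var) (z : ℤ) {reg : ℕ → ℤ}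
    (hr : ∀ v' : Var, reg v'.idx = if v' = v then z else σ.reg v'.idx) :
    Rep (s.set v z) { σ with reg := reg } := by
  refine ⟨fun v' => ?_, by rw [s.set_mem]; exact h.2⟩
  refine (hr v').trans ?_
  split_ifs with e
  · rw [e, s.get_set_self]
  · rw [s.get_set_ne z e, h.1]

theorem Runs.set {v : Var} {e : Ex} (he : e.sz ≤ 100) (hb : |e.eval s| < 2 ^ l)
    (h : Q (s.set v (e.eval s))) : Runs l (setP v e) s 1 Q := by
  intro hs σ hσ
  obtain ⟨m, reg, h1, h2, h3, h4⟩ := e.exec_compile hs 40 le_rfl σ hσ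
  refine ⟨_, _, _, .seq h1 (.seq (.const _ _ _) (.arith _ _ _ _ _)), hσ.set v (e.eval s) ?_, ?_, ?_, h⟩
  · intro v'
    have hv : v'.idx ≠ 41 := by have := v'.idx_lt; omega
    split_ifs with h5
    · subst h5; simp [Op.eval, h3]
    · have : v'.idx ≠ v.idx := fun h => h5 (Var.idx_inj h)
      simp [Function.update_of_ne this, Function.update_of_ne hv, h4 v'.idx v'.idx_lt]
  · refine ⟨fun v' => ?_, by rw [s.set_mem]; exact hs.2⟩
    by_cases e : v' = v
    · rw [e, s.get_set_self]; exact hb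
    · rw [s.get_set_ne _ e]; exact hs.1 v'
  · have h0 : len 0 = 1 := by simp [len]
    simp only [Function.update_self, h3, Op.cost, h0, Function.update_of_ne (show 40 ≠ 41 by norm_num)]
    have := e.len_eval_le hs
    have := cube_bound (l := l) he
    have := len_bound (l := l) he
    unfold unit
    nlinarith

theorem Runs.store {a e : Ex} (ha : a.sz ≤ 100) (he : e.sz ≤ 100) (hb : |e.eval s| < 2 ^ l)
    (h : Q { s with mem := Function.update s.mem (a.eval s) (e.eval s) }) :
    Runs l (storeP a e) s 1 Q := by
  intro hs σ hσ
  obtain ⟨m, reg, h1, h2, h3, h4⟩ := a.exec_compile hs 40 le_rfl σ hσ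
  obtain ⟨m₂, r₂, g1, g2, g3, g4⟩ := e.exec_compile hs 41 (by omega) { σ with reg := reg }
      ⟨fun v => by rw [← hσ.1 v]; exact h4 _ v.idx_lt, hσ.2⟩
  have e1 : r₂ 40 = a.eval s := by rw [g4 40 (by omega)]; exact h3
  refine ⟨_, _, { s with mem := Function.update s.mem (a.eval s) (e.eval s) },
    .seq h1 (.seq g1 (.store _ _ _)), ?_, ?_, ?_, h⟩
  · refine ⟨fun v => ?_, ?_⟩
    · show r₂ v.idx = _
      have := v.idx_lt
      rw [g4 _ (by omega)]
      show reg v.idx = _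
      rw [h4 _ (by omega), hσ.1]; cases v <;> rfl
    · simp [e1, g3, hσ.2]
  · refine ⟨fun v => ?_, fun z => ?_⟩
    · have := hs.1 v
      cases v <;> exact this
    · by_cases hz : z = a.eval s
      · subst hz; simpa using hb
      · simpa [Function.update_of_ne hz] using hs.2 z
  · simp only [e1, g3]
    have := e.len_eval_le hs
    have := a.len_eval_le hs
    have := cube_bound (l := l) he
    have := len_bound (l := l) he
    have := cube_bound (l := l) ha
    have := len_bound (l := l) ha
    unfold unit
    nlinarith

theorem Rep.reg {σ : State} (h : Rep s σ) {reg : ℕ → ℤ} (hr : ∀ r, r < 40 → reg r = σ.reg r) :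
    Rep s { σ with reg := reg } :=
  ⟨fun v => by rw [← h.1 v]; exact hr _ v.idx_lt, h.2⟩

theorem cond_bound {e : Ex} (hs : s.Bdd l) (he : e.sz ≤ 100) :
    4 * e.sz ^ 3 * (l + 1) ^ 2 + len (e.eval s) ≤ unit l := by
  have := e.len_eval_le hs
  have := cube_bound (l := l) he
  have := len_bound (l := l) he
  unfold unit
  nlinarith

theorem Runs.ite {e : Ex} (he : e.sz ≤ 100) (hp : 0 < e.eval s → Runs l p s m Q)
    (hq : ¬ 0 < e.eval s → Runs l q s m Q) : Runs l (iteP e p q) s (m + 1) Q := by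
  intro hs σ hσ
  obtain ⟨m₁, reg, h1, h2, h3, h4⟩ := e.exec_compile hs 40 le_rfl σ hσ
  have hr := hσ.reg h4
  have hc := cond_bound hs he
  by_cases h : 0 < e.eval s
  · obtain ⟨t, σ', s', g1, g2, g3, g4, g5⟩ := hp h hs _ hr
    refine ⟨_, _, _, .seq h1 (.ite_pos (by simpa [h3] using h) g1), g2, g3, ?_, g5⟩
    simp only [h3, add_mul]; omega
  · obtain ⟨t, σ', s', g1, g2, g3, g4, g5⟩ := hq h hs _ hr
    refine ⟨_, _, _, .seq h1 (.ite_neg (by simpa [h3] using h) g1), g2, g3, ?_, g5⟩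
    simp only [h3, add_mul]; omega

/-- The rule for loops: `I k` holds when `k` iterations are left. -/
theorem Runs.while {e : Ex} (he : e.sz ≤ 100) (I : ℕ → St → Prop) (k : ℕ) (h : I k s)
    (hpos : ∀ k s, I (k + 1) s → s.Bdd l → 0 < e.eval s ∧ Runs l p s m (I k))
    (hzero : ∀ s, I 0 s → ¬ 0 < e.eval s) :
    Runs l (whileP e p) s (k * (m + 2) + 2) (I 0) := by
  -- The loop instruction tests a register, so the induction also carries that register 40 holds the
  -- current value of the test, which is recomputed after each pass.
  suffices H : ∀ (k : ℕ) (s : St) (σ : State), I k s → s.Bdd l → Rep s σ → σ.reg 40 = e.eval s →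
      ∃ t σ' s', Exec (.loop 40 (.seq p (e.compile 40))) σ t σ' ∧ Rep s' σ' ∧ s'.Bdd l ∧
        t ≤ (k * (m + 2) + 1) * unit l ∧ I 0 s' by
    intro hs σ hσ
    obtain ⟨m₁, reg, h1, h2, h3, h4⟩ := e.exec_compile hs 40 le_rfl σ hσ
    obtain ⟨t, σ', s', g1, g2, g3, g4, g5⟩ := H k s _ h hs (hσ.reg h4) h3
    refine ⟨_, _, _, .seq h1 g1, g2, g3, ?_, g5⟩
    have := cond_bound hs he
    have e1 : (k * (m + 2) + 2) * unit l = (k * (m + 2) + 1) * unit l + unit l := by ring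
    omega
  intro k
  induction k with
  | zero =>
    intro s σ h hs hσ hr
    refine ⟨_, _, _, Exec.loop_stop (by rw [hr]; exact hzero s h), hσ, hs, ?_, h⟩
    have := cond_bound hs he
    rw [hr]; omega
  | succ k ih =>
    intro s σ h hs hσ hr
    obtain ⟨hc, hp⟩ := hpos k s h hs
    obtain ⟨t, σ', s', g1, g2, g3, g4, g5⟩ := hp hs σ hσ
    obtain ⟨m₁, reg, h1, h2, h3, h4⟩ := e.exec_compile g3 40 le_rfl σ' g2
    obtain ⟨t', σ'', s'', f1, f2, f3, f4, f5⟩ := ih s' _ g5 g3 (g2.reg h4) h3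
    refine ⟨_, _, _, .loop_step (by rw [hr]; exact hc) (.seq g1 h1) f1, f2, f3, ?_, f5⟩
    have c1 := cond_bound hs he
    have c2 := cond_bound g3 he
    have e1 : ((k + 1) * (m + 2) + 1) * unit l
      = (k * (m + 2) + 1) * unit l + m * unit l + unit l + unit l := by ring
    rw [hr]; omega

theorem Runs.set_seq {v : Var} {e : Ex} (he : e.sz ≤ 100) (hb : |e.eval s| < 2 ^ l)
    (h : Runs l p (s.set v (e.eval s)) m Q) : Runs l (.seq (setP v e) p) s (m + 1) Q := by
  rw [add_comm]; exact Runs.seq (Runs.set he hb h)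

theorem Runs.store_seq {a e : Ex} (ha : a.sz ≤ 100) (he : e.sz ≤ 100) (hb : |e.eval s| < 2 ^ l)
    (h : Runs l p { s with mem := Function.update s.mem (a.eval s) (e.eval s) } m Q) :
    Runs l (.seq (storeP a e) p) s (m + 1) Q := by
  rw [add_comm]; exact Runs.seq (Runs.store ha he hb h)

end RAM

/-! ### Configurations, and soundness of a visit. -/

namespace Polytree

/-- A configuration of the search: the visited nodes and, for each slot `i`, the node `q i` that
it holds (as a set with at most one element) and the set `R i` of its parents still to be visited. -/
@[ext] structure Cfg (V : Type*) where
  S : Finset V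
  q : ℕ → Finset V
  R : ℕ → Finset V

section Search

variable {V : Type*}

theorem skeleton_adj {D : V → Finset V} {u v : V} :
    (skeleton D).Adj u v ↔ u ≠ v ∧ (u ∈ D v ∨ v ∈ D u) := by
  simp [skeleton, SimpleGraph.fromRel_adj, Arc]

theorem IsDAG.not_mem_self {D : V → Finset V} (h : IsDAG D) (v : V) : v ∉ D v :=
  fun hv => h v (.single hv)

theorem IsDAG.asymm {D : V → Finset V} (h : IsDAG D) {u v : V} (huv : u ∈ D v) : v ∉ D u :=
  fun hvu => h v (.tail (.single hvu) huv)

theorem isDAG_of_rank {D : V → Finset V} (rank : V → ℤ) (h : ∀ v u, u ∈ D v → rank u < rank v) :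
    IsDAG D := by
  have key : ∀ u v, Relation.TransGen (Arc D) u v → rank u < rank v := by
    intro u v huv
    induction huv with
    | single h1 => exact h _ _ h1
    | tail _ h1 ih => exact ih.trans (h _ _ h1)
  exact fun v hv => lt_irrefl _ (key v v hv)

open Classical in
/-- The component of `x` in the subgraph induced by `T`. -/
noncomputable def comp (G : SimpleGraph V) (T : Finset V) (x : V) : Finset V :=
  T.filter fun y => Relation.ReflTransGen (fun a b => G.Adj a b ∧ a ∈ T ∧ b ∈ T) x y

variable {G : SimpleGraph V}

theorem comp_subset (T : Finset V) (x : V) : comp G T x ⊆ T := by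
  intro y hy
  simp only [comp, Finset.mem_filter] at hy
  exact hy.1

theorem mem_comp_self {T : Finset V} {x : V} (hx : x ∈ T) : x ∈ comp G T x := by
  simp [comp, hx, Relation.ReflTransGen.refl]

theorem mem_comp_of_adj {T : Finset V} {x y z : V} (hy : y ∈ comp G T x) (h : G.Adj y z)
    (hz : z ∈ T) : z ∈ comp G T x := by
  simp only [comp, Finset.mem_filter] at hy ⊢
  exact ⟨hz, hy.2.tail ⟨h, hy.1, hz⟩⟩

theorem comp_mono {T T' : Finset V} (h : T' ⊆ T) (x : V) : comp G T' x ⊆ comp G T x := by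
  intro y hy
  simp only [comp, Finset.mem_filter] at hy ⊢
  exact ⟨h hy.1, Relation.ReflTransGen.mono (fun a b hab => ⟨hab.1, h hab.2.1, h hab.2.2⟩) _ _ hy.2⟩

/-- Two such neighbours would close a cycle through p. Formally, the edge yp is a bridge, but a walk
inside T from y to z avoids p, and the edge zp then leads back to p. -/
theorem comp_adj_unique (hG : G.IsAcyclic) {T : Finset V} {x p y z : V} (hp : p ∉ T)
    (hy : y ∈ comp G T x) (hz : z ∈ comp G T x) (hyp : G.Adj y p) (hzp : G.Adj z p) : y = z := by
  by_contra hne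
  have hb := SimpleGraph.isAcyclic_iff_forall_isBridge.1 hG ((SimpleGraph.mem_edgeSet G).2 hyp)
  rw [SimpleGraph.isBridge_iff] at hb
  simp only [comp, Finset.mem_filter] at hy hz
  have key : ∀ w, Relation.ReflTransGen (fun a b => G.Adj a b ∧ a ∈ T ∧ b ∈ T) x w →
      (G \ SimpleGraph.fromEdgeSet {s(y, p)}).Reachable x w := by
    intro w hw
    induction hw with
    | refl => exact .refl _
    | tail _ h ih =>
      refine ih.trans (SimpleGraph.Adj.reachable ?_)
      obtain ⟨h1, h2, h3⟩ := h
      rw [SimpleGraph.sdiff_adj]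
      refine ⟨h1, ?_⟩
      rw [SimpleGraph.fromEdgeSet_adj]
      rintro ⟨h4, -⟩
      simp only [Set.mem_singleton_iff, Sym2.eq_iff] at h4
      rcases h4 with ⟨-, rfl⟩ | ⟨rfl, -⟩
      · exact hp h3
      · exact hp h2
  refine hb (((key y hy.2).symm.trans (key z hz.2)).trans (SimpleGraph.Adj.reachable ?_))
  rw [SimpleGraph.sdiff_adj]
  refine ⟨hzp, ?_⟩
  rw [SimpleGraph.fromEdgeSet_adj]
  rintro ⟨h4, -⟩
  simp only [Set.mem_singleton_iff, Sym2.eq_iff] at h4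
  rcases h4 with ⟨h, -⟩ | ⟨h, h'⟩
  · exact hne h.symm
  · exact hne (h'.symm.trans h.symm)

/-- A component has a node that is the only possible neighbour of a node outside. -/
theorem exists_root (hG : G.IsAcyclic) {T : Finset V} {x : V} (hx : x ∈ T) (q : Finset V)
    (hq : q.card ≤ 1) (hqT : ∀ p ∈ q, p ∉ T) :
    ∃ r ∈ comp G T x, ∀ y ∈ comp G T x, ∀ p ∈ q, G.Adj y p → y = r := by
  by_cases h : ∃ y ∈ comp G T x, ∃ p ∈ q, G.Adj y p
  · obtain ⟨r, hr, p, hp, hrp⟩ := h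
    refine ⟨r, hr, fun y hy p' hp' hyp => ?_⟩
    rw [Finset.card_le_one.1 hq p' hp' p hp] at hyp
    exact comp_adj_unique hG (hqT p hp) hy hr hyp hrp
  · push Not at h
    exact ⟨x, mem_comp_self hx, fun y hy p hp hyp => absurd hyp (h y hy p hp)⟩

/-- As v is isolated in the old skeleton, it is not connected to p there, so the edge vp closes no
cycle. -/
theorem skeleton_acyclic_extend {D D' : V → Finset V} {v p : V} (hD : (skeleton D).IsAcyclic)
    (hv : ∀ x y, y ∈ D x → x ≠ v ∧ y ≠ v) (hpv : p ≠ v)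
    (h : ∀ x y, y ∈ D' x → y ∈ D x ∨ (x = v ∧ y = p) ∨ (x = p ∧ y = v)) :
    (skeleton D').IsAcyclic := by
  have hr : ¬ (skeleton D).Reachable v p := by
    rintro ⟨w⟩
    cases w with
    | nil => exact hpv rfl
    | cons ha _ =>
      rcases (skeleton_adj.1 ha).2 with h1 | h1
      · exact (hv _ _ h1).2 rfl
      · exact (hv _ _ h1).1 rfl
  refine SimpleGraph.IsAcyclic.anti ?_ (hD.sup_edge_of_not_reachable hr)
  intro x y hxy
  obtain ⟨hne, h1⟩ := skeleton_adj.1 hxy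
  rw [SimpleGraph.sup_adj, SimpleGraph.edge_adj, skeleton_adj]
  rcases h1 with h1 | h1 <;> rcases h _ _ h1 with h2 | h2 | h2 <;> grind

variable [DecidableEq V]

/-- The pending sets after `v` has been attached to the node in slot `i`. -/
def Cfg.mid (c : Cfg V) (v : V) (i : ℕ) : ℕ → Finset V :=
  Function.update c.R i ((c.R i).erase v)

/-- `v` can be visited with parent set `P`, attached to the node in slot `i`, and put into the
slot `j`. -/
def Cfg.Ok (c : Cfg V) (v : V) (P : Finset V) (i j : ℕ) : Prop :=
  v ∉ c.S ∧ ¬ (v ∈ c.R i ∧ (c.q i ∩ P).Nonempty) ∧ c.mid v i j = ∅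

/-- The configuration after this visit. -/
def Cfg.next (c : Cfg V) (v : V) (P : Finset V) (i j : ℕ) : Cfg V :=
  ⟨insert v c.S, Function.update c.q j {v}, Function.update (c.mid v i) j (P \ c.q i)⟩

/-- The initial configuration. -/
def Cfg.start : Cfg V := ⟨∅, fun _ => ∅, fun _ => ∅⟩

/-- The part of the chosen graph `H` that has been visited so far is a polytree. -/
def Realized (L : ℕ) (c : Cfg V) (H : V → Finset V) : Prop :=
  ∃ (D : V → Finset V) (rank : V → ℤ),
    (∀ v u, u ∈ D v → rank u < rank v) ∧ (skeleton D).IsAcyclic ∧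
    (∀ v u, u ∈ D v → u ∈ c.S ∧ v ∈ c.S) ∧ (∀ v, D v ⊆ H v) ∧ (∀ v, v ∉ c.S → H v = ∅) ∧
    (∀ i p, p ∈ c.q i → p ∈ c.S ∧ c.R i ⊆ H p) ∧
    (∀ i, (c.R i).Nonempty → (c.q i).Nonempty) ∧ (∀ i, (c.q i).card ≤ 1) ∧
    ∀ v ∈ c.S, H v ⊆ D v ∨ ∃ i < L, v ∈ c.q i ∧ H v ⊆ D v ∪ c.R i

theorem realized_start (L : ℕ) : Realized L (Cfg.start : Cfg V) (fun _ => ∅) := by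
  refine ⟨fun _ => ∅, fun _ => 0, by simp, ?_, by simp, by simp, by simp, by simp [Cfg.start],
    by simp [Cfg.start], by simp [Cfg.start], by simp [Cfg.start]⟩
  have : skeleton (fun _ : V => (∅ : Finset V)) = ⊥ := by
    ext x y; simp [skeleton_adj]
  rw [this]; exact SimpleGraph.isAcyclic_bot

/-- The node v is isolated among the realized arcs and receives at most one: from the node p in slot
i if p is in P, to p if v was pending there, or none, which opens a new component. `Cfg.Ok` forbids
both directions at once and demands that the node evicted from slot j has no parents left to wait
for. -/
theorem Realized.next {L : ℕ} {c : Cfg V} {H : V → Finset V} (h : Realized L c H) {v : V}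
    {P : Finset V} {i j : ℕ} (hvP : v ∉ P) (hi : i < L) (hj : j < L) (ok : c.Ok v P i j) :
    Realized L (c.next v P i j) (Function.update H v P) := by
  obtain ⟨D, rank, h1, h2, h3, h4, h5, h6, h7, h8, h9⟩ := h
  obtain ⟨hvS, hab, hmid⟩ := ok
  have hDv : D v = ∅ := Finset.eq_empty_of_forall_notMem fun u hu => hvS (h3 v u hu).2
  have hvD : ∀ x, v ∉ D x := fun x hx => hvS (h3 x v hx).1
  have hone : ∀ p ∈ c.q i, ∀ p' ∈ c.q i, p = p' := fun p hp p' hp' =>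
    Finset.card_le_one.1 (h8 i) p hp p' hp'
  have hiso : ∀ x y, y ∈ D x → x ≠ v ∧ y ≠ v := fun x y hy =>
    ⟨by rintro rfl; simp [hDv] at hy, by rintro rfl; exact hvD x hy⟩
  -- it suffices to give the realized arcs and the ranks
  have main : ∀ (D' : V → Finset V) (rank' : V → ℤ), (∀ v u, u ∈ D' v → rank' u < rank' v) →
      (skeleton D').IsAcyclic → (∀ x u, u ∈ D' x → u ∈ insert v c.S ∧ x ∈ insert v c.S) →
      (∀ x, D x ⊆ D' x) → (∀ x, x ≠ v → D' x ⊆ H x) → D' v ⊆ P → P ⊆ D' v ∪ (P \ c.q i) →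
      (v ∈ c.R i → ∀ p ∈ c.q i, v ∈ D' p) →
      Realized L (c.next v P i j) (Function.update H v P) := by
    intro D' rank' g1 g2 g3 g4 g5 g6 g7 g8
    refine ⟨D', rank', g1, g2, g3, ?_, ?_, ?_, ?_, ?_, ?_⟩
    · intro x
      by_cases hx : x = v
      · subst hx; simpa using g6
      · simpa [Function.update_of_ne hx] using g5 x hx
    · intro x hx
      simp only [Cfg.next, Finset.mem_insert, not_or] at hx
      rw [Function.update_of_ne hx.1]; exact h5 x hx.2
    · intro i' p hp
      simp only [Cfg.next, Cfg.mid] at hp ⊢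
      by_cases hij : i' = j
      · subst hij
        simp only [Function.update_self, Finset.mem_singleton] at hp ⊢
        subst hp
        simp
      · rw [Function.update_of_ne hij] at hp ⊢
        have := h6 i' p hp
        have hpv : p ≠ v := by rintro rfl; exact hvS this.1
        refine ⟨Finset.mem_insert_of_mem this.1, ?_⟩
        rw [Function.update_of_ne hpv]
        by_cases hii : i' = i
        · subst hii; rw [Function.update_self]; exact (Finset.erase_subset _ _).trans this.2
        · rw [Function.update_of_ne hii]; exact this.2
    · intro i' hne
      simp only [Cfg.next, Cfg.mid] at hne ⊢
      by_cases hij : i' = j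
      · subst hij; simp
      · rw [Function.update_of_ne hij] at hne ⊢
        by_cases hii : i' = i
        · subst hii; rw [Function.update_self] at hne
          exact h7 _ (hne.mono (Finset.erase_subset _ _))
        · rw [Function.update_of_ne hii] at hne; exact h7 _ hne
    · intro i'
      simp only [Cfg.next]
      by_cases hij : i' = j
      · subst hij; simp
      · rw [Function.update_of_ne hij]; exact h8 i'
    · intro x hx
      simp only [Cfg.next] at hx ⊢
      by_cases hxv : x = v
      · subst hxv
        refine .inr ⟨j, hj, ?_⟩
        simp only [Function.update_self, Finset.mem_singleton, true_and]; exact g7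
      · rw [Function.update_of_ne hxv]
        rcases h9 x (by simpa [hxv] using hx) with h | ⟨i', hi', hq, h⟩
        · exact .inl (h.trans (g4 x))
        · have key : H x ⊆ D' x ∪ c.mid v i i' := by
            intro y hy
            have := h hy
            simp only [Cfg.mid]
            by_cases hii : i' = i
            · subst hii
              rw [Function.update_self]
              simp only [Finset.mem_union, Finset.mem_erase] at this ⊢
              by_cases hyv : y = v
              · subst hyv
                rcases this with this | this
                · exact .inl (g4 x this)
                · exact .inl (g8 this x hq)
              · exact this.imp (fun h => g4 x h) (fun h => ⟨hyv, h⟩)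
            · rw [Function.update_of_ne hii]
              simp only [Finset.mem_union] at this ⊢
              exact this.imp (fun h => g4 x h) id
          -- The node evicted from slot j has an empty pending set, so all its chosen parents are
          -- realized by now.
          by_cases hij : i' = j
          · subst hij; rw [hmid, Finset.union_empty] at key; exact .inl key
          · refine .inr ⟨i', hi', ?_⟩
            rw [Function.update_of_ne hij, Function.update_of_ne hij]
            exact ⟨hq, key⟩
  by_cases hb : (c.q i ∩ P).Nonempty
  · obtain ⟨p, hp⟩ := hb
    obtain ⟨hpq, hpP⟩ := Finset.mem_inter.1 hp
    have hpS := (h6 i p hpq).1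
    have hpv : p ≠ v := by rintro rfl; exact hvS hpS
    -- Here p is a parent of v. Since v lies on no other realized arc, its rank is only constrained
    -- by that of p.
    refine main (Function.update D v {p}) (Function.update rank v (rank p + 1)) ?_ ?_ ?_ ?_ ?_ ?_ ?_ ?_
    · intro x u hu
      by_cases hx : x = v
      · subst hx
        simp only [Function.update_self, Finset.mem_singleton] at hu
        subst hu
        simp [Function.update_of_ne hpv]
      · rw [Function.update_of_ne hx] at hu
        rw [Function.update_of_ne hx, Function.update_of_ne (hiso x u hu).2]
        exact h1 x u hu
    · refine skeleton_acyclic_extend h2 hiso hpv fun x y hy => ?_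
      by_cases hx : x = v
      · subst hx
        simp only [Function.update_self, Finset.mem_singleton] at hy
        exact .inr (.inl ⟨rfl, hy⟩)
      · rw [Function.update_of_ne hx] at hy; exact .inl hy
    · intro x u hu
      by_cases hx : x = v
      · subst hx
        simp only [Function.update_self, Finset.mem_singleton] at hu
        subst hu
        simp [hpS]
      · rw [Function.update_of_ne hx] at hu
        exact ⟨Finset.mem_insert_of_mem (h3 x u hu).1, Finset.mem_insert_of_mem (h3 x u hu).2⟩
    · intro x
      by_cases hx : x = v
      · subst hx; simp [hDv]
      · rw [Function.update_of_ne hx]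
    · intro x hx
      rw [Function.update_of_ne hx]; exact h4 x
    · simpa using hpP
    · intro y hy
      simp only [Function.update_self, Finset.mem_union, Finset.mem_singleton, Finset.mem_sdiff]
      by_cases hyq : y ∈ c.q i
      · exact .inl (hone y hyq p hpq)
      · exact .inr ⟨hy, hyq⟩
    · exact fun hvR => absurd ⟨hvR, ⟨p, hp⟩⟩ hab
  have hPq : P \ c.q i = P := by
    rw [Finset.sdiff_eq_self_iff_disjoint, Finset.disjoint_left]
    exact fun y hy hyq => hb ⟨y, Finset.mem_inter.2 ⟨hyq, hy⟩⟩
  by_cases ha : v ∈ c.R i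
  · obtain ⟨p, hpq⟩ := h7 i ⟨v, ha⟩
    have hpS := (h6 i p hpq).1
    have hpv : p ≠ v := by rintro rfl; exact hvS hpS
    -- Here v is a parent of p. Ranks are integers, so there is always room below.
    refine main (Function.update D p (insert v (D p))) (Function.update rank v (rank p - 1))
      ?_ ?_ ?_ ?_ ?_ ?_ ?_ ?_
    · intro x u hu
      by_cases hx : x = p
      · subst hx
        rw [Function.update_self, Finset.mem_insert] at hu
        rw [Function.update_of_ne hpv]
        rcases hu with rfl | hu
        · simp
        · rw [Function.update_of_ne (hiso x u hu).2]; exact h1 x u hu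
      · rw [Function.update_of_ne hx] at hu
        rw [Function.update_of_ne (hiso x u hu).1, Function.update_of_ne (hiso x u hu).2]
        exact h1 x u hu
    · refine skeleton_acyclic_extend h2 hiso hpv fun x y hy => ?_
      by_cases hx : x = p
      · subst hx
        rw [Function.update_self, Finset.mem_insert] at hy
        rcases hy with rfl | hy
        · exact .inr (.inr ⟨rfl, rfl⟩)
        · exact .inl hy
      · rw [Function.update_of_ne hx] at hy; exact .inl hy
    · intro x u hu
      by_cases hx : x = p
      · subst hx
        rw [Function.update_self, Finset.mem_insert] at hu
        rcases hu with rfl | hu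
        · simp [hpS]
        · exact ⟨Finset.mem_insert_of_mem (h3 x u hu).1, Finset.mem_insert_of_mem (h3 x u hu).2⟩
      · rw [Function.update_of_ne hx] at hu
        exact ⟨Finset.mem_insert_of_mem (h3 x u hu).1, Finset.mem_insert_of_mem (h3 x u hu).2⟩
    · intro x
      by_cases hx : x = p
      · subst hx; simp
      · rw [Function.update_of_ne hx]
    · intro x _
      by_cases hx : x = p
      · subst hx; rw [Function.update_self]
        exact Finset.insert_subset ((h6 i x hpq).2 ha) (h4 x)
      · rw [Function.update_of_ne hx]; exact h4 x
    · rw [Function.update_of_ne hpv.symm, hDv]; simp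
    · rw [hPq]; exact Finset.subset_union_right
    · intro _ p' hp'
      rw [hone p' hp' p hpq]; simp
  · refine main D rank h1 h2 ?_ (fun _ => subset_rfl) (fun x _ => h4 x) (by simp [hDv]) ?_ ?_
    · exact fun x u hu => ⟨Finset.mem_insert_of_mem (h3 x u hu).1, Finset.mem_insert_of_mem (h3 x u hu).2⟩
    · rw [hPq]; exact Finset.subset_union_right
    · exact fun h => absurd h ha

/-! ### Every polytree can be searched with few slots -/

/-- Sequences of visits in which each node gets the parent set that it has in `D`. -/
def Visits (L : ℕ) (D : V → Finset V) : Cfg V → Cfg V → Prop :=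
  Relation.ReflTransGen fun c c' => ∃ v i j, i < L ∧ j < L ∧ c.Ok v (D v) i j ∧
    c' = c.next v (D v) i j

/-- The nodes in `T` have not been visited, and all arcs that leave `T` go to the node in
slot `i`. -/
structure Hang (D : V → Finset V) (c : Cfg V) (T : Finset V) (i : ℕ) : Prop where
  not_mem : ∀ x ∈ T, x ∉ c.S
  q_sub : c.q i ⊆ c.S
  q_card : (c.q i).card ≤ 1
  adj : ∀ x ∈ T, ∀ y, (skeleton D).Adj x y → y ∈ T ∨ y ∈ c.q i
  pend : ∀ x ∈ T, (x ∈ c.R i ↔ ∃ p ∈ c.q i, x ∈ D p)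

/-- The configuration `c'` arises from `c` by visiting `T` with the help of the slots below `d`. -/
structure Done (d : ℕ) (c : Cfg V) (T : Finset V) (i : ℕ) (c' : Cfg V) : Prop where
  S_eq : c'.S = c.S ∪ T
  q_eq : ∀ j, d ≤ j → c'.q j = c.q j
  R_eq : ∀ j, d ≤ j → c'.R j = if j = i then c.R j \ T else c.R j
  R_low : ∀ j < d, c'.R j = ∅

theorem Done.trans {d i : ℕ} {c c₁ c₂ : Cfg V} {T₁ T₂ : Finset V} (h₁ : Done d c T₁ i c₁)
    (h₂ : Done d c₁ T₂ i c₂) : Done d c (T₁ ∪ T₂) i c₂ where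
  S_eq := by rw [h₂.S_eq, h₁.S_eq, Finset.union_assoc]
  q_eq j hj := by rw [h₂.q_eq j hj, h₁.q_eq j hj]
  R_eq j hj := by
    rw [h₂.R_eq j hj, h₁.R_eq j hj]
    split_ifs with h
    · rw [sdiff_sdiff_left]; rfl
    · rfl
  R_low := h₂.R_low

/-- Sets with components of less than `2 ^ d` nodes can be visited with the slots below `d`. -/
def SmallComps (L : ℕ) (D : V → Finset V) (d : ℕ) : Prop :=
  ∀ (c : Cfg V) (T : Finset V) (i : ℕ), Hang D c T i →
    (∀ x ∈ T, (comp (skeleton D) T x).card < 2 ^ d) → d ≤ i → i < L → (∀ j < d, c.R j = ∅) →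
    ∃ c', Visits L D c c' ∧ Done d c T i c'

/-- Rooted trees with less than `2 ^ (d + 1)` nodes can be visited with the slots up to `d`. -/
def SmallTree (L : ℕ) (D : V → Finset V) (d : ℕ) : Prop :=
  ∀ (m : ℕ) (c : Cfg V) (C : Finset V) (r : V) (i : ℕ), C.card = m → r ∈ C → Hang D c C i →
    (∀ x ∈ C, ∀ p ∈ c.q i, (skeleton D).Adj x p → x = r) → C.card < 2 ^ (d + 1) → d ≤ i → i < L →
    (∀ j < d, c.R j = ∅) → c.mid r i d = ∅ →
    ∃ c', Visits L D c c' ∧ Done (d + 1) c C i c'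

/-- The root occupies slot d while everything outside one large component is visited with the lower
slots. The root of the large component then evicts it from slot d, and the argument repeats on a
smaller set without using a further slot. -/
theorem SmallComps.smallTree {L d : ℕ} {D : V → Finset V} (hD : IsPolytree D)
    (hA : SmallComps L D d) : SmallTree L D d := by
  intro m
  induction m using Nat.strong_induction_on with
  | _ m ih =>
  intro c C r i hm hr hang hroot hcard hdi hiL hlow hmid
  have hrS := hang.not_mem r hr
  have adj_of : ∀ {x y}, x ∈ D y → (skeleton D).Adj x y := fun {x y} h =>
    skeleton_adj.2 ⟨fun e => hD.1.not_mem_self y (e ▸ h), .inl h⟩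
  have ok : c.Ok r (D r) i d := by
    refine ⟨hrS, ?_, hmid⟩
    rintro ⟨h1, p', hp'⟩
    obtain ⟨p, hp, h2⟩ := (hang.pend r hr).1 h1
    obtain ⟨h3, h4⟩ := Finset.mem_inter.1 hp'
    rw [Finset.card_le_one.1 hang.q_card p' h3 p hp] at h4
    exact hD.1.asymm h2 h4
  set c₁ := c.next r (D r) i d with hc₁
  have v1 : Visits L D c c₁ := .single ⟨r, i, d, hiL, by omega, ok, rfl⟩
  have S1 : c₁.S = insert r c.S := rfl
  have q1 : c₁.q d = {r} := by simp [hc₁, Cfg.next]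
  have R1 : c₁.R d = D r \ c.q i := by simp [hc₁, Cfg.next]
  have q1' : ∀ j, d + 1 ≤ j → c₁.q j = c.q j := fun j hj => by
    simp [hc₁, Cfg.next, Function.update_of_ne (show j ≠ d by omega)]
  have R1' : ∀ j, d + 1 ≤ j → c₁.R j = if j = i then c.R j \ C else c.R j := fun j hj => by
    simp only [hc₁, Cfg.next, Cfg.mid, Function.update_of_ne (show j ≠ d by omega)]
    split_ifs with h
    · subst h
      rw [Function.update_self]
      ext x
      simp only [Finset.mem_erase, Finset.mem_sdiff]
      constructor
      · rintro ⟨h1, h2⟩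
        refine ⟨h2, fun h3 => ?_⟩
        obtain ⟨p, hp, h4⟩ := (hang.pend x h3).1 h2
        exact h1 (hroot x h3 p hp (adj_of h4))
      · rintro ⟨h1, h2⟩
        exact ⟨fun h => h2 (h ▸ hr), h1⟩
    · rw [Function.update_of_ne h]
  have R1low : ∀ j < d, c₁.R j = ∅ := fun j hj => by
    simp only [hc₁, Cfg.next, Cfg.mid, Function.update_of_ne (show j ≠ d by omega)]
    rw [Function.update_of_ne (by omega)]; exact hlow j hj
  have hRd : ∀ x ∈ c₁.R d, x ∈ C.erase r ∧ (skeleton D).Adj x r := by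
    intro x hx
    rw [R1, Finset.mem_sdiff] at hx
    have ha := adj_of hx.1
    refine ⟨Finset.mem_erase.2 ⟨ha.ne, ?_⟩, ha⟩
    exact (hang.adj r hr x ha.symm).resolve_right hx.2
  have hang1 : Hang D c₁ (C.erase r) d := by
    refine ⟨?_, ?_, by simp [q1], ?_, ?_⟩
    · intro x hx
      rw [S1, Finset.mem_insert, not_or]
      exact ⟨(Finset.mem_erase.1 hx).1, hang.not_mem x (Finset.mem_erase.1 hx).2⟩
    · simp [q1, S1]
    · intro x hx y hxy
      obtain ⟨h1, h2⟩ := Finset.mem_erase.1 hx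
      rw [q1, Finset.mem_singleton, Finset.mem_erase]
      rcases hang.adj x h2 y hxy with h | h
      · tauto
      · exact absurd (hroot x h2 y h hxy) h1
    · intro x hx
      rw [R1, q1, Finset.mem_sdiff]
      have : x ∉ c.q i := fun h => hang.not_mem x (Finset.mem_erase.1 hx).2 (hang.q_sub h)
      simp [this]
  -- If no component is large, the lower slots suffice for all of them.
  by_cases hbig : ∃ x ∈ C.erase r, 2 ^ d ≤ (comp (skeleton D) (C.erase r) x).card
  · obtain ⟨x, hx, hH⟩ := hbig
    set T := C.erase r with hT
    set H := comp (skeleton D) T x with hHdef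
    have hHT : H ⊆ T := comp_subset T x
    have hTC : T.card + 1 = C.card := Finset.card_erase_add_one hr
    have cT : (T \ H).card + H.card = T.card := Finset.card_sdiff_add_card_eq_card hHT
    have p2 : 2 ^ (d + 1) = 2 ^ d + 2 ^ d := by ring
    have hang2 : Hang D c₁ (T \ H) d := by
      refine ⟨fun y hy => hang1.not_mem y (Finset.mem_sdiff.1 hy).1, hang1.q_sub, hang1.q_card, ?_,
        fun y hy => hang1.pend y (Finset.mem_sdiff.1 hy).1⟩
      intro y hy z hyz
      obtain ⟨h1, h2⟩ := Finset.mem_sdiff.1 hy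
      rcases hang1.adj y h1 z hyz with h | h
      · exact .inl (Finset.mem_sdiff.2 ⟨h, fun h3 => h2 (mem_comp_of_adj h3 hyz.symm h1)⟩)
      · exact .inr h
    -- With at least 2^d nodes in H, fewer than 2^d nodes remain outside H altogether, so each
    -- component there is small.
    obtain ⟨c₂, v2, d2⟩ := hA c₁ (T \ H) d hang2
      (fun y hy => (Finset.card_le_card (comp_subset _ _)).trans_lt (by omega)) le_rfl (by omega) R1low
    obtain ⟨r', hr', hroot'⟩ := exists_root hD.2 hx {r} (by simp)
      (fun p hp => by rw [Finset.mem_singleton.1 hp]; simp [hT])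
    have q2 : c₂.q d = {r} := by rw [d2.q_eq d le_rfl, q1]
    have R2 : c₂.R d = c₁.R d \ (T \ H) := by rw [d2.R_eq d le_rfl, if_pos rfl]
    have hang3 : Hang D c₂ H d := by
      refine ⟨?_, ?_, by simp [q2], ?_, ?_⟩
      · intro y hy
        rw [d2.S_eq, Finset.mem_union, not_or]
        exact ⟨hang1.not_mem y (hHT hy), fun h => (Finset.mem_sdiff.1 h).2 hy⟩
      · rw [q2, d2.S_eq, S1]; simp
      · intro y hy z hyz
        rw [q2, ← q1]
        exact (hang1.adj y (hHT hy) z hyz).imp_left fun h => mem_comp_of_adj hy hyz h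
      · intro y hy
        rw [R2, q2, ← q1, ← hang1.pend y (hHT hy), Finset.mem_sdiff]
        exact ⟨fun h => h.1, fun h => ⟨h, fun h' => (Finset.mem_sdiff.1 h').2 hy⟩⟩
    have hcardH := Finset.card_le_card hHT
    obtain ⟨c₃, v3, d3⟩ := ih H.card (by omega) c₂ H r' d rfl hr' hang3
      (fun y hy p hp hyp => hroot' y hy p (by rwa [q2] at hp) hyp) (by omega) le_rfl (by omega)
      d2.R_low (by
        rw [Cfg.mid, Function.update_self, R2]
        -- A parent of r that is still pending lies in H and is adjacent to r, so it is the root r'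
        -- of H, which is just being attached. Slot d becomes free.
        refine Finset.eq_empty_of_forall_notMem fun y hy => ?_
        obtain ⟨h1, h2⟩ := Finset.mem_erase.1 hy
        obtain ⟨h3, h4⟩ := Finset.mem_sdiff.1 h2
        obtain ⟨h5, h6⟩ := hRd y h3
        have h7 : y ∈ H := by
          by_contra h; exact h4 (Finset.mem_sdiff.2 ⟨h5, h⟩)
        exact h1 (hroot' y h7 r (Finset.mem_singleton_self r) h6))
    refine ⟨c₃, (v1.trans v2).trans v3, ⟨?_, ?_, ?_, d3.R_low⟩⟩
    · rw [d3.S_eq, d2.S_eq, S1, Finset.union_assoc, Finset.sdiff_union_of_subset hHT,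
        Finset.insert_union, ← Finset.union_insert, hT, Finset.insert_erase hr]
    · intro j hj
      rw [d3.q_eq j hj, d2.q_eq j (by omega), q1' j hj]
    · intro j hj
      rw [d3.R_eq j hj, if_neg (by omega), d2.R_eq j (by omega), if_neg (by omega), R1' j hj]
  · push Not at hbig
    obtain ⟨c₂, v2, d2⟩ := hA c₁ (C.erase r) d hang1 hbig le_rfl (by omega) R1low
    refine ⟨c₂, v1.trans v2, ⟨?_, ?_, ?_, ?_⟩⟩
    · rw [d2.S_eq, S1, Finset.insert_union, ← Finset.union_insert, Finset.insert_erase hr]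
    · intro j hj
      rw [d2.q_eq j (by omega), q1' j hj]
    · intro j hj
      rw [d2.R_eq j (by omega), if_neg (by omega), R1' j hj]
    · intro j hj
      by_cases hjd : j = d
      · subst hjd
        rw [d2.R_eq j le_rfl, if_pos rfl, Finset.sdiff_eq_empty_iff_subset]
        exact fun y hy => (hRd y hy).1
      · exact d2.R_low j (by omega)

/-- The components are visited one after the other. Each has a single possible neighbour of the node
in slot i and serves as a tree rooted there; slot i lies above d, so it keeps its node and only
loses pending parents. -/
theorem SmallTree.smallComps_succ {L d : ℕ} {D : V → Finset V} (hD : IsPolytree D)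
    (hB : SmallTree L D d) : SmallComps L D (d + 1) := by
  intro c T
  induction hT : T.card using Nat.strong_induction_on generalizing c T with
  | _ m ih =>
  intro i hang hsmall hdi hiL hlow
  rcases T.eq_empty_or_nonempty with rfl | ⟨x, hx⟩
  · exact ⟨c, .refl, ⟨by simp, fun _ _ => rfl, fun j _ => by simp, hlow⟩⟩
  set H := comp (skeleton D) T x with hHdef
  have hHT : H ⊆ T := comp_subset T x
  have hqT : ∀ p ∈ c.q i, p ∉ T := fun p hp h => hang.not_mem p h (hang.q_sub hp)
  obtain ⟨r, hr, hroot⟩ := exists_root hD.2 hx (c.q i) hang.q_card hqT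
  have hangH : Hang D c H i := ⟨fun y hy => hang.not_mem y (hHT hy), hang.q_sub, hang.q_card,
    fun y hy z hyz => (hang.adj y (hHT hy) z hyz).imp_left fun h => mem_comp_of_adj hy hyz h,
    fun y hy => hang.pend y (hHT hy)⟩
  obtain ⟨c₁, v1, d1⟩ := hB _ c H r i rfl hr hangH hroot (hsmall x hx) (by omega) hiL
    (fun j hj => hlow j (by omega))
    (by rw [Cfg.mid, Function.update_of_ne (by omega)]; exact hlow d (by omega))
  have hlt : (T \ H).card < m := by
    rw [← hT]
    exact Finset.card_lt_card (Finset.sdiff_ssubset hHT ⟨x, mem_comp_self hx⟩)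
  have hang1 : Hang D c₁ (T \ H) i := by
    have hq := d1.q_eq i hdi
    refine ⟨?_, ?_, by rw [hq]; exact hang.q_card, ?_, ?_⟩
    · intro y hy
      obtain ⟨h1, h2⟩ := Finset.mem_sdiff.1 hy
      rw [d1.S_eq, Finset.mem_union, not_or]
      exact ⟨hang.not_mem y h1, h2⟩
    · rw [hq, d1.S_eq]; exact hang.q_sub.trans Finset.subset_union_left
    · intro y hy z hyz
      obtain ⟨h1, h2⟩ := Finset.mem_sdiff.1 hy
      rw [hq]
      refine (hang.adj y h1 z hyz).imp_left fun h =>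
        Finset.mem_sdiff.2 ⟨h, fun h3 => h2 (mem_comp_of_adj h3 hyz.symm h1)⟩
    · intro y hy
      obtain ⟨h1, h2⟩ := Finset.mem_sdiff.1 hy
      rw [hq, d1.R_eq i hdi, if_pos rfl, ← hang.pend y h1, Finset.mem_sdiff]
      tauto
  obtain ⟨c₂, v2, d2⟩ := ih _ hlt c₁ (T \ H) rfl i hang1
    (fun y hy => (Finset.card_le_card (comp_mono Finset.sdiff_subset y)).trans_lt
      (hsmall y (Finset.mem_sdiff.1 hy).1)) hdi hiL d1.R_low
  refine ⟨c₂, v1.trans v2, ?_⟩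
  have := d1.trans d2
  rwa [Finset.union_sdiff_of_subset hHT] at this

theorem smallComps (L : ℕ) {D : V → Finset V} (hD : IsPolytree D) (d : ℕ) : SmallComps L D d := by
  induction d with
  | zero =>
    intro c T i _ hsmall _ _ hlow
    have : T = ∅ := Finset.eq_empty_of_forall_notMem fun x hx => by
      have h1 := hsmall x hx
      have h2 : 0 < (comp (skeleton D) T x).card := Finset.card_pos.2 ⟨x, mem_comp_self hx⟩
      omega
    subst this
    exact ⟨c, .refl, ⟨by simp, fun _ _ => rfl, fun j _ => by simp, hlow⟩⟩
  | succ d ih => exact (ih.smallTree hD).smallComps_succ hD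

variable [Fintype V]

/-- The final configuration. -/
def Cfg.fin : Cfg V := ⟨Finset.univ, fun _ => ∅, fun _ => ∅⟩

open Classical in
/-- All successful configurations are identified with the final one. -/
def Cfg.canon (L : ℕ) (c : Cfg V) : Cfg V :=
  if c.S = Finset.univ ∧ ∀ i < L, c.R i = ∅ then Cfg.fin else c

theorem Realized.canon {L : ℕ} {c : Cfg V} {H : V → Finset V} (h : Realized L c H) :
    Realized L (c.canon L) H := by
  unfold Cfg.canon
  split_ifs with hc
  · obtain ⟨D, rank, h1, h2, h3, h4, h5, h6, h7, h8, h9⟩ := h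
    refine ⟨D, rank, h1, h2, by simp [Cfg.fin], h4, by simp [Cfg.fin], by simp [Cfg.fin],
      by simp [Cfg.fin], by simp [Cfg.fin], fun v _ => ?_⟩
    rcases h9 v (by simp [hc.1]) with h | ⟨i, hi, _, h⟩
    · exact .inl h
    · rw [hc.2 i hi, Finset.union_empty] at h; exact .inl h
  · exact h

/-- In the final configuration no slot holds a node, so no chosen parent can still be pending and
the chosen graph is the realized one. -/
theorem Realized.isPolytree {L : ℕ} {H : V → Finset V} (h : Realized L Cfg.fin H) :
    IsPolytree H := by
  obtain ⟨D, rank, h1, h2, h3, h4, h5, h6, h7, h8, h9⟩ := h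
  have : H = D := by
    funext v
    refine Finset.Subset.antisymm ?_ (h4 v)
    rcases h9 v (by simp [Cfg.fin]) with h | ⟨i, _, h, _⟩
    · exact h
    · simp [Cfg.fin] at h
  subst this
  exact ⟨isDAG_of_rank rank h1, h2⟩

/-- A polytree with less than `2 ^ d` nodes can be searched with `d + 1` slots. -/
theorem exists_visits {D : V → Finset V} (hD : IsPolytree D) {d : ℕ} (hd : Fintype.card V < 2 ^ d) :
    ∃ c, Visits (d + 1) D Cfg.start c ∧ c.S = Finset.univ ∧ ∀ i < d + 1, c.R i = ∅ := by
  -- The whole node set hangs on the empty slot d, which accounts for the extra slot.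
  obtain ⟨c, hv, hc⟩ := smallComps (d + 1) hD d Cfg.start Finset.univ d
    ⟨by simp [Cfg.start], by simp [Cfg.start], by simp [Cfg.start], by simp, by simp [Cfg.start]⟩
    (fun x _ => (Finset.card_le_univ _).trans_lt hd) le_rfl (by omega) (by simp [Cfg.start])
  refine ⟨c, hv, by simp [hc.S_eq], fun i hi => ?_⟩
  by_cases h : i < d
  · exact hc.R_low i h
  · rw [hc.R_eq i (by omega)]; simp [Cfg.start]

end Search

end Polytree

namespace Polytree

/-! ### Digits and codes -/

/-- The number with the digits `d 0, …, d (N - 1)` in base `B`. -/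
def dsum (B N : ℕ) (d : ℕ → ℕ) : ℕ := ∑ j ∈ Finset.range N, d j * B ^ j

theorem dsum_succ (B N : ℕ) (d : ℕ → ℕ) : dsum B (N + 1) d = dsum B N d + d N * B ^ N :=
  Finset.sum_range_succ _ _

theorem dsum_succ' (B N : ℕ) (d : ℕ → ℕ) :
    dsum B (N + 1) d = d 0 + B * dsum B N (fun j => d (j + 1)) := by
  rw [dsum, Finset.sum_range_succ', dsum, Finset.mul_sum, add_comm]
  congr 1
  · simp
  · exact Finset.sum_congr rfl fun j _ => by ring

theorem dsum_lt {B N : ℕ} {d : ℕ → ℕ} (h : ∀ j, d j < B) : dsum B N d < B ^ N := by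
  induction N with
  | zero => simp [dsum]
  | succ N ih =>
    rw [dsum_succ, pow_succ]
    have := h N
    have : (d N + 1) * B ^ N ≤ B * B ^ N := Nat.mul_le_mul_right _ this
    nlinarith

theorem dsum_digit {B : ℕ} {d : ℕ → ℕ} (h : ∀ j, d j < B) {N i : ℕ} (hi : i < N) :
    dsum B N d / B ^ i % B = d i := by
  have hB : 0 < B := (Nat.zero_le _).trans_lt (h 0)
  induction N generalizing d i with
  | zero => omega
  | succ N ih =>
    rw [dsum_succ']
    cases i with
    | zero => simp [Nat.mod_eq_of_lt (h 0)]
    | succ i =>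
      rw [pow_succ', ← Nat.div_div_eq_div_mul, Nat.add_mul_div_left _ _ hB,
        Nat.div_eq_of_lt (h 0), zero_add]
      exact ih (d := fun j => d (j + 1)) (fun j => h _) (by omega)

theorem dsum_update (B N : ℕ) (d : ℕ → ℕ) {j : ℕ} (hj : j < N) (x : ℕ) :
    dsum B N (Function.update d j x) + d j * B ^ j = dsum B N d + x * B ^ j := by
  have hm : j ∈ Finset.range N := Finset.mem_range.2 hj
  simp only [dsum]
  rw [← Finset.sum_erase_add _ _ hm, ← Finset.sum_erase_add (f := fun j => d j * B ^ j) _ hm]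
  have : ∑ x_1 ∈ (Finset.range N).erase j, Function.update d j x x_1 * B ^ x_1
      = ∑ x_1 ∈ (Finset.range N).erase j, d x_1 * B ^ x_1 :=
    Finset.sum_congr rfl fun y hy => by rw [Function.update_of_ne (Finset.mem_erase.1 hy).1]
  rw [this, Function.update_self]; ring

section Codes

variable {n : ℕ}

/-- The set `P` as a bit mask. -/
def mask (P : Finset (Fin n)) : ℕ := ∑ x ∈ P, 2 ^ (x : ℕ)

theorem mask_eq_dsum (P : Finset (Fin n)) :
    mask P = dsum 2 n fun j => if ∃ x ∈ P, (x : ℕ) = j then 1 else 0 := by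
  rw [dsum, Finset.sum_range, mask, ← Finset.sum_filter_add_sum_filter_not Finset.univ (· ∈ P)]
  have h1 : Finset.univ.filter (· ∈ P) = P := by ext; simp
  rw [h1]
  have h2 : ∑ x ∈ Finset.univ.filter (fun x : Fin n => ¬ x ∈ P),
      (if ∃ y ∈ P, (y : ℕ) = (x : ℕ) then 1 else 0) * 2 ^ (x : ℕ) = 0 := by
    refine Finset.sum_eq_zero fun x hx => ?_
    rw [if_neg, zero_mul]
    rintro ⟨y, hy, hxy⟩
    exact (Finset.mem_filter.1 hx).2 (Fin.ext hxy ▸ hy)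
  rw [h2, add_zero]
  refine Finset.sum_congr rfl fun x hx => ?_
  rw [if_pos ⟨x, hx, rfl⟩, one_mul]

theorem mask_lt (P : Finset (Fin n)) : mask P < 2 ^ n := by
  rw [mask_eq_dsum]; exact dsum_lt fun j => by split_ifs <;> norm_num

theorem mask_bit (P : Finset (Fin n)) (x : Fin n) :
    mask P / 2 ^ (x : ℕ) % 2 = if x ∈ P then 1 else 0 := by
  rw [mask_eq_dsum, dsum_digit (fun j => by split_ifs <;> norm_num) x.2]
  congr 1
  simp only [eq_iff_iff]
  exact ⟨fun ⟨y, hy, h⟩ => Fin.ext h ▸ hy, fun h => ⟨x, h, rfl⟩⟩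

theorem mask_inj {P Q : Finset (Fin n)} (h : mask P = mask Q) : P = Q := by
  ext x
  have h1 := mask_bit P x
  rw [h, mask_bit Q x] at h1
  by_cases hP : x ∈ P <;> by_cases hQ : x ∈ Q <;> simp_all

@[simp] theorem mask_empty : mask (∅ : Finset (Fin n)) = 0 := by simp [mask]

@[simp] theorem mask_singleton (x : Fin n) : mask {x} = 2 ^ (x : ℕ) := by simp [mask]

theorem mask_eq_zero {P : Finset (Fin n)} : mask P = 0 ↔ P = ∅ :=
  ⟨fun h => mask_inj (h.trans mask_empty.symm), fun h => by simp [h]⟩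

theorem mask_univ : mask (Finset.univ : Finset (Fin n)) + 1 = 2 ^ n := by
  rw [mask, ← Finset.sum_range (fun j => 2 ^ j), Nat.geomSum_eq le_rfl]
  have := Nat.one_le_two_pow (n := n)
  simp; omega

theorem mask_insert {P : Finset (Fin n)} {x : Fin n} (h : x ∉ P) :
    mask (insert x P) = 2 ^ (x : ℕ) + mask P := by
  rw [mask, Finset.sum_insert h, mask]

theorem mask_erase (P : Finset (Fin n)) (x : Fin n) :
    mask (P.erase x) + (if x ∈ P then 1 else 0) * 2 ^ (x : ℕ) = mask P := by
  split_ifs with h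
  · rw [mask, one_mul, Finset.sum_erase_add _ _ h, mask]
  · rw [Finset.erase_eq_of_notMem h]; simp

theorem card_le_one_cases {q : Finset (Fin n)} (hq : q.card ≤ 1) : q = ∅ ∨ ∃ x, q = {x} := by
  rcases Nat.le_one_iff_eq_zero_or_eq_one.1 hq with h | h
  · exact .inl (Finset.card_eq_zero.1 h)
  · exact .inr (Finset.card_eq_one.1 h)

/-- A set with at most one element meets `P` if and only if a bit of the mask of `P` is set. -/
theorem mask_div_mod_two {q : Finset (Fin n)} (hq : q.card ≤ 1) (P : Finset (Fin n)) :
    mask P / mask q % 2 = if (q ∩ P).Nonempty then 1 else 0 := by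
  rcases card_le_one_cases hq with rfl | ⟨x, rfl⟩
  -- The mask of the empty set is 0, and division by 0 yields 0, which is the desired bit.
  · simp
  · rw [mask_singleton, mask_bit]
    congr 1
    by_cases h : x ∈ P <;> simp [h]

theorem mask_sdiff {q : Finset (Fin n)} (hq : q.card ≤ 1) (P : Finset (Fin n)) :
    mask (P \ q) + (if (q ∩ P).Nonempty then 1 else 0) * mask q = mask P := by
  rcases card_le_one_cases hq with rfl | ⟨x, rfl⟩
  · simp
  · rw [mask_singleton, Finset.sdiff_singleton_eq_erase, ← mask_erase P x]
    congr 2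
    by_cases h : x ∈ P <;> simp [h]

/-- The digits of the code of a configuration. -/
def Cfg.dig (L : ℕ) (c : Cfg (Fin n)) (j : ℕ) : Finset (Fin n) :=
  if j = 0 then c.S else if j ≤ L then c.q (j - 1) else c.R (j - 1 - L)

/-- The code of a configuration. -/
def Cfg.code (L : ℕ) (c : Cfg (Fin n)) : ℕ := dsum (2 ^ n) (2 * L + 1) fun j => mask (c.dig L j)

/-- The code of a directed graph. -/
def graphCode (H : Fin n → Finset (Fin n)) : ℕ := ∑ v, mask (H v) * (2 ^ n) ^ (v : ℕ)

variable {L : ℕ}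

theorem Cfg.code_lt (c : Cfg (Fin n)) : c.code L < (2 ^ n) ^ (2 * L + 1) :=
  dsum_lt fun _ => mask_lt _

theorem Cfg.code_digit (c : Cfg (Fin n)) {j : ℕ} (hj : j < 2 * L + 1) :
    (c.code L : ℤ) / (2 ^ n) ^ j % 2 ^ n = mask (c.dig L j) := by
  have := dsum_digit (d := fun j => mask (c.dig L j)) (fun j => mask_lt _) hj
  rw [Cfg.code]; exact_mod_cast this

theorem Cfg.code_S (c : Cfg (Fin n)) : (c.code L : ℤ) % 2 ^ n = mask c.S := by
  simpa [Cfg.dig] using c.code_digit (L := L) (j := 0) (by omega)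

theorem Cfg.code_q (c : Cfg (Fin n)) {i : ℕ} (hi : i < L) :
    (c.code L : ℤ) / (2 ^ n) ^ (i + 1) % 2 ^ n = mask (c.q i) := by
  rw [c.code_digit (by omega), Cfg.dig, if_neg (by omega), if_pos (by omega)]; rfl

theorem Cfg.code_R (c : Cfg (Fin n)) {i : ℕ} (hi : i < L) :
    (c.code L : ℤ) / ((2 ^ n) ^ (i + 1) * (2 ^ n) ^ L) % 2 ^ n = mask (c.R i) := by
  rw [← pow_add, c.code_digit (by omega), Cfg.dig, if_neg (by omega), if_neg (by omega)]
  congr 3; omega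

theorem Cfg.code_of_dig {c c' : Cfg (Fin n)} {j : ℕ} (hj : j < 2 * L + 1) {X : Finset (Fin n)}
    (h : c'.dig L = Function.update (c.dig L) j X) :
    (c'.code L : ℤ) = c.code L + (mask X - mask (c.dig L j)) * (2 ^ n) ^ j := by
  have h1 := dsum_update (2 ^ n) (2 * L + 1) (fun j => mask (c.dig L j)) hj (mask X)
  have h2 : (fun j => mask (c'.dig L j))
      = Function.update (fun j => mask (c.dig L j)) j (mask X) := by
    funext m
    rw [h]
    by_cases hm : m = j
    · subst hm; simp
    · simp [Function.update_of_ne hm]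
  rw [← h2] at h1
  rw [Cfg.code, Cfg.code]
  zify at h1
  linear_combination h1

theorem Cfg.code_setS (c : Cfg (Fin n)) (X : Finset (Fin n)) :
    ((Cfg.mk X c.q c.R).code L : ℤ) = c.code L + (mask X - mask c.S) := by
  have := Cfg.code_of_dig (L := L) (c := c) (c' := ⟨X, c.q, c.R⟩) (j := 0) (X := X) (by omega) (by
    funext m
    by_cases hm : m = 0
    · subst hm; simp [Cfg.dig]
    · simp [Cfg.dig, hm])
  simpa [Cfg.dig] using this

theorem Cfg.code_setq (c : Cfg (Fin n)) {j : ℕ} (hj : j < L) (X : Finset (Fin n)) :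
    ((Cfg.mk c.S (Function.update c.q j X) c.R).code L : ℤ)
      = c.code L + (mask X - mask (c.q j)) * (2 ^ n) ^ (j + 1) := by
  have := Cfg.code_of_dig (L := L) (c := c) (c' := ⟨c.S, Function.update c.q j X, c.R⟩)
    (j := j + 1) (X := X) (by omega) (by
    funext m
    by_cases hm : m = j + 1
    · subst hm; simp [Cfg.dig, Nat.succ_le_of_lt hj]
    · rw [Function.update_of_ne hm]
      simp only [Cfg.dig]
      split_ifs <;> first | rfl | (rw [Function.update_of_ne]; omega))
  simpa [Cfg.dig, Nat.succ_le_of_lt hj] using this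

theorem Cfg.code_setR (c : Cfg (Fin n)) {j : ℕ} (hj : j < L) (X : Finset (Fin n)) :
    ((Cfg.mk c.S c.q (Function.update c.R j X)).code L : ℤ)
      = c.code L + (mask X - mask (c.R j)) * ((2 ^ n) ^ (j + 1) * (2 ^ n) ^ L) := by
  have hjL : ¬ j + 1 + L ≤ L := by omega
  have e : j + 1 + L - 1 - L = j := by omega
  have := Cfg.code_of_dig (L := L) (c := c) (c' := ⟨c.S, c.q, Function.update c.R j X⟩)
    (j := j + 1 + L) (X := X) (by omega) (by
    funext m
    by_cases hm : m = j + 1 + L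
    · subst hm; simp only [Cfg.dig, if_neg hjL, e]; simp
    · rw [Function.update_of_ne hm]
      simp only [Cfg.dig]
      split_ifs <;> first | rfl | (rw [Function.update_of_ne]; omega))
  rw [this, pow_add]
  simp only [Cfg.dig, if_neg hjL, e]
  simp

theorem Cfg.code_mid (c : Cfg (Fin n)) (v : Fin n) {i : ℕ} (hi : i < L) :
    ((Cfg.mk c.S c.q (c.mid v i)).code L : ℤ) = c.code L
      - (if v ∈ c.R i then 1 else 0) * 2 ^ (v : ℕ) * ((2 ^ n) ^ (i + 1) * (2 ^ n) ^ L) := by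
  rw [Cfg.mid, c.code_setR hi]
  have := mask_erase (c.R i) v
  zify at this
  rw [← this]; ring

/-- Each replaced digit contributes the difference of its masks. The pending digit of slot j is 0
before the visit, so the new one is simply added. -/
theorem Cfg.code_next (c : Cfg (Fin n)) {v : Fin n} {P : Finset (Fin n)} {i j : ℕ} (hj : j < L)
    (hq : (c.q i).card ≤ 1) (ok : c.Ok v P i j) :
    ((c.next v P i j).code L : ℤ) = (Cfg.mk c.S c.q (c.mid v i)).code L + 2 ^ (v : ℕ)
      + (2 ^ (v : ℕ) - mask (c.q j)) * (2 ^ n) ^ (j + 1)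
      + (mask P - (if (c.q i ∩ P).Nonempty then 1 else 0) * mask (c.q i)) *
        ((2 ^ n) ^ (j + 1) * (2 ^ n) ^ L) := by
  have h1 := Cfg.code_setR (L := L) ⟨insert v c.S, Function.update c.q j {v}, c.mid v i⟩ hj (P \ c.q i)
  have h2 := Cfg.code_setq (L := L) ⟨insert v c.S, c.q, c.mid v i⟩ hj {v}
  have h3 := Cfg.code_setS (L := L) ⟨c.S, c.q, c.mid v i⟩ (insert v c.S)
  have h4 := mask_insert ok.1
  have h5 := mask_sdiff hq P
  simp only at h1 h2 h3
  rw [Cfg.next, h1, h2, h3, h4, ok.2.2, ← h5]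
  simp only [mask_empty, mask_singleton]
  push_cast
  ring

/-- This is the table index at which the output routine finds the solution. -/
theorem Cfg.code_fin : ((Cfg.fin : Cfg (Fin n)).code L : ℤ) = 2 ^ n - 1 := by
  have : (Cfg.fin : Cfg (Fin n)).code L = mask (Finset.univ : Finset (Fin n)) := by
    rw [Cfg.code, dsum_succ']
    simp [Cfg.dig, Cfg.fin, dsum]
  rw [this]
  have := mask_univ (n := n)
  zify at this
  linarith

theorem Cfg.code_start : (Cfg.start : Cfg (Fin n)).code L = 0 := by
  simp [Cfg.code, Cfg.dig, Cfg.start, dsum]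

/-- The pending sets are the L most significant digits, so one comparison tests all of them at once.
-/
theorem Cfg.code_lt_iff (c : Cfg (Fin n)) :
    (c.code L : ℤ) < 2 ^ n * (2 ^ n) ^ L ↔ ∀ i < L, c.R i = ∅ := by
  constructor
  · intro h i hi
    have h1 := c.code_R hi
    rw [Int.ediv_eq_zero_of_lt (by positivity) (h.trans_le ?_)] at h1
    · exact mask_eq_zero.1 (by exact_mod_cast h1.symm)
    · rw [pow_succ, mul_comm _ ((2 : ℤ) ^ n)]
      have : (1 : ℤ) ≤ (2 ^ n) ^ i := one_le_pow₀ (one_le_pow₀ (by norm_num))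
      nlinarith [show (0 : ℤ) < 2 ^ n * (2 ^ n) ^ L by positivity]
  · intro h
    have h1 : ∀ m ≤ L, dsum (2 ^ n) (L + 1 + m) (fun j => mask (c.dig L j))
        = dsum (2 ^ n) (L + 1) (fun j => mask (c.dig L j)) := by
      intro m
      induction m with
      | zero => intro _; rfl
      | succ m ih =>
        intro hm
        rw [← add_assoc, dsum_succ, ih (by omega)]
        have : c.dig L (L + 1 + m) = ∅ := by
          rw [Cfg.dig, if_neg (by omega), if_neg (by omega), ← h m (by omega)]
          congr 1; omega
        simp [this]
    have h2 := h1 L le_rfl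
    have h3 : dsum (2 ^ n) (L + 1) (fun j => mask (c.dig L j)) < (2 ^ n) ^ (L + 1) :=
      dsum_lt fun _ => mask_lt _
    rw [← h2, show L + 1 + L = 2 * L + 1 by ring, pow_succ'] at h3
    exact_mod_cast h3

/-- The slots from `L` on are not used. -/
def Cfg.Within (L : ℕ) (c : Cfg (Fin n)) : Prop := ∀ i, L ≤ i → c.q i = ∅ ∧ c.R i = ∅

/-- The code only sees the slots below L; the others have to be known to be empty. -/
theorem Cfg.code_inj {c c' : Cfg (Fin n)} (h : c.Within L) (h' : c'.Within L)
    (e : c.code L = c'.code L) : c = c' := by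
  ext1
  · have h1 := c.code_S (L := L)
    rw [e, c'.code_S] at h1
    exact mask_inj (by exact_mod_cast h1.symm)
  · funext i
    by_cases hi : i < L
    · have h1 := c.code_q hi
      rw [e, c'.code_q hi] at h1
      exact mask_inj (by exact_mod_cast h1.symm)
    · rw [(h i (by omega)).1, (h' i (by omega)).1]
  · funext i
    by_cases hi : i < L
    · have h1 := c.code_R hi
      rw [e, c'.code_R hi] at h1
      exact mask_inj (by exact_mod_cast h1.symm)
    · rw [(h i (by omega)).2, (h' i (by omega)).2]

theorem graphCode_eq_dsum (H : Fin n → Finset (Fin n)) :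
    graphCode H = dsum (2 ^ n) n fun j => if h : j < n then mask (H ⟨j, h⟩) else 0 := by
  rw [dsum, Finset.sum_range, graphCode]
  exact Finset.sum_congr rfl fun v _ => by simp

theorem graphCode_lt (H : Fin n → Finset (Fin n)) : graphCode H < (2 ^ n) ^ n := by
  rw [graphCode_eq_dsum]
  exact dsum_lt fun j => by split_ifs <;> first | exact mask_lt _ | positivity

theorem graphCode_digit (H : Fin n → Finset (Fin n)) (v : Fin n) :
    (graphCode H : ℤ) / (2 ^ n) ^ (v : ℕ) % 2 ^ n = mask (H v) := by
  have := dsum_digit (B := 2 ^ n) (d := fun j => if h : j < n then mask (H ⟨j, h⟩) else 0)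
    (fun j => by split_ifs <;> first | exact mask_lt _ | positivity) v.2
  rw [← graphCode_eq_dsum] at this
  simp only [v.2, dif_pos] at this
  exact_mod_cast this

theorem graphCode_update (H : Fin n → Finset (Fin n)) {v : Fin n} (hv : H v = ∅)
    (P : Finset (Fin n)) :
    graphCode (Function.update H v P) = graphCode H + mask P * (2 ^ n) ^ (v : ℕ) := by
  rw [graphCode, graphCode, ← Finset.sum_erase_add _ _ (Finset.mem_univ v),
    ← Finset.sum_erase_add (f := fun v => mask (H v) * (2 ^ n) ^ (v : ℕ)) _ (Finset.mem_univ v), hv]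
  rw [Function.update_self, mask_empty, zero_mul, add_zero]
  congr 1
  exact Finset.sum_congr rfl fun x hx => by rw [Function.update_of_ne (Finset.mem_erase.1 hx).1]

end Codes

/-! ### Partial solutions -/

section Reach

variable {I : Instance} {L : ℕ}

/-- The configuration can be reached with the chosen parent sets `H`, whose total score is the
quotient of the two integers. -/
inductive Reach (I : Instance) (L : ℕ) :
    Cfg (Fin I.n) → (Fin I.n → Finset (Fin I.n)) → ℤ → ℤ → Prop
  | start : Reach I L Cfg.start (fun _ => ∅) 0 1
  | step {c : Cfg (Fin I.n)} {H : Fin I.n → Finset (Fin I.n)} {a b : ℤ} {v : Fin I.n}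
      {P : Finset (Fin I.n)} {x : ℚ} {i j : ℕ} :
      Reach I L c H a b → I.f v P = x → i < L → j < L → c.Ok v P i j →
      Reach I L ((c.next v P i j).canon L) (Function.update H v P) (a * x.den + x.num * b) (b * x.den)

theorem Cfg.canon_S {n : ℕ} (c : Cfg (Fin n)) : (c.canon L).S = c.S := by
  unfold Cfg.canon; split_ifs with h
  · exact h.1.symm
  · rfl

theorem Reach.realized {c H a b} (h : Reach I L c H a b) : Realized L c H := by
  induction h with
  | start => exact realized_start L
  | step _ hx hi hj ok ih =>
    refine (ih.next (fun hv => ?_) hi hj ok).canon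
    rw [I.f_self _ _ hv] at hx
    exact absurd hx (by simp)

theorem Reach.within {c H a b} (h : Reach I L c H a b) : c.Within L := by
  induction h with
  | start => exact fun i _ => by simp [Cfg.start]
  | step _ hx hi hj ok ih =>
    unfold Cfg.canon
    split_ifs
    · exact fun i _ => by simp [Cfg.fin]
    · intro i' hi'
      simp only [Cfg.next, Cfg.mid]
      rw [Function.update_of_ne (by omega), Function.update_of_ne (by omega),
        Function.update_of_ne (by omega)]
      exact ih i' hi'

theorem Reach.card_q {c H a b} (h : Reach I L c H a b) (i : ℕ) : (c.q i).card ≤ 1 := by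
  obtain ⟨_, _, _, _, _, _, _, _, _, h, _⟩ := h.realized
  exact h i

theorem Reach.eq_empty {c H a b} (h : Reach I L c H a b) {v : Fin I.n} (hv : v ∉ c.S) : H v = ∅ := by
  obtain ⟨_, _, _, _, _, _, h, _⟩ := h.realized
  exact h v hv

/-- A pending set starts as a subset of a potential parent set and only shrinks until its slot is
reused. This is how the in-degree bound enters the count of configurations. -/
theorem Reach.card_R {k : ℕ} (hk : I.InDegreeLE k) {c H a b} (h : Reach I L c H a b) (i : ℕ) :
    (c.R i).card ≤ k := by
  induction h generalizing i with
  | start => simp [Cfg.start]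
  | step _ hx hi hj ok ih =>
    rename_i P _ _ _ _
    unfold Cfg.canon
    split_ifs
    · simp [Cfg.fin]
    · simp only [Cfg.next, Cfg.mid, Function.update_apply]
      split_ifs
      · exact (Finset.card_le_card Finset.sdiff_subset).trans (hk _ P (by rw [hx]; simp))
      · exact (Finset.card_le_card (Finset.erase_subset _ _)).trans (ih _)
      · exact ih i

theorem Reach.den_pos {c H a b} (h : Reach I L c H a b) : 0 < b := by
  induction h with
  | start => norm_num
  | step _ _ _ _ _ ih => exact mul_pos ih (by exact_mod_cast Rat.den_pos _)

theorem Reach.value_step {a b : ℤ} (hb : 0 < b) (x : ℚ) :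
    ((a * x.den + x.num * b : ℤ) : ℚ) / ((b * x.den : ℤ) : ℚ) = a / b + x := by
  have h1 : (x.den : ℚ) ≠ 0 := by exact_mod_cast x.den_ne_zero
  have h2 : (b : ℚ) ≠ 0 := by exact_mod_cast hb.ne'
  have h3 : x = x.num / x.den := (Rat.num_div_den x).symm
  push_cast
  conv_rhs => rw [h3]
  field_simp

theorem Reach.sum_eq {c H a b} (h : Reach I L c H a b) :
    ∑ v ∈ c.S, I.f v (H v) = ((a / b : ℚ) : WithBot ℚ) := by
  induction h with
  | start => simp [Cfg.start]
  | step h hx hi hj ok ih =>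
    rename_i c H a b v P x i j
    rw [Cfg.canon_S, Reach.value_step h.den_pos]
    simp only [Cfg.next]
    rw [Finset.sum_insert ok.1, Function.update_self, hx, WithBot.coe_add, ← ih, add_comm]
    congr 1
    refine Finset.sum_congr rfl fun y hy => ?_
    rw [Function.update_of_ne (by rintro rfl; exact ok.1 hy)]

theorem Reach.card_S_step {c : Cfg (Fin I.n)} {v P i j} (ok : c.Ok v P i j) :
    ((c.next v P i j).canon L).S.card = c.S.card + 1 := by
  rw [Cfg.canon_S]; exact Finset.card_insert_of_notMem ok.1

/-- Fractions are never reduced, yet each visit multiplies the denominator by less than 2^A, and the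
number of visits is the size of the visited set. -/
theorem Reach.bounds {A : ℕ} (hA : ∀ v P (x : ℚ), I.f v P = x → |x.num| < 2 ^ A ∧ (x.den : ℤ) < 2 ^ A)
    {c H a b} (h : Reach I L c H a b) :
    |a| ≤ c.S.card * (2 ^ A) ^ c.S.card ∧ b ≤ (2 ^ A) ^ c.S.card := by
  induction h with
  | start => simp [Cfg.start]
  | step h hx hi hj ok ih =>
    rename_i c H a b v P x i j
    rw [Reach.card_S_step ok]
    obtain ⟨h1, h2⟩ := hA _ _ _ hx
    obtain ⟨i1, i2⟩ := ih
    have hb := h.den_pos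
    have hd : (0 : ℤ) < x.den := by exact_mod_cast x.den_pos
    generalize c.S.card = m at *
    have hp : (0 : ℤ) < (2 ^ A) ^ m := by positivity
    rw [pow_succ]
    refine ⟨?_, mul_le_mul i2 h2.le hd.le hp.le⟩
    calc |a * x.den + x.num * b| ≤ |a * x.den| + |x.num * b| := abs_add_le _ _
      _ = |a| * x.den + |x.num| * b := by rw [abs_mul, abs_mul, abs_of_pos hd, abs_of_pos hb]
      _ ≤ (m * (2 ^ A) ^ m) * 2 ^ A + 2 ^ A * (2 ^ A) ^ m :=
        add_le_add (mul_le_mul i1 h2.le hd.le (by positivity))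
          (mul_le_mul h1.le i2 hb.le (by positivity))
      _ = _ := by push_cast; ring

/-- Along the search given by `exists_visits`, the chosen parent sets are those of D restricted to
the visited nodes. -/
theorem exists_reach {D : Fin I.n → Finset (Fin I.n)} (hD : IsPolytree D) {g : Fin I.n → ℚ}
    (hg : ∀ v, I.f v (D v) = g v) {d : ℕ} (hd : I.n < 2 ^ d) :
    ∃ a b, Reach I (d + 1) Cfg.fin D a b := by
  obtain ⟨c, hv, hS, hR⟩ := exists_visits hD (d := d) (by simpa using hd)
  have key : ∀ c, Visits (d + 1) D Cfg.start c →
      ∃ a b, Reach I (d + 1) (c.canon (d + 1)) (fun v => if v ∈ c.S then D v else ∅) a b := by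
    intro c hc
    induction hc with
    | refl =>
      refine ⟨0, 1, ?_⟩
      have : (Cfg.start : Cfg (Fin I.n)).canon (d + 1) = Cfg.start := by
        unfold Cfg.canon
        split_ifs with h
        -- This case means that there are no nodes; the initial configuration is then already final.
        · rw [Cfg.fin, ← h.1]; rfl
        · rfl
      rw [this]
      simpa [Cfg.start] using Reach.start (I := I) (L := d + 1)
    | tail _ h ih =>
      obtain ⟨v, i, j, hi, hj, ok, rfl⟩ := h
      rename_i c _
      obtain ⟨a, b, h⟩ := ih
      -- A further visit is possible, so some node is unvisited, and no merging has happened yet.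
      have : c.canon (d + 1) = c := by
        unfold Cfg.canon
        rw [if_neg]
        exact fun h => ok.1 (by simp [h.1])
      rw [this] at h
      have := h.step (hg v) hi hj ok
      have e : Function.update (fun y => if y ∈ c.S then D y else ∅) v (D v)
          = fun y => if y ∈ (c.next v (D v) i j).S then D y else ∅ := by
        funext y
        simp only [Cfg.next, Finset.mem_insert, Function.update_apply]
        split_ifs <;> simp_all
      exact ⟨_, _, e ▸ this⟩
  obtain ⟨a, b, h⟩ := key c hv
  refine ⟨a, b, ?_⟩
  simp only [hS, Finset.mem_univ, if_true] at h
  rwa [Cfg.canon, if_pos ⟨hS, hR⟩] at h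

/-! ### Counting configurations -/

/-- A set with at most k elements is the set of entries of a k-tuple of optional elements. -/
theorem card_small_sets (n k : ℕ) :
    ((Finset.univ : Finset (Finset (Fin n))).filter fun P => P.card ≤ k).card ≤ (n + 1) ^ k := by
  have : ((Finset.univ : Finset (Finset (Fin n))).filter fun P => P.card ≤ k) ⊆
      (Finset.univ : Finset (Fin k → Option (Fin n))).image
        (fun g => Finset.univ.filter fun x => ∃ i, g i = some x) := by
    intro P hP
    rw [Finset.mem_filter] at hP
    refine Finset.mem_image.2 ⟨fun i => P.toList[(i : ℕ)]?, Finset.mem_univ _, ?_⟩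
    ext x
    simp only [Finset.mem_filter, Finset.mem_univ, true_and]
    constructor
    · rintro ⟨i, hi⟩
      exact Finset.mem_toList.1 (List.mem_of_getElem? hi)
    · intro hx
      obtain ⟨i, hi, e⟩ := List.mem_iff_getElem.1 (Finset.mem_toList.2 hx)
      refine ⟨⟨i, ?_⟩, ?_⟩
      · rw [Finset.length_toList] at hi; exact hi.trans_le hP.2
      · simp [List.getElem?_eq_getElem hi, e]
  refine (Finset.card_le_card this).trans (Finset.card_image_le.trans ?_)
  simp

/-- A bound for the number of configurations with `L` slots. -/
def cfgBound (n k L : ℕ) : ℕ := 2 ^ n * ((n + 1) ^ (k + 1)) ^ L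

/-- Only the visited set costs an exponential factor; each of the L slots contributes n + 1 for its
node and (n+1)^k for its pending set. -/
theorem length_le_cfgBound {k : ℕ} {l : List (Cfg (Fin I.n))} (hl : l.Nodup)
    (hq : ∀ c ∈ l, ∀ i, (c.q i).card ≤ 1) (hR : ∀ c ∈ l, ∀ i, (c.R i).card ≤ k)
    (hw : ∀ c ∈ l, c.Within L) : l.length ≤ cfgBound I.n k L := by
  classical
  let sm (m : ℕ) := (Finset.univ : Finset (Finset (Fin I.n))).filter fun P => P.card ≤ m
  let X : Finset (Finset (Fin I.n) × (Fin L → Finset (Fin I.n)) × (Fin L → Finset (Fin I.n))) :=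
    Finset.univ ×ˢ (Fintype.piFinset fun _ => sm 1) ×ˢ (Fintype.piFinset fun _ => sm k)
  let φ (c : Cfg (Fin I.n)) : Finset (Fin I.n) × (Fin L → Finset (Fin I.n)) × (Fin L → Finset (Fin I.n)) :=
    (c.S, fun i => c.q i, fun i => c.R i)
  have h1 : l.toFinset.card ≤ X.card := by
    refine Finset.card_le_card_of_injOn φ ?_ ?_
    · intro c hc
      have hc' : c ∈ l := by simpa using hc
      simp only [X, φ, sm, Finset.coe_product, Set.mem_prod, Finset.mem_coe, Finset.mem_univ,
        Fintype.mem_piFinset, Finset.mem_filter, true_and]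
      exact ⟨fun i => hq c hc' i, fun i => hR c hc' i⟩
    · intro c hc c' hc' e
      have hc1 : c ∈ l := by simpa using hc
      have hc2 : c' ∈ l := by simpa using hc'
      simp only [φ, Prod.mk.injEq] at e
      obtain ⟨e1, e2, e3⟩ := e
      ext1
      · exact e1
      · funext i
        by_cases hi : i < L
        · exact congrFun e2 ⟨i, hi⟩
        · rw [(hw c hc1 i (by omega)).1, (hw c' hc2 i (by omega)).1]
      · funext i
        by_cases hi : i < L
        · exact congrFun e3 ⟨i, hi⟩
        · rw [(hw c hc1 i (by omega)).2, (hw c' hc2 i (by omega)).2]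
  rw [List.toFinset_card_of_nodup hl] at h1
  refine h1.trans ?_
  simp only [X, Finset.card_product, Finset.card_univ, Fintype.card_finset, Fintype.card_fin,
    Fintype.card_piFinset, Finset.prod_const]
  rw [cfgBound]
  refine Nat.mul_le_mul_left _ ?_
  rw [← mul_pow]
  refine Nat.pow_le_pow_left ?_ _
  rw [pow_succ' (I.n + 1) k]
  exact Nat.mul_le_mul (by simpa using card_small_sets I.n 1) (card_small_sets I.n k)

end Reach

end Polytree

/-! ### The dynamic program -/

namespace RAM

/-- A sequence of programs. -/
def blk : List Prog → Prog
  | [] => .skip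
  | p :: ps => .seq p (blk ps)

/-- Remainder. -/
def md (a b : Ex) : Ex := a - a / b * b

/-- The address of the entry `x` of the table `f`. -/
def tab (f : ℕ) (x : ℤ) : ℤ := -(16 * x + f)

/-- The address of an entry of the table `f`. -/
def tb (f : ℕ) (a : Ex) : Ex := 0 - (16 * a + Ex.lit f)

@[simp] theorem Ex.eval_md (s : St) (a b : Ex) : (md a b).eval s = a.eval s % b.eval s := by
  rw [md, Int.emod_def]; simp [mul_comm]

@[simp] theorem Ex.eval_tb (s : St) (f : ℕ) (a : Ex) : (tb f a).eval s = tab f (a.eval s) := by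
  show 0 - (16 * a.eval s + (f : ℤ)) = _
  rw [tab, zero_sub]

/-- The table number is the residue of the negated address modulo 16. Addresses with positive table
number and nonnegative index are negative, hence disjoint from the cells of the input and the
output. -/
theorem tab_inj {f f' : ℕ} (hf : f < 16) (hf' : f' < 16) {x x' : ℤ} :
    tab f x = tab f' x' ↔ f = f' ∧ x = x' := by
  unfold tab; omega

section Rules

variable {l : ℕ} {p : Prog} {ps : List Prog} {s : St} {m m' : ℕ} {Q Q' : St → Prop}

theorem Runs.nil (h : Q s) : Runs l (blk []) s 1 Q := Runs.skip h

theorem Runs.cons {m₁ m₂ : ℕ} (h : Runs l p s m₁ fun s' => Runs l (blk ps) s' m₂ Q) :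
    Runs l (blk (p :: ps)) s (m₁ + m₂) Q := Runs.seq h

theorem Runs.cons_set {v : Var} {e : Ex} (he : e.sz ≤ 100) (hb : |e.eval s| < 2 ^ l)
    (h : Runs l (blk ps) (s.set v (e.eval s)) m Q) : Runs l (blk (setP v e :: ps)) s (m + 1) Q :=
  Runs.set_seq he hb h

theorem Runs.cons_let {v : Var} {e : Ex} {z : ℤ} (he : e.sz ≤ 100) (hz : e.eval s = z)
    (hb : |z| < 2 ^ l) (h : Runs l (blk ps) (s.set v z) m Q) :
    Runs l (blk (setP v e :: ps)) s (m + 1) Q := by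
  subst hz; exact Runs.set_seq he hb h

theorem Runs.cons_store {a e : Ex} (ha : a.sz ≤ 100) (he : e.sz ≤ 100) (hb : |e.eval s| < 2 ^ l)
    (h : Runs l (blk ps) { s with mem := Function.update s.mem (a.eval s) (e.eval s) } m Q) :
    Runs l (blk (storeP a e :: ps)) s (m + 1) Q :=
  Runs.store_seq ha he hb h

theorem Runs.weaken (h : Runs l p s m Q) (hm : m ≤ m') : Runs l p s m' Q := h.mono hm fun _ h => h

theorem Runs.imp (h : Runs l p s m Q) (hQ : ∀ s, Q s → Q' s) : Runs l p s m Q' := h.mono le_rfl hQ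

/-- The rule for loops with `N` iterations: `J t` holds after `t` iterations. -/
theorem Runs.for {e : Ex} (he : e.sz ≤ 100) (N : ℕ) (J : ℕ → St → Prop) (h : J 0 s)
    (hpos : ∀ t s, t < N → J t s → s.Bdd l → 0 < e.eval s ∧ Runs l p s m (J (t + 1)))
    (hzero : ∀ s, J N s → ¬ 0 < e.eval s) :
    Runs l (whileP e p) s (N * (m + 2) + 2) (J N) := by
  have := Runs.while (l := l) (p := p) (m := m) he (fun k s => k ≤ N ∧ J (N - k) s) N
    ⟨le_rfl, by simpa using h⟩ (fun k s hk hs => ?_) (fun s hs => hzero s (by simpa using hs.2))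
  · exact this.imp fun s hs => by simpa using hs.2
  · obtain ⟨h1, h2⟩ := hpos (N - (k + 1)) s (by omega) hk.2 hs
    refine ⟨h1, h2.imp fun s hs => ⟨by omega, ?_⟩⟩
    rwa [show N - (k + 1) + 1 = N - k by omega] at hs

end Rules

open Var in
/-- Record the code `c` with value `(nx * ed + en * dx) / (dx * ed)`. -/
def relaxP : Prog := blk [
  setP d (dx * ed),
  setP y (nx * ed + en * dx),
  setP g (.ld (tb 1 c)),
  iteP g
    (setP g (y * g - .ld (tb 2 c) * d))
    (blk [storeP (tb 4 tail) c, setP tail (tail + 1), setP g 1]),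
  iteP g
    (blk [storeP (tb 1 c) d, storeP (tb 2 c) y, storeP (tb 3 c) (hx + P * wv)])
    .skip]

open Var in
/-- Visit the node of the current entry, with the slots `i` and `j`. -/
def innerP : Prog := blk [
  setP a (md (md (x / (wi * WL)) W / u) 2),
  setP b (md (P / md (x / wi) W) 2),
  setP c (x - a * u * (wi * WL)),
  iteP ((1 - md (md x W / u) 2) * (1 - a * b) * (1 - md (c / (wj * WL)) W))
    (blk [
      setP c (c + u + (u - md (c / wj) W) * wj + (P - b * md (x / wi) W) * (wj * WL)),
      iteP (W * WL - c) (iteP (md c W + 2 - W) (setP c (W - 1)) .skip) .skip,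
      relaxP])
    .skip]

open Var in
/-- All visits with the current entry and the slot `i`. -/
def slotP : Prog := whileP (L - j) (blk [innerP, setP wj (wj * W), setP j (j + 1)])

open Var in
/-- All visits with the current entry. -/
def entryP : Prog := whileP (L - i) (blk [
  setP j 0, setP wj W, slotP, setP wi (wi * W), setP i (i + 1)])

open Var in
/-- All visits from the current configuration. -/
def expandP : Prog := blk [
  setP e 0,
  whileP (E - e) (blk [
    setP u (.ld (tb 5 e)), setP P (.ld (tb 6 e)), setP en (.ld (tb 7 e)), setP ed (.ld (tb 8 e)),
    setP wv (.ld (tb 9 e)), setP i 0, setP wi W, entryP, setP e (e + 1)])]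

end RAM

/-! ### Tables and invariants of the dynamic program. -/

namespace Polytree

open RAM

section Search

variable {I : Instance} {L l h : ℕ} {ents : List (Fin I.n × Finset (Fin I.n) × ℚ)}

/-- The bounds needed for the dynamic program. -/
structure Params (I : Instance) (L l h : ℕ) (ents : List (Fin I.n × Finset (Fin I.n) × ℚ)) :
    Prop where
  mem_iff : ∀ v P (x : ℚ), (v, P, x) ∈ ents ↔ I.f v P = x
  code_le : (4 : ℤ) * (2 ^ I.n) ^ (2 * L + 2) ≤ 2 ^ l
  hist_le : ((2 : ℤ) ^ I.n) ^ I.n ≤ 2 ^ l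
  num_lt : ∀ c H a b, Reach I L c H a b → |a| < 2 ^ h ∧ b < 2 ^ h
  num_le : (2 : ℤ) * (2 ^ h * 2 ^ h) ≤ 2 ^ l
  len_lt : (ents.length : ℤ) < 2 ^ l
  slots_lt : (L : ℤ) < 2 ^ l

/-- The table of the potential parent sets. -/
def EntTable (ents : List (Fin I.n × Finset (Fin I.n) × ℚ)) (mem : ℤ → ℤ) : Prop :=
  ∀ (t : ℕ) (ht : t < ents.length), mem (tab 5 t) = 2 ^ (ents[t].1 : ℕ) ∧
    mem (tab 6 t) = mask ents[t].2.1 ∧ mem (tab 7 t) = ents[t].2.2.num ∧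
    mem (tab 8 t) = ents[t].2.2.den ∧ mem (tab 9 t) = (2 ^ I.n) ^ (ents[t].1 : ℕ)

/-- The memory while the queue is `Q`. -/
structure DPInv (I : Instance) (L : ℕ) (ents : List (Fin I.n × Finset (Fin I.n) × ℚ)) (mem : ℤ → ℤ)
    (Q : List (Cfg (Fin I.n))) : Prop where
  table : EntTable ents mem
  nodup : Q.Nodup
  queue : ∀ (t : ℕ) (ht : t < Q.length), mem (tab 4 t) = Q[t].code L
  absent : ∀ c : Cfg (Fin I.n), c.Within L → c ∉ Q → mem (tab 1 (c.code L)) = 0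
  sound : ∀ c ∈ Q, ∃ H, Reach I L c H (mem (tab 2 (c.code L))) (mem (tab 1 (c.code L))) ∧
    mem (tab 3 (c.code L)) = graphCode H

/-- The value recorded for a configuration. -/
def value (L : ℕ) (mem : ℤ → ℤ) (c : Cfg (Fin I.n)) : ℚ :=
  mem (tab 2 (c.code L)) / mem (tab 1 (c.code L))

/-- The memory and the queue have changed by recording values for configurations with `r` visited
nodes. -/
structure Ext (L r : ℕ) (mem : ℤ → ℤ) (Q : List (Cfg (Fin I.n))) (mem' : ℤ → ℤ)
    (Q' : List (Cfg (Fin I.n))) : Prop where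
  append : ∃ ys, Q' = Q ++ ys ∧ ∀ c ∈ ys, c.S.card = r
  le : ∀ c ∈ Q, value L mem c ≤ value L mem' c
  eq : ∀ c ∈ Q, c.S.card ≠ r → ∀ f, f ∈ [1, 2, 3] →
    mem' (tab f (c.code L)) = mem (tab f (c.code L))

/-- A value of at least `y` is recorded for the configuration `c`. -/
def Dom (L : ℕ) (mem : ℤ → ℤ) (Q : List (Cfg (Fin I.n))) (c : Cfg (Fin I.n)) (y : ℚ) : Prop :=
  c ∈ Q ∧ y ≤ value L mem c

theorem Ext.refl (r : ℕ) (mem : ℤ → ℤ) (Q : List (Cfg (Fin I.n))) : Ext L r mem Q mem Q :=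
  ⟨⟨[], by simp⟩, fun _ _ => le_rfl, fun _ _ _ _ _ => rfl⟩

theorem Ext.subset {r : ℕ} {mem mem' : ℤ → ℤ} {Q Q' : List (Cfg (Fin I.n))}
    (e : Ext L r mem Q mem' Q') {c : Cfg (Fin I.n)} (hc : c ∈ Q) : c ∈ Q' := by
  obtain ⟨ys, rfl, _⟩ := e.append
  exact List.mem_append_left _ hc

theorem Ext.trans {r : ℕ} {m₁ m₂ m₃ : ℤ → ℤ} {Q₁ Q₂ Q₃ : List (Cfg (Fin I.n))}
    (e₁ : Ext L r m₁ Q₁ m₂ Q₂) (e₂ : Ext L r m₂ Q₂ m₃ Q₃) : Ext L r m₁ Q₁ m₃ Q₃ where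
  append := by
    obtain ⟨y₁, rfl, h₁⟩ := e₁.append
    obtain ⟨y₂, rfl, h₂⟩ := e₂.append
    refine ⟨y₁ ++ y₂, by simp, fun c hc => ?_⟩
    rcases List.mem_append.1 hc with h | h
    · exact h₁ c h
    · exact h₂ c h
  le c hc := (e₁.le c hc).trans (e₂.le c (e₁.subset hc))
  eq c hc hr f hf := (e₂.eq c (e₁.subset hc) hr f hf).trans (e₁.eq c hc hr f hf)

theorem Dom.ext {r : ℕ} {mem mem' : ℤ → ℤ} {Q Q' : List (Cfg (Fin I.n))} {c : Cfg (Fin I.n)} {y : ℚ}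
    (d : Dom L mem Q c y) (e : Ext L r mem Q mem' Q') : Dom L mem' Q' c y :=
  ⟨e.subset d.1, d.2.trans (e.le c d.1)⟩

/-- The memory after recording values for the code `x`. -/
def put (mem : ℤ → ℤ) (x b a z : ℤ) : ℤ → ℤ :=
  Function.update (Function.update (Function.update mem (tab 1 x) b) (tab 2 x) a) (tab 3 x) z

theorem put_of_ne (mem : ℤ → ℤ) {x b a z : ℤ} {f : ℕ} (hf : f < 16) {x' : ℤ}
    (h : x' ≠ x ∨ f ∉ [1, 2, 3]) : put mem x b a z (tab f x') = mem (tab f x') := by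
  have : ∀ f' ∈ [1, 2, 3], tab f x' ≠ tab f' x := by
    intro f' hf' e
    have h16 : f' < 16 := by simp at hf'; omega
    obtain ⟨h1, h2⟩ := (tab_inj hf h16).1 e
    subst h1 h2
    rcases h with h | h
    · exact h rfl
    · exact h hf'
  rw [put, Function.update_of_ne (this 3 (by simp)), Function.update_of_ne (this 2 (by simp)),
    Function.update_of_ne (this 1 (by simp))]

theorem put_self (mem : ℤ → ℤ) (x b a z : ℤ) : put mem x b a z (tab 1 x) = b ∧
    put mem x b a z (tab 2 x) = a ∧ put mem x b a z (tab 3 x) = z := by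
  have h12 : tab 1 x ≠ tab 2 x := by unfold tab; omega
  have h13 : tab 1 x ≠ tab 3 x := by unfold tab; omega
  have h23 : tab 2 x ≠ tab 3 x := by unfold tab; omega
  simp [put, Function.update_of_ne, h12, h13, h23]

theorem code_ne {c c' : Cfg (Fin I.n)} (h : c.Within L) (h' : c'.Within L) (e : c ≠ c') :
    (c.code L : ℤ) ≠ c'.code L := fun h1 => e (Cfg.code_inj h h' (by exact_mod_cast h1))

theorem DPInv.within {mem : ℤ → ℤ} {Q : List (Cfg (Fin I.n))} (hinv : DPInv I L ents mem Q)
    {c : Cfg (Fin I.n)} (hc : c ∈ Q) : c.Within L := by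
  obtain ⟨H, hr, _⟩ := hinv.sound c hc
  exact hr.within

theorem DPInv.length_le {mem : ℤ → ℤ} {Q : List (Cfg (Fin I.n))} (hinv : DPInv I L ents mem Q) :
    (Q.length : ℤ) ≤ (2 ^ I.n) ^ (2 * L + 1) := by
  have h1 : (Q.map (Cfg.code L)).Nodup :=
    List.Nodup.map_on (fun c hc c' hc' e => Cfg.code_inj (hinv.within hc) (hinv.within hc') e)
      hinv.nodup
  have h2 : (Q.map (Cfg.code L)).toFinset ⊆ Finset.range ((2 ^ I.n) ^ (2 * L + 1)) := by
    intro x hx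
    obtain ⟨c, _, rfl⟩ := List.mem_map.1 (List.mem_toFinset.1 hx)
    exact Finset.mem_range.2 c.code_lt
  have h3 := Finset.card_le_card h2
  rw [List.toFinset_card_of_nodup h1, List.length_map, Finset.card_range] at h3
  exact_mod_cast h3

theorem DPInv.length_le_cfgBound {k : ℕ} (hk : I.InDegreeLE k) {mem : ℤ → ℤ}
    {Q : List (Cfg (Fin I.n))} (hinv : DPInv I L ents mem Q) : Q.length ≤ cfgBound I.n k L := by
  refine Polytree.length_le_cfgBound hinv.nodup (fun c hc i => ?_) (fun c hc i => ?_)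
    (fun c hc => hinv.within hc) <;> obtain ⟨H, hr, _⟩ := hinv.sound c hc
  · exact hr.card_q i
  · exact hr.card_R hk i

/-- Distinct configurations within the slots have distinct codes, so overwriting the record of one
leaves the others alone. -/
theorem DPInv.improve {mem : ℤ → ℤ} {Q : List (Cfg (Fin I.n))} (hinv : DPInv I L ents mem Q)
    {c : Cfg (Fin I.n)} {H a b} (hr : Reach I L c H a b) (hc : c ∈ Q)
    (hle : value L mem c ≤ a / b) :
    DPInv I L ents (put mem (c.code L) b a (graphCode H)) Q ∧
      Ext L c.S.card mem Q (put mem (c.code L) b a (graphCode H)) Q ∧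
      Dom L (put mem (c.code L) b a (graphCode H)) Q c (a / b) := by
  obtain ⟨p1, p2, p3⟩ := put_self mem (c.code L) b a (graphCode H)
  refine ⟨⟨?_, hinv.nodup, ?_, ?_, ?_⟩, ⟨⟨[], by simp⟩, ?_, ?_⟩, hc, ?_⟩
  · intro t ht
    iterate 5 rw [put_of_ne _ (by norm_num) (.inr (by decide))]
    exact hinv.table t ht
  · intro t ht
    rw [put_of_ne _ (by norm_num) (.inr (by decide))]
    exact hinv.queue t ht
  · intro c' hc' hQ
    rw [put_of_ne _ (by norm_num) (.inl (code_ne hc' hr.within (by rintro rfl; exact hQ hc)))]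
    exact hinv.absent c' hc' hQ
  · intro c' hc'
    by_cases e : c' = c
    · subst e; rw [p1, p2, p3]; exact ⟨H, hr, rfl⟩
    · have := code_ne (hinv.within hc') hr.within e
      iterate 3 rw [put_of_ne _ (by norm_num) (.inl this)]
      exact hinv.sound c' hc'
  · intro c' hc'
    by_cases e : c' = c
    · subst e
      refine hle.trans ?_
      rw [value, p1, p2]
    · have := code_ne (hinv.within hc') hr.within e
      rw [value, value]
      iterate 2 rw [put_of_ne _ (by norm_num) (.inl this)]
  · intro c' hc' hcard f hf
    have hf' : f < 16 := by simp at hf; omega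
    refine put_of_ne _ hf' (.inl (code_ne (hinv.within hc') hr.within ?_))
    rintro rfl; exact hcard rfl
  · rw [value, p1, p2]

theorem DPInv.push {mem : ℤ → ℤ} {Q : List (Cfg (Fin I.n))} (hinv : DPInv I L ents mem Q)
    {c : Cfg (Fin I.n)} {H a b} (hr : Reach I L c H a b) (hc : c ∉ Q) {mem' : ℤ → ℤ}
    (hm : mem' = put (Function.update mem (tab 4 Q.length) (c.code L)) (c.code L) b a (graphCode H)) :
    DPInv I L ents mem' (Q ++ [c]) ∧ Ext L c.S.card mem Q mem' (Q ++ [c]) ∧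
      Dom L mem' (Q ++ [c]) c (a / b) := by
  obtain ⟨p1, p2, p3⟩ := put_self (Function.update mem (tab 4 Q.length) (c.code L)) (c.code L) b a
    (graphCode H)
  rw [← hm] at p1 p2 p3
  have ne4 : ∀ (f : ℕ) (x : ℤ), f < 16 → (f ≠ 4 ∨ x ≠ Q.length) →
      Function.update mem (tab 4 Q.length) (c.code L : ℤ) (tab f x) = mem (tab f x) := by
    intro f x hf h
    refine Function.update_of_ne (fun e => ?_) _ _
    have := (tab_inj hf (by norm_num)).1 e
    tauto
  have other : ∀ (f : ℕ) (x : ℤ), f < 16 → (x ≠ c.code L ∨ f ∉ [1, 2, 3]) → (f ≠ 4 ∨ x ≠ Q.length) →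
      mem' (tab f x) = mem (tab f x) := by
    intro f x hf h1 h2
    rw [hm, put_of_ne _ hf h1, ne4 f x hf h2]
  have same : ∀ c' ∈ Q, ∀ f ∈ [1, 2, 3], mem' (tab f (c'.code L)) = mem (tab f (c'.code L)) := by
    intro c' hc' f hf
    have hf' : f < 16 ∧ f ≠ 4 := by simp at hf; omega
    refine other f _ hf'.1 (.inl (code_ne (hinv.within hc') hr.within ?_)) (.inl hf'.2)
    rintro rfl; exact hc hc'
  refine ⟨⟨?_, ?_, ?_, ?_, ?_⟩, ⟨⟨[c], rfl, by simp⟩, ?_, ?_⟩, by simp, ?_⟩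
  · intro t ht
    iterate 5 rw [other _ _ (by norm_num) (.inr (by decide)) (.inl (by decide))]
    exact hinv.table t ht
  · exact hinv.nodup.append (by simp) (by simpa using hc)
  · intro t ht
    by_cases e : t = Q.length
    · subst e
      rw [hm, put_of_ne _ (by norm_num) (.inr (by decide))]
      simp
    · have ht' : t < Q.length := by
        rw [List.length_append, List.length_singleton] at ht; omega
      rw [other _ _ (by norm_num) (.inr (by decide)) (.inr (by exact_mod_cast e)),
        hinv.queue t ht', List.getElem_append_left ht']
  · intro c' hc' hQ
    rw [List.mem_append, not_or] at hQ
    rw [other _ _ (by norm_num) (.inl (code_ne hc' hr.within (by simpa using hQ.2)))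
      (.inl (by decide))]
    exact hinv.absent c' hc' hQ.1
  · intro c' hc'
    rcases List.mem_append.1 hc' with h | h
    · rw [same c' h 1 (by simp), same c' h 2 (by simp), same c' h 3 (by simp)]
      exact hinv.sound c' h
    · rw [List.mem_singleton] at h
      subst h
      rw [p1, p2, p3]; exact ⟨H, hr, rfl⟩
  · intro c' hc'
    rw [value, value, same c' hc' 1 (by simp), same c' hc' 2 (by simp)]
  · exact fun c' hc' _ f hf => same c' hc' f hf
  · rw [value, p1, p2]

theorem graphCode_lt_int (H : Fin I.n → Finset (Fin I.n)) :
    |(graphCode H : ℤ)| < (2 ^ I.n) ^ I.n := by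
  rw [abs_of_nonneg (by positivity)]; exact_mod_cast graphCode_lt H

theorem Params.code_lt (hp : Params I L l h ents) (c : Cfg (Fin I.n)) : |(c.code L : ℤ)| < 2 ^ l := by
  rw [abs_of_nonneg (by positivity)]
  have h1 : (c.code L : ℤ) < (2 ^ I.n) ^ (2 * L + 1) := by exact_mod_cast c.code_lt
  have h2 : ((2 : ℤ) ^ I.n) ^ (2 * L + 1) ≤ (2 ^ I.n) ^ (2 * L + 2) :=
    pow_le_pow_right₀ (one_le_pow₀ (by norm_num)) (by omega)
  have := hp.code_le
  have : (0 : ℤ) < (2 ^ I.n) ^ (2 * L + 2) := by positivity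
  linarith

theorem Params.tail_lt (hp : Params I L l h ents) {mem : ℤ → ℤ} {Q : List (Cfg (Fin I.n))}
    (hinv : DPInv I L ents mem Q) : (Q.length : ℤ) + 1 < 2 ^ l := by
  have h1 := hinv.length_le
  have h2 : ((2 : ℤ) ^ I.n) ^ (2 * L + 1) ≤ (2 ^ I.n) ^ (2 * L + 2) :=
    pow_le_pow_right₀ (one_le_pow₀ (by norm_num)) (by omega)
  have := hp.code_le
  have : (1 : ℤ) ≤ (2 ^ I.n) ^ (2 * L + 2) := one_le_pow₀ (one_le_pow₀ (by norm_num))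
  linarith

end Search

end Polytree

/-! ### Recording a value, and trying a single visit. -/

namespace Polytree

open RAM

section Search

variable {I : Instance} {L l h : ℕ} {ents : List (Fin I.n × Finset (Fin I.n) × ℚ)}

theorem value_le_iff {a b a' b' : ℤ} (hb : 0 < b) (hb' : 0 < b') :
    (a : ℚ) / b ≤ a' / b' ↔ a * b' ≤ a' * b := by
  rw [div_le_div_iff₀ (by exact_mod_cast hb) (by exact_mod_cast hb')]
  exact_mod_cast Iff.rfl

/-- The recorded denominator doubles as a presence flag: it is 0 for unseen configurations and
positive otherwise. For a known configuration the fractions are compared by cross multiplication; a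
new one is appended to the queue and recorded unconditionally. -/
theorem runs_relax (hp : Params I L l h ents) {s : St} {Q : List (Cfg (Fin I.n))}
    (hinv : DPInv I L ents s.mem Q) {c : Cfg (Fin I.n)} {H : Fin I.n → Finset (Fin I.n)}
    (hr : Reach I L c H (s.nx * s.ed + s.en * s.dx) (s.dx * s.ed)) (hc : s.c = c.code L)
    (hh : s.hx + s.P * s.wv = graphCode H) (htail : s.tail = Q.length) :
    Runs l relaxP s 14 fun s' => ∃ (d y g : ℤ) (mem : ℤ → ℤ) (Q' : List (Cfg (Fin I.n))),
      s' = { s with d := d, y := y, g := g, tail := Q'.length, mem := mem } ∧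
      DPInv I L ents mem Q' ∧ Ext L c.S.card s.mem Q mem Q' ∧
      Dom L mem Q' c ((s.nx * s.ed + s.en * s.dx : ℤ) / (s.dx * s.ed : ℤ)) := by
  obtain ⟨hn1, hn2⟩ := hp.num_lt _ _ _ _ hr
  have hdpos := hr.den_pos
  set Post : St → Prop := fun s' => ∃ (d y g : ℤ) (mem : ℤ → ℤ) (Q' : List (Cfg (Fin I.n))),
      s' = { s with d := d, y := y, g := g, tail := Q'.length, mem := mem } ∧
      DPInv I L ents mem Q' ∧ Ext L c.S.card s.mem Q mem Q' ∧
      Dom L mem Q' c ((s.nx * s.ed + s.en * s.dx : ℤ) / (s.dx * s.ed : ℤ)) with hPost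
  set D := s.dx * s.ed with hD
  set Y := s.nx * s.ed + s.en * s.dx with hY
  have h1 : (1 : ℤ) ≤ 2 ^ h := one_le_pow₀ (by norm_num)
  have hhl : (2 : ℤ) ^ h < 2 ^ l := by nlinarith [hp.num_le]
  have hDl : |D| < 2 ^ l := by rw [abs_of_pos hdpos]; exact hn2.trans hhl
  have hYl : |Y| < 2 ^ l := hn1.trans hhl
  have hl1 : (1 : ℤ) < 2 ^ l := h1.trans_lt hhl
  have hstore : ∀ (g tl : ℤ) (m : ℤ → ℤ), 0 < g →
      Post { s with d := D, y := Y, g := g, tail := tl, mem := put m (c.code L) D Y (graphCode H) } →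
      Runs l (blk [iteP (.var .g) (blk [storeP (tb 1 (.var .c)) (.var .d),
        storeP (tb 2 (.var .c)) (.var .y),
        storeP (tb 3 (.var .c)) ((.var .hx) + (.var .P) * (.var .wv))]) .skip])
        { s with d := D, y := Y, g := g, tail := tl, mem := m } 6 Post := by
    intro g tl m hg hpost
    refine Runs.cons (m₁ := 5) (m₂ := 1) (Runs.ite (by decide) (fun _ => ?_) fun hn => absurd hg hn)
    refine Runs.cons_store (by decide) (by decide) hDl
      (Runs.cons_store (by decide) (by decide) hYl
      (Runs.cons_store (by decide) (by decide) ?_ (Runs.nil (Runs.nil ?_))))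
    · simp only [Ex.eval_add, Ex.eval_mul, Ex.eval_var, St.get, hh]
      exact (graphCode_lt_int H).trans_le hp.hist_le
    · simpa [St.get, hh, hc, put] using hpost
  have hnostore : ∀ (g tl : ℤ) (m : ℤ → ℤ), ¬ 0 < g →
      Post { s with d := D, y := Y, g := g, tail := tl, mem := m } →
      Runs l (blk [iteP (.var .g) (blk [storeP (tb 1 (.var .c)) (.var .d),
        storeP (tb 2 (.var .c)) (.var .y),
        storeP (tb 3 (.var .c)) ((.var .hx) + (.var .P) * (.var .wv))]) .skip])
        { s with d := D, y := Y, g := g, tail := tl, mem := m } 6 Post := by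
    intro g tl m hg hpost
    refine Runs.cons (m₁ := 5) (m₂ := 1) (Runs.ite (by decide) (fun hn => absurd hn hg) fun _ => ?_)
    exact (Runs.skip (Runs.nil hpost)).weaken (by norm_num)
  have hglt : |s.mem (tab 1 (c.code L))| < 2 ^ h := by
    by_cases hQ : c ∈ Q
    · obtain ⟨H', hr', _⟩ := hinv.sound c hQ
      rw [abs_of_pos hr'.den_pos]; exact (hp.num_lt _ _ _ _ hr').2
    · rw [hinv.absent c hr.within hQ]; simp
  refine Runs.cons_set (by decide) hDl (Runs.cons_set (by decide) hYl (Runs.cons_set (by decide) ?_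
    (Runs.cons (m₁ := 5) (m₂ := 6) (Runs.ite (by decide) (fun hg => ?_) (fun hg => ?_)))))
  · simp only [Ex.eval_ld, Ex.eval_tb, Ex.eval_var, St.get, St.set, hc]
    exact hglt.trans hhl
  · simp only [Ex.eval_ld, Ex.eval_tb, Ex.eval_var, Ex.eval_mul, Ex.eval_add, St.get, St.set, hc,
      ← hD, ← hY] at hg ⊢
    have hQ : c ∈ Q := by
      by_contra hQ
      rw [hinv.absent c hr.within hQ] at hg
      exact lt_irrefl _ hg
    obtain ⟨H', hr', hH'⟩ := hinv.sound c hQ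
    obtain ⟨ho1, ho2⟩ := hp.num_lt _ _ _ _ hr'
    refine (Runs.set (by decide) ?_ ?_).weaken (m' := 4) (by norm_num)
    · simp only [Ex.eval_ld, Ex.eval_tb, Ex.eval_var, Ex.eval_mul, Ex.eval_sub, St.get]
      refine (abs_sub _ _).trans_lt ?_
      rw [abs_mul, abs_mul, abs_of_pos hdpos, abs_of_pos hg]
      have e1 : |Y| * s.mem (tab 1 (c.code L)) < 2 ^ h * 2 ^ h :=
        mul_lt_mul'' hn1 ho2 (abs_nonneg _) hg.le
      have e2 : |s.mem (tab 2 (c.code L))| * D < 2 ^ h * 2 ^ h :=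
        mul_lt_mul'' ho1 hn2 (abs_nonneg _) hdpos.le
      have := hp.num_le
      linarith
    · simp only [Ex.eval_ld, Ex.eval_tb, Ex.eval_var, Ex.eval_mul, Ex.eval_sub, St.get, St.set]
      have hv : value L s.mem c ≤ (Y : ℚ) / D ↔ _ := value_le_iff hr'.den_pos hdpos
      have hv' : (Y : ℚ) / D ≤ value L s.mem c ↔ _ := value_le_iff hdpos hr'.den_pos
      by_cases hlt : 0 < Y * s.mem (tab 1 (c.code L)) - s.mem (tab 2 (c.code L)) * D
      · obtain ⟨i1, i2, i3⟩ := hinv.improve hr hQ (hv.2 (by linarith))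
        have := hstore _ s.tail s.mem hlt ⟨_, _, _, _, Q, by rw [htail], i1, i2, i3⟩
        simpa [hc] using this
      · have := hnostore _ s.tail s.mem hlt ⟨_, _, _, _, Q, by rw [htail], hinv, Ext.refl _ _ _, hQ,
          hv'.2 (by linarith)⟩
        simpa [hc] using this
  · simp only [Ex.eval_ld, Ex.eval_tb, Ex.eval_var, Ex.eval_mul, Ex.eval_add, St.get, St.set, hc,
      ← hD, ← hY] at hg ⊢
    have hQ : c ∉ Q := by
      intro hQ
      obtain ⟨H', hr', _⟩ := hinv.sound c hQ
      exact hg hr'.den_pos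
    refine Runs.cons_store (by decide) (by decide) ?_ (Runs.cons_set (by decide) ?_
      (Runs.cons_set (by decide) ?_ (Runs.nil ?_)))
    · exact hp.code_lt c
    · simp only [Ex.eval_var, Ex.eval_add, Ex.eval_one, St.get, htail]
      rw [abs_of_nonneg (by positivity)]
      exact hp.tail_lt hinv
    · simpa using hl1
    · obtain ⟨i1, i2, i3⟩ := hinv.push hr hQ rfl
      have := hstore 1 (s.tail + 1) (Function.update s.mem (tab 4 Q.length) (c.code L)) one_pos
        ⟨D, Y, 1, _, Q ++ [c], by simp [htail], i1, i2, i3⟩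
      simpa [St.set, St.get, hc, htail] using this

/-- The current configuration is `c`, with the chosen parent sets `H`. -/
def AtCfg (L : ℕ) (ents : List (Fin I.n × Finset (Fin I.n) × ℚ)) (s : St) (c : Cfg (Fin I.n))
    (H : Fin I.n → Finset (Fin I.n)) : Prop :=
  Reach I L c H s.nx s.dx ∧ s.x = c.code L ∧ s.hx = graphCode H ∧ s.W = 2 ^ I.n ∧
    s.WL = (2 ^ I.n) ^ L ∧ s.L = L ∧ s.E = ents.length

/-- The current entry is the parent set `P` of `v` with the score `x`. -/
def AtEntry (s : St) (v : Fin I.n) (P : Finset (Fin I.n)) (x : ℚ) : Prop :=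
  s.u = 2 ^ (v : ℕ) ∧ s.P = mask P ∧ s.en = x.num ∧ s.ed = x.den ∧ s.wv = (2 ^ I.n) ^ (v : ℕ)

theorem mask_bit_int (P : Finset (Fin I.n)) (x : Fin I.n) :
    (mask P : ℤ) / 2 ^ (x : ℕ) % 2 = if x ∈ P then 1 else 0 := by
  have := mask_bit P x
  exact_mod_cast this

theorem mask_div_mod_two_int {q : Finset (Fin I.n)} (hq : q.card ≤ 1) (P : Finset (Fin I.n)) :
    (mask P : ℤ) / mask q % 2 = if (q ∩ P).Nonempty then 1 else 0 := by
  have := mask_div_mod_two hq P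
  exact_mod_cast this

/-- The first two factors are 0 or 1, and the third is positive only if the mask is 0, so one sign
test checks the three conditions. -/
theorem cond_iff (c : Cfg (Fin I.n)) (v : Fin I.n) (P : Finset (Fin I.n)) (i j : ℕ) :
    0 < (1 - (if v ∈ c.S then 1 else 0 : ℤ)) *
      (1 - (if v ∈ c.R i then 1 else 0) * (if (c.q i ∩ P).Nonempty then 1 else 0)) *
      (1 - (mask (c.mid v i j) : ℤ)) ↔ c.Ok v P i j := by
  have h0 : (0 : ℤ) ≤ mask (c.mid v i j) := by positivity
  unfold Cfg.Ok
  rw [← mask_eq_zero]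
  by_cases h1 : v ∈ c.S <;> by_cases h2 : v ∈ c.R i <;> by_cases h3 : (c.q i ∩ P).Nonempty <;>
    simp [h1, h2, h3]

theorem runs_canon (hp : Params I L l h ents) {s : St} {c : Cfg (Fin I.n)} (hc : s.c = c.code L)
    (hW : s.W = 2 ^ I.n) (hWL : s.WL = (2 ^ I.n) ^ L) {Q : St → Prop}
    (hQ : Q { s with c := (c.canon L).code L }) :
    Runs l (iteP ((.var .W) * (.var .WL) - (.var .c)) (iteP (md (.var .c) (.var .W) + 2 - (.var .W))
      (setP .c ((.var .W) - 1)) .skip) .skip) s 3 Q := by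
  have hS : (mask c.S : ℤ) + 1 ≤ 2 ^ I.n := by exact_mod_cast mask_lt c.S
  -- Masks are at most 2^n - 1, and only the full set attains this.
  have huniv : 0 < (mask c.S : ℤ) + 2 - 2 ^ I.n ↔ c.S = Finset.univ := by
    have h1 := mask_univ (n := I.n)
    zify at h1
    constructor
    · intro h
      refine mask_inj ?_
      have : (mask c.S : ℤ) = mask (Finset.univ : Finset (Fin I.n)) := by linarith
      exact_mod_cast this
    · intro h
      rw [h]; linarith
  have hR : 0 < (2 : ℤ) ^ I.n * (2 ^ I.n) ^ L - c.code L ↔ ∀ i < L, c.R i = ∅ := by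
    rw [← c.code_lt_iff, sub_pos]
  have hno : ¬ (c.S = Finset.univ ∧ ∀ i < L, c.R i = ∅) → Q s := by
    intro h
    rw [Cfg.canon, if_neg h, ← hc] at hQ
    exact hQ
  refine Runs.ite (m := 2) (by decide) (fun h1 => Runs.ite (m := 1) (by decide) (fun h2 => ?_)
    (fun h2 => ?_)) (fun h1 => ?_)
  · simp only [Ex.eval_sub, Ex.eval_add, Ex.eval_mul, Ex.eval_md, Ex.eval_var, St.get, hc, hW, hWL,
      c.code_S, Ex.eval_two, hR, huniv] at h1 h2
    rw [Cfg.canon, if_pos ⟨h2, h1⟩, Cfg.code_fin] at hQ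
    refine Runs.set (by decide) ?_ (by simpa [St.set, St.get, hW] using hQ)
    simp only [Ex.eval_sub, Ex.eval_var, Ex.eval_one, St.get, hW]
    rw [← Cfg.code_fin (L := L)]
    exact hp.code_lt _
  · simp only [Ex.eval_sub, Ex.eval_add, Ex.eval_mul, Ex.eval_md, Ex.eval_var, St.get, hc, hW, hWL,
      c.code_S, Ex.eval_two, hR, huniv] at h1 h2
    exact Runs.skip (hno fun h => h2 h.1)
  · simp only [Ex.eval_sub, Ex.eval_mul, Ex.eval_var, St.get, hc, hW, hWL, hR] at h1
    exact (Runs.skip (hno fun h => h1 h.2)).weaken (by norm_num)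

/-- The visit is carried out on codes alone: α and β are the bits telling whether v is pending in
slot i and whether the node of slot i lies in P. The code after the attachment is computed first,
because the test of slot j refers to it; this matters when i = j. -/
theorem runs_inner (hp : Params I L l h ents) {s : St} {Q : List (Cfg (Fin I.n))}
    (hinv : DPInv I L ents s.mem Q) {c : Cfg (Fin I.n)} {H : Fin I.n → Finset (Fin I.n)}
    (hc : AtCfg L ents s c H) {v : Fin I.n} {P : Finset (Fin I.n)} {x : ℚ} (he : AtEntry s v P x)
    (hx : I.f v P = x) {i j : ℕ} (hi : i < L) (hj : j < L) (hwi : s.wi = (2 ^ I.n) ^ (i + 1))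
    (hwj : s.wj = (2 ^ I.n) ^ (j + 1)) (htail : s.tail = Q.length) :
    Runs l innerP s 24 fun s' => ∃ (a b c' d y g : ℤ) (mem : ℤ → ℤ) (Q' : List (Cfg (Fin I.n))),
      s' = { s with a := a, b := b, c := c', d := d, y := y, g := g, tail := Q'.length, mem := mem } ∧
      DPInv I L ents mem Q' ∧ Ext L (c.S.card + 1) s.mem Q mem Q' ∧
      (c.Ok v P i j → Dom L mem Q' ((c.next v P i j).canon L) ((s.nx : ℚ) / s.dx + x)) := by
  obtain ⟨hr, hsx, hhx, hW, hWL, hL, hE⟩ := hc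
  obtain ⟨hu, hP, hen, hed, hwv⟩ := he
  have hq := hr.card_q i
  have hl1 : (1 : ℤ) < 2 ^ l := by
    have := hp.tail_lt hinv
    linarith [show (0 : ℤ) ≤ Q.length by positivity]
  have hbool : ∀ (p : Prop) [Decidable p], |(if p then 1 else 0 : ℤ)| < 2 ^ l := by
    intro p _
    split_ifs
    · simpa using hl1
    · simp
  set m : Cfg (Fin I.n) := ⟨c.S, c.q, c.mid v i⟩ with hm
  have hmid := c.code_mid v hi
  rw [← hm] at hmid
  have mR : (m.code L : ℤ) / ((2 ^ I.n) ^ (j + 1) * (2 ^ I.n) ^ L) % 2 ^ I.n = mask (c.mid v i j) :=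
    m.code_R hj
  have mq : (m.code L : ℤ) / (2 ^ I.n) ^ (j + 1) % 2 ^ I.n = mask (c.q j) := m.code_q hj
  set α : ℤ := if v ∈ c.R i then 1 else 0 with hα
  set β : ℤ := if (c.q i ∩ P).Nonempty then 1 else 0 with hβ
  have eα : s.x / (s.wi * s.WL) % s.W / s.u % 2 = α := by
    rw [hsx, hwi, hWL, hW, c.code_R hi, hu, mask_bit_int]
  have eq : s.x / s.wi % s.W = mask (c.q i) := by rw [hsx, hwi, hW, c.code_q hi]
  have eβ : s.P / (s.x / s.wi % s.W) % 2 = β := by rw [eq, hP, mask_div_mod_two_int hq]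
  have eS : s.x % s.W / s.u % 2 = if v ∈ c.S then 1 else 0 := by
    rw [hsx, hW, c.code_S, hu, mask_bit_int]
  have em : s.x - α * s.u * (s.wi * s.WL) = m.code L := by rw [hmid, hsx, hu, hwi, hWL]
  have emR : (m.code L : ℤ) / (s.wj * s.WL) % s.W = mask (c.mid v i j) := by rw [hwj, hWL, hW, mR]
  have emq : (m.code L : ℤ) / s.wj % s.W = mask (c.q j) := by rw [hwj, hW, mq]
  refine Runs.cons_let (z := α) (by decide) (by simpa [St.get] using eα) (hbool _)
    (Runs.cons_let (z := β) (by decide) (by simpa [St.get, St.set] using eβ) (hbool _)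
    (Runs.cons_let (z := m.code L) (by decide) (by simpa [St.get, St.set] using em) (hp.code_lt m) ?_))
  simp only [St.set]
  have hcond : (((1 - md (md (.var .x) (.var .W) / (.var .u)) 2) * (1 - (.var .a) * (.var .b)) *
      (1 - md ((.var .c) / ((.var .wj) * (.var .WL))) (.var .W)) : Ex)).eval
        { s with a := α, b := β, c := m.code L } = (1 - (if v ∈ c.S then 1 else 0 : ℤ)) *
      (1 - α * β) * (1 - (mask (c.mid v i j) : ℤ)) := by
    simp only [Ex.eval_md, Ex.eval_div, Ex.eval_var, Ex.eval_mul, Ex.eval_sub, Ex.eval_one,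
      Ex.eval_two, St.get, eS, emR]
  refine Runs.cons (m₁ := 20) (m₂ := 1) (Runs.ite (by decide) (fun h => ?_) (fun h => ?_))
  · have hok : c.Ok v P i j := (cond_iff c v P i j).1 (hcond ▸ h)
    have hn := c.code_next hj hq hok
    rw [← hm] at hn
    have hreach := hr.step hx hi hj hok
    have hcard := Reach.card_S_step (L := L) hok
    have hlast : Runs l (blk [relaxP])
        { s with a := α, b := β, c := ((c.next v P i j).canon L).code L } 15 fun s' => Runs l (blk []) s' 1 fun s' =>
        ∃ (a b c' d y g : ℤ) (mem : ℤ → ℤ) (Q' : List (Cfg (Fin I.n))),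
        s' = { s with a := a, b := b, c := c', d := d, y := y, g := g, tail := Q'.length, mem := mem } ∧
        DPInv I L ents mem Q' ∧ Ext L (c.S.card + 1) s.mem Q mem Q' ∧
        (c.Ok v P i j → Dom L mem Q' ((c.next v P i j).canon L) ((s.nx : ℚ) / s.dx + x)) := by
      refine Runs.cons (m₁ := 14) (m₂ := 1) ((runs_relax hp
        (s := { s with a := α, b := β, c := ((c.next v P i j).canon L).code L }) hinv
        (c := (c.next v P i j).canon L) (by simpa [hen, hed] using hreach) rfl ?_ htail).imp ?_)
      · show s.hx + s.P * s.wv = _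
        rw [graphCode_update H (hr.eq_empty hok.1), hhx, hP, hwv]
        push_cast; ring
      · rintro s' ⟨d, y, g, mem, Q', rfl, h1, h2, h3⟩
        refine Runs.nil (Runs.nil ⟨_, _, _, d, y, g, mem, Q', rfl, h1, ?_, fun _ => ?_⟩)
        · rw [← hcard]; exact h2
        · simp only [hen, hed] at h3
          rwa [Reach.value_step hr.den_pos] at h3
    refine Runs.cons_let (z := (c.next v P i j).code L) (by decide)
      (by
        simp only [Ex.eval_md, Ex.eval_div, Ex.eval_var, Ex.eval_mul, Ex.eval_sub, Ex.eval_add,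
          St.get, eq, emq]
        rw [hn, hu, hP, hwj, hWL]) (hp.code_lt _) ?_
    simp only [St.set]
    exact Runs.cons (m₁ := 3) (m₂ := 15) (runs_canon hp (c := c.next v P i j)
      (s := { s with a := α, b := β, c := (c.next v P i j).code L }) rfl hW hWL hlast)
  · have hok : ¬ c.Ok v P i j := fun hok => h (hcond ▸ (cond_iff c v P i j).2 hok)
    exact (Runs.skip (Runs.nil ⟨α, β, _, s.d, s.y, s.g, s.mem, Q, by rw [← htail], hinv,
      .refl _ _ _, fun h => absurd h hok⟩)).weaken (by norm_num)

end Search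

end Polytree

/-! ### All visits from one configuration. -/

namespace Polytree

open RAM

section Search

variable {I : Instance} {L l h : ℕ} {ents : List (Fin I.n × Finset (Fin I.n) × ℚ)}

theorem pow_slot_lt (hp : Params I L l h ents) {t : ℕ} (ht : t ≤ L + 1) :
    |((2 : ℤ) ^ I.n) ^ t| < 2 ^ l := by
  rw [abs_of_nonneg (by positivity)]
  have h1 : ((2 : ℤ) ^ I.n) ^ t ≤ (2 ^ I.n) ^ (2 * L + 2) :=
    pow_le_pow_right₀ (one_le_pow₀ (by norm_num)) (by omega)
  have := hp.code_le
  have : (1 : ℤ) ≤ (2 ^ I.n) ^ (2 * L + 2) := one_le_pow₀ (one_le_pow₀ (by norm_num))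
  linarith

theorem natCast_lt {t N : ℕ} (ht : t ≤ N) (hN : (N : ℤ) < 2 ^ l) : |(t : ℤ)| < 2 ^ l := by
  rw [abs_of_nonneg (by positivity)]
  have : (t : ℤ) ≤ N := by exact_mod_cast ht
  linarith

theorem runs_slots (hp : Params I L l h ents) {s : St} {Q : List (Cfg (Fin I.n))}
    (hinv : DPInv I L ents s.mem Q) {c : Cfg (Fin I.n)} {H : Fin I.n → Finset (Fin I.n)}
    (hc : AtCfg L ents s c H) {v : Fin I.n} {P : Finset (Fin I.n)} {x : ℚ} (he : AtEntry s v P x)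
    (hx : I.f v P = x) {i : ℕ} (hi : i < L) (hwi : s.wi = (2 ^ I.n) ^ (i + 1))
    (hj : s.j = 0) (hwj : s.wj = 2 ^ I.n) (htail : s.tail = Q.length) :
    Runs l slotP s (L * 29 + 2) fun s' => ∃ (j wj a b c' d y g : ℤ) (mem : ℤ → ℤ) (Q' : List (Cfg (Fin I.n))),
      s' = { s with j := j, wj := wj, a := a, b := b, c := c', d := d, y := y, g := g,
                    tail := Q'.length, mem := mem } ∧
      DPInv I L ents mem Q' ∧ Ext L (c.S.card + 1) s.mem Q mem Q' ∧
      ∀ t < L, c.Ok v P i t → Dom L mem Q' ((c.next v P i t).canon L) ((s.nx : ℚ) / s.dx + x) := by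
  refine (Runs.for (by decide) L (m := 27) (fun t s' =>
      ∃ (a b c' d y g : ℤ) (mem : ℤ → ℤ) (Q' : List (Cfg (Fin I.n))),
      s' = { s with j := t, wj := (2 ^ I.n) ^ (t + 1), a := a, b := b, c := c', d := d, y := y,
                    g := g, tail := Q'.length, mem := mem } ∧
      DPInv I L ents mem Q' ∧ Ext L (c.S.card + 1) s.mem Q mem Q' ∧
      ∀ t' < t, c.Ok v P i t' → Dom L mem Q' ((c.next v P i t').canon L) ((s.nx : ℚ) / s.dx + x))
      ?_ ?_ ?_).imp ?_
  · exact ⟨s.a, s.b, s.c, s.d, s.y, s.g, s.mem, Q, by simp [← hj, ← hwj, ← htail], hinv, .refl _ _ _,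
      by simp⟩
  · rintro t s' ht ⟨a, b, c', d, y, g, mem, Q', rfl, h1, h2, h3⟩ -
    refine ⟨?_, ?_⟩
    · simp only [Ex.eval_sub, Ex.eval_var, St.get, hc.2.2.2.2.2.1]
      have : (t : ℤ) < L := by exact_mod_cast ht
      linarith
    · refine Runs.cons (m₁ := 24) (m₂ := 3)
        (Runs.imp (runs_inner hp (by exact h1) (c := c) (H := H) (by exact hc) (by exact he) hx hi ht (by exact hwi)
          rfl (by rfl)) ?_)
      rintro s' ⟨a, b, c', d, y, g, mem', Q'', rfl, g1, g2, g3⟩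
      refine Runs.cons_let (z := (2 ^ I.n) ^ (t + 1 + 1)) (by decide)
        (by simp [St.get, hc.2.2.2.1, pow_succ]) (pow_slot_lt hp (by omega)) ?_
      simp only [St.set]
      refine Runs.cons_let (z := (t + 1 : ℕ)) (by decide) (by simp [St.get])
        (natCast_lt (Nat.succ_le_of_lt ht) hp.slots_lt) ?_
      simp only [St.set]
      refine Runs.nil ⟨a, b, c', d, y, g, mem', Q'', rfl, g1, h2.trans g2, ?_⟩
      · intro t' ht' ok
        by_cases e : t' = t
        · subst e; exact g3 ok
        · exact (h3 t' (by omega) ok).ext g2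
  · rintro s' ⟨a, b, c', d, y, g, mem, Q', rfl, -⟩
    simp [St.get, hc.2.2.2.2.2.1]
  · rintro s' ⟨a, b, c', d, y, g, mem, Q', rfl, h1, h2, h3⟩
    exact ⟨_, _, a, b, c', d, y, g, mem, Q', rfl, h1, h2, h3⟩

theorem runs_entry (hp : Params I L l h ents) {s : St} {Q : List (Cfg (Fin I.n))}
    (hinv : DPInv I L ents s.mem Q) {c : Cfg (Fin I.n)} {H : Fin I.n → Finset (Fin I.n)}
    (hc : AtCfg L ents s c H) {v : Fin I.n} {P : Finset (Fin I.n)} {x : ℚ} (he : AtEntry s v P x)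
    (hx : I.f v P = x) (hi : s.i = 0) (hwi : s.wi = 2 ^ I.n) (htail : s.tail = Q.length) :
    Runs l entryP s (L * (L * 29 + 9) + 2) fun s' => ∃ (i wi j wj a b c' d y g : ℤ) (mem : ℤ → ℤ) (Q' : List (Cfg (Fin I.n))),
      s' = { s with i := i, wi := wi, j := j, wj := wj, a := a, b := b, c := c', d := d, y := y,
                    g := g, tail := Q'.length, mem := mem } ∧
      DPInv I L ents mem Q' ∧ Ext L (c.S.card + 1) s.mem Q mem Q' ∧
      ∀ r < L, ∀ t < L, c.Ok v P r t →
        Dom L mem Q' ((c.next v P r t).canon L) ((s.nx : ℚ) / s.dx + x) := by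
  refine (Runs.for (by decide) L (m := L * 29 + 7) (fun r s' =>
      ∃ (j wj a b c' d y g : ℤ) (mem : ℤ → ℤ) (Q' : List (Cfg (Fin I.n))),
      s' = { s with i := r, wi := (2 ^ I.n) ^ (r + 1), j := j, wj := wj, a := a, b := b, c := c',
                    d := d, y := y, g := g, tail := Q'.length, mem := mem } ∧
      DPInv I L ents mem Q' ∧ Ext L (c.S.card + 1) s.mem Q mem Q' ∧
      ∀ r' < r, ∀ t < L, c.Ok v P r' t →
        Dom L mem Q' ((c.next v P r' t).canon L) ((s.nx : ℚ) / s.dx + x)) ?_ ?_ ?_).imp ?_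
  · exact ⟨s.j, s.wj, s.a, s.b, s.c, s.d, s.y, s.g, s.mem, Q, by simp [← hi, ← hwi, ← htail], hinv,
      .refl _ _ _, by simp⟩
  · rintro r s' hr ⟨j, wj, a, b, c', d, y, g, mem, Q', rfl, h1, h2, h3⟩ -
    refine ⟨?_, ?_⟩
    · simp only [Ex.eval_sub, Ex.eval_var, St.get, hc.2.2.2.2.2.1]
      have : (r : ℤ) < L := by exact_mod_cast hr
      linarith
    · refine Runs.cons_let (z := 0) (m := L * 29 + 6) (by decide) rfl (by simp) ?_
      simp only [St.set]
      refine Runs.cons_let (z := 2 ^ I.n) (m := L * 29 + 5) (by decide) (by simp [St.get, hc.2.2.2.1])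
        (by simpa using pow_slot_lt hp (t := 1) (by omega)) ?_
      simp only [St.set]
      refine Runs.cons (m₁ := L * 29 + 2) (m₂ := 3)
        (Runs.imp (runs_slots hp (by exact h1) (c := c) (H := H) (by exact hc) (by exact he) hx hr rfl rfl rfl
          (by rfl)) ?_)
      rintro s' ⟨j, wj, a, b, c', d, y, g, mem', Q'', rfl, g1, g2, g3⟩
      refine Runs.cons_let (z := (2 ^ I.n) ^ (r + 1 + 1)) (by decide)
        (by simp [St.get, hc.2.2.2.1, pow_succ]) (pow_slot_lt hp (by omega)) ?_
      simp only [St.set]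
      refine Runs.cons_let (z := (r + 1 : ℕ)) (by decide) (by simp [St.get])
        (natCast_lt (Nat.succ_le_of_lt hr) hp.slots_lt) ?_
      simp only [St.set]
      refine Runs.nil ⟨j, wj, a, b, c', d, y, g, mem', Q'', rfl, g1, h2.trans g2, ?_⟩
      · intro r' hr' t ht ok
        by_cases e : r' = r
        · subst e; exact g3 t ht ok
        · exact (h3 r' (by omega) t ht ok).ext g2
  · rintro s' ⟨j, wj, a, b, c', d, y, g, mem, Q', rfl, -⟩
    simp [St.get, hc.2.2.2.2.2.1]
  · rintro s' ⟨j, wj, a, b, c', d, y, g, mem, Q', rfl, h1, h2, h3⟩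
    exact ⟨_, _, j, wj, a, b, c', d, y, g, mem, Q', rfl, h1, h2, h3⟩

/-- The cost of processing a configuration. -/
def expandCost (L E : ℕ) : ℕ := E * (L * (L * 29 + 9) + 13) + 4

theorem runs_expand (hp : Params I L l h ents) {s : St} {Q : List (Cfg (Fin I.n))}
    (hinv : DPInv I L ents s.mem Q) {c : Cfg (Fin I.n)} {H : Fin I.n → Finset (Fin I.n)}
    (hc : AtCfg L ents s c H) (htail : s.tail = Q.length) :
    Runs l expandP s (expandCost L ents.length) fun s' =>
      ∃ (e u P en ed wv i wi j wj a b c' d y g : ℤ) (mem : ℤ → ℤ) (Q' : List (Cfg (Fin I.n))),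
      s' = { s with e := e, u := u, P := P, en := en, ed := ed, wv := wv, i := i, wi := wi, j := j,
                    wj := wj, a := a, b := b, c := c', d := d, y := y, g := g, tail := Q'.length,
                    mem := mem } ∧
      DPInv I L ents mem Q' ∧ Ext L (c.S.card + 1) s.mem Q mem Q' ∧
      ∀ v P (x : ℚ), (v, P, x) ∈ ents → ∀ r < L, ∀ t < L, c.Ok v P r t →
        Dom L mem Q' ((c.next v P r t).canon L) ((s.nx : ℚ) / s.dx + x) := by
  refine Runs.cons_let (z := 0) (m := ents.length * (L * (L * 29 + 9) + 13) + 3) (by decide) rfl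
    (by simp) (Runs.cons (m₁ := ents.length * (L * (L * 29 + 9) + 13) + 2) (m₂ := 1)
    ((Runs.for (by decide) ents.length (m := L * (L * 29 + 9) + 11) (fun k s' =>
      ∃ (u P en ed wv i wi j wj a b c' d y g : ℤ) (mem : ℤ → ℤ) (Q' : List (Cfg (Fin I.n))),
      s' = { s with e := k, u := u, P := P, en := en, ed := ed, wv := wv, i := i, wi := wi, j := j,
                    wj := wj, a := a, b := b, c := c', d := d, y := y, g := g, tail := Q'.length,
                    mem := mem } ∧
      DPInv I L ents mem Q' ∧ Ext L (c.S.card + 1) s.mem Q mem Q' ∧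
      ∀ k' (hk : k' < ents.length), k' < k → ∀ r < L, ∀ t < L, c.Ok ents[k'].1 ents[k'].2.1 r t →
        Dom L mem Q' ((c.next ents[k'].1 ents[k'].2.1 r t).canon L)
          ((s.nx : ℚ) / s.dx + ents[k'].2.2)) ?_ ?_ ?_).imp ?_))
  · exact ⟨s.u, s.P, s.en, s.ed, s.wv, s.i, s.wi, s.j, s.wj, s.a, s.b, s.c, s.d, s.y, s.g, s.mem, Q,
      by simp [St.set, ← htail], hinv, .refl _ _ _, by simp⟩
  · rintro k s' hk ⟨u, P, en, ed, wv, i, wi, j, wj, a, b, c', d, y, g, mem, Q', rfl, h1, h2, h3⟩ hbdd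
    obtain ⟨e5, e6, e7, e8, e9⟩ := h1.table k hk
    refine ⟨?_, ?_⟩
    · simp only [Ex.eval_sub, Ex.eval_var, St.get, hc.2.2.2.2.2.2]
      have : (k : ℤ) < ents.length := by exact_mod_cast hk
      linarith
    · have hx := (hp.mem_iff ents[k].1 ents[k].2.1 ents[k].2.2).1 (List.getElem_mem hk)
      refine Runs.cons_let (by decide) e5 (e5 ▸ hbdd.2 _) ?_
      simp only [St.set]
      refine Runs.cons_let (by decide) e6 (e6 ▸ hbdd.2 _) ?_
      simp only [St.set]
      refine Runs.cons_let (by decide) e7 (e7 ▸ hbdd.2 _) ?_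
      simp only [St.set]
      refine Runs.cons_let (by decide) e8 (e8 ▸ hbdd.2 _) ?_
      simp only [St.set]
      refine Runs.cons_let (by decide) e9 (e9 ▸ hbdd.2 _) ?_
      simp only [St.set]
      refine Runs.cons_let (z := 0) (by decide) rfl (by simp) ?_
      simp only [St.set]
      refine Runs.cons_let (z := 2 ^ I.n) (m := L * (L * 29 + 9) + 4) (by decide)
        (by simp [St.get, hc.2.2.2.1]) (by simpa using pow_slot_lt hp (t := 1) (by omega)) ?_
      simp only [St.set]
      refine Runs.cons (m₁ := L * (L * 29 + 9) + 2) (m₂ := 2) (Runs.imp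
        (runs_entry hp (by exact h1) (c := c) (H := H) (v := ents[k].1) (P := ents[k].2.1)
          (x := ents[k].2.2) (by exact hc) ⟨rfl, rfl, rfl, rfl, rfl⟩ hx rfl rfl (by rfl)) ?_)
      rintro s' ⟨i, wi, j, wj, a, b, c', d, y, g, mem', Q'', rfl, g1, g2, g3⟩
      refine Runs.cons_let (z := (k + 1 : ℕ)) (by decide) (by simp [St.get])
        (natCast_lt (Nat.succ_le_of_lt hk) hp.len_lt) ?_
      simp only [St.set]
      refine Runs.nil ⟨_, _, _, _, _, i, wi, j, wj, a, b, c', d, y, g, mem', Q'', rfl, g1,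
        h2.trans g2, ?_⟩
      · intro k' hk' hkk r hr t ht ok
        by_cases e : k' = k
        · subst e; exact g3 r hr t ht ok
        · exact (h3 k' hk' (by omega) r hr t ht ok).ext g2
  · rintro s' ⟨u, P, en, ed, wv, i, wi, j, wj, a, b, c', d, y, g, mem, Q', rfl, -⟩
    simp [St.get, hc.2.2.2.2.2.2]
  · rintro s' ⟨u, P, en, ed, wv, i, wi, j, wj, a, b, c', d, y, g, mem, Q', rfl, h1, h2, h3⟩
    refine Runs.nil ⟨_, u, P, en, ed, wv, i, wi, j, wj, a, b, c', d, y, g, mem, Q', rfl, h1, h2, ?_⟩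
    intro v P x hv r hr t ht ok
    obtain ⟨k, hk, e⟩ := List.mem_iff_getElem.1 hv
    have := h3 k hk hk r hr t ht
    rw [e] at this
    exact this ok

end Search

end Polytree

/-! ### Processing the configurations layer by layer. -/

namespace RAM

open Var in
/-- Process the configurations of the queue from `head` to `bd`. -/
def layerP : Prog := whileP (bd - head) (blk [
  setP x (.ld (tb 4 head)), setP dx (.ld (tb 1 x)), setP nx (.ld (tb 2 x)), setP hx (.ld (tb 3 x)),
  expandP, setP head (head + 1)])

open Var in
/-- The dynamic program. -/
def searchP : Prog := blk [
  storeP (tb 1 0) 1, storeP (tb 4 0) 0, setP head 0, setP tail 1, setP rd n,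
  whileP rd (blk [setP bd tail, layerP, setP rd (rd - 1)])]

end RAM

namespace Polytree

open RAM

section Search

variable {I : Instance} {L l h : ℕ} {ents : List (Fin I.n × Finset (Fin I.n) × ℚ)}

/-- The registers that do not change during the search. -/
def Env (L : ℕ) (ents : List (Fin I.n × Finset (Fin I.n) × ℚ)) (s : St) : Prop :=
  s.n = I.n ∧ s.W = 2 ^ I.n ∧ s.WL = (2 ^ I.n) ^ L ∧ s.L = L ∧ s.E = ents.length

/-- The configurations with `r` visited nodes are those from the position `hd` of the queue on,
and optimal values are recorded for them. -/
structure Layer (I : Instance) (L r : ℕ) (mem : ℤ → ℤ) (Q : List (Cfg (Fin I.n))) (hd : ℕ) : Prop where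
  le : hd ≤ Q.length
  lt : ∀ (t : ℕ) (ht : t < Q.length), t < hd → Q[t].S.card < r
  eq : ∀ (t : ℕ) (ht : t < Q.length), hd ≤ t → Q[t].S.card = r
  complete : ∀ c H a b, Reach I L c H a b → c.S.card = r → Dom L mem Q c (a / b)

/-- All visits from `c` are recorded, starting from the value `y`. -/
def Expanded (I : Instance) (L : ℕ) (ents : List (Fin I.n × Finset (Fin I.n) × ℚ)) (mem : ℤ → ℤ)
    (Q : List (Cfg (Fin I.n))) (c : Cfg (Fin I.n)) (y : ℚ) : Prop :=
  ∀ v P (x : ℚ), (v, P, x) ∈ ents → ∀ i < L, ∀ j < L, c.Ok v P i j →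
    Dom L mem Q ((c.next v P i j).canon L) (y + x)

/-- The principle of optimality: the last visit of a partial solution starts from a configuration of
the previous layer, whose recorded value is at least as good, and the same visit has been tried from
there. -/
theorem Layer.next (hp : Params I L l h ents) {r : ℕ} {mem mem' : ℤ → ℤ}
    {Q Q' : List (Cfg (Fin I.n))} {hd : ℕ} (hl : Layer I L r mem Q hd)
    (he : Ext L (r + 1) mem Q mem' Q')
    (hx : ∀ (t : ℕ) (ht : t < Q.length), hd ≤ t →
      Expanded I L ents mem' Q' Q[t] (value L mem Q[t])) :
    Layer I L (r + 1) mem' Q' Q.length := by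
  obtain ⟨ys, rfl, hys⟩ := he.append
  refine ⟨by simp, ?_, ?_, ?_⟩
  · intro t ht htQ
    rw [List.getElem_append_left htQ]
    rcases lt_or_ge t hd with h1 | h1
    · exact (hl.lt t htQ h1).trans (Nat.lt_succ_self r)
    · rw [hl.eq t htQ h1]; exact Nat.lt_succ_self r
  · intro t ht htQ
    rw [List.getElem_append_right htQ]
    exact hys _ (List.getElem_mem _)
  · intro c H a b hr hc
    cases hr with
    | start => simp [Cfg.start] at hc
    | @step c H a b v P x i j hr hx' hi hj ok =>
      rw [Reach.card_S_step ok, Nat.add_right_cancel_iff] at hc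
      obtain ⟨h1, h2⟩ := hl.complete _ _ _ _ hr hc
      obtain ⟨t, ht, rfl⟩ := List.mem_iff_getElem.1 h1
      have h3 : hd ≤ t := by
        by_contra h4
        have := hl.lt t ht (by omega)
        omega
      obtain ⟨h5, h6⟩ := hx t ht h3 v P x ((hp.mem_iff v P x).2 hx') i hi j hj ok
      refine ⟨h5, ?_⟩
      rw [Reach.value_step hr.den_pos]
      linarith

theorem runs_layer (hp : Params I L l h ents) {s : St} {Q : List (Cfg (Fin I.n))} {r hd : ℕ}
    (hinv : DPInv I L ents s.mem Q) (hl : Layer I L r s.mem Q hd) (henv : Env L ents s)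
    (hhead : s.head = hd) (htail : s.tail = Q.length) (hbd : s.bd = Q.length) :
    Runs l layerP s ((Q.length - hd) * (expandCost L ents.length + 8) + 2) fun s' =>
      ∃ Q' : List (Cfg (Fin I.n)), DPInv I L ents s'.mem Q' ∧ Layer I L (r + 1) s'.mem Q' Q.length ∧
        Env L ents s' ∧ s'.head = Q.length ∧ s'.tail = Q'.length ∧ s'.rd = s.rd := by
  have hle := hl.le
  have hlen : (Q.length : ℤ) < 2 ^ l := by linarith [hp.tail_lt hinv]
  refine (Runs.for (by decide) (Q.length - hd) (m := expandCost L ents.length + 6) (fun t s' =>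
    ∃ Q' : List (Cfg (Fin I.n)), DPInv I L ents s'.mem Q' ∧ Ext L (r + 1) s.mem Q s'.mem Q' ∧
      Env L ents s' ∧ s'.head = (hd + t : ℕ) ∧ s'.tail = Q'.length ∧ s'.rd = s.rd ∧ s'.bd = s.bd ∧
      ∀ (t' : ℕ) (ht' : t' < Q.length), hd ≤ t' → t' < hd + t →
        Expanded I L ents s'.mem Q' Q[t'] (value L s.mem Q[t'])) ?_ ?_ ?_).imp ?_
  · exact ⟨Q, hinv, .refl _ _ _, henv, by simpa using hhead, htail, rfl, rfl,
      fun t' _ h1 h2 => absurd h2 (by omega)⟩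
  · rintro t s' ht ⟨Q', h1, h2, h3, h4, h5, h6, h7, h8⟩ hb
    have hQ : hd + t < Q.length := by omega
    obtain ⟨ys, hQ', hys⟩ := h2.append
    have hQ1 : hd + t < Q'.length := by rw [hQ', List.length_append]; omega
    have hget : Q'[hd + t] = Q[hd + t] := by simp only [hQ', List.getElem_append_left hQ]
    have hmem : Q[hd + t] ∈ Q' := hget ▸ List.getElem_mem _
    have hcard := hl.eq (hd + t) hQ (by omega)
    have hcode := h1.queue (hd + t) hQ1
    rw [hget] at hcode
    obtain ⟨H, hr, hH⟩ := h1.sound _ hmem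
    -- Recordings during this pass only concern configurations with one more visited node, so values
    -- of the current layer are already final.
    have hval : value L s'.mem Q[hd + t] = value L s.mem Q[hd + t] := by
      have := h2.eq _ (List.getElem_mem hQ) (by omega)
      rw [value, value, this 1 (by simp), this 2 (by simp)]
    refine ⟨?_, ?_⟩
    · simp only [Ex.eval_sub, Ex.eval_var, St.get, h4, h7, hbd]
      have : ((hd + t : ℕ) : ℤ) < Q.length := by exact_mod_cast hQ
      linarith
    · refine Runs.cons_let (z := Q[hd + t].code L) (m := expandCost L ents.length + 5) (by decide)
        (by simpa [St.get, h4] using hcode) (hp.code_lt _) ?_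
      simp only [St.set]
      refine Runs.cons_let (z := s'.mem (tab 1 (Q[hd + t].code L))) (m := expandCost L ents.length + 4)
        (by decide) (by simp [St.get]) (hb.2 _) ?_
      simp only [St.set]
      refine Runs.cons_let (z := s'.mem (tab 2 (Q[hd + t].code L))) (m := expandCost L ents.length + 3)
        (by decide) (by simp [St.get]) (hb.2 _) ?_
      simp only [St.set]
      refine Runs.cons_let (z := s'.mem (tab 3 (Q[hd + t].code L))) (m := expandCost L ents.length + 2)
        (by decide) (by simp [St.get]) (hb.2 _) ?_
      simp only [St.set]
      obtain ⟨hn, hW, hWL, hL, hE⟩ := id h3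
      refine Runs.cons (m₁ := expandCost L ents.length) (m₂ := 2)
        (Runs.imp (runs_expand hp (by exact h1) (c := Q[hd + t]) (H := H)
          ⟨hr, rfl, hH, hW, hWL, hL, hE⟩ (by exact h5)) ?_)
      rintro s'' ⟨e, u, P, en, ed, wv, i, wi, j, wj, a, b, c', d, y, g, mem, Q'', rfl, g1, g2, g3⟩
      rw [hcard] at g2
      refine Runs.cons_let (z := (hd + (t + 1) : ℕ)) (by decide)
        (by simp [St.get, h4, add_assoc]) (natCast_lt (show hd + (t + 1) ≤ Q.length by omega) hlen) ?_
      simp only [St.set]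
      refine Runs.nil ⟨Q'', g1, h2.trans g2, h3, rfl, rfl, h6, h7, ?_⟩
      intro t' ht' k1 k2
      by_cases e : t' = hd + t
      · subst e
        rw [← hval]
        exact g3
      · exact fun v P x hx i hi j hj ok => (h8 t' ht' k1 (by omega) v P x hx i hi j hj ok).ext g2
  · rintro s' ⟨Q', h1, h2, h3, h4, h5, h6, h7, h8⟩
    simp only [Ex.eval_sub, Ex.eval_var, St.get, h4, h7, hbd]
    rw [Nat.add_sub_cancel' hle]
    simp
  · rintro s' ⟨Q', h1, h2, h3, h4, h5, h6, h7, h8⟩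
    rw [Nat.add_sub_cancel' hle] at h4 h8
    exact ⟨Q', h1, hl.next hp h2 fun t ht k => h8 t ht k ht, h3, h4, h5, h6⟩

/-- The cost of the search with at most `N` configurations. -/
def searchCost (n L E N : ℕ) : ℕ := n * (N * (expandCost L E + 8) + 7) + 8

theorem graphCode_empty {n : ℕ} : graphCode (fun _ : Fin n => ∅) = 0 := by
  simp [graphCode, mask_empty]

theorem runs_search (hp : Params I L l h ents) {N : ℕ}
    (hN : ∀ mem Q, DPInv I L ents mem Q → Q.length ≤ N) {s : St} (henv : Env L ents s)
    (htab : EntTable ents s.mem) (hzero : ∀ f ∈ [1, 2, 3], ∀ x : ℕ, s.mem (tab f x) = 0) :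
    Runs l searchP s (searchCost I.n L ents.length N) fun s' =>
      ∃ Q : List (Cfg (Fin I.n)), DPInv I L ents s'.mem Q ∧ Env L ents s' ∧
        ∀ c H a b, Reach I L c H a b → c.S.card = I.n → Dom L s'.mem Q c (a / b) := by
  have h1l : (1 : ℤ) < 2 ^ l := by
    have := hp.code_le
    have : (1 : ℤ) ≤ (2 ^ I.n) ^ (2 * L + 2) := one_le_pow₀ (one_le_pow₀ (by norm_num))
    linarith
  have hnl : |(I.n : ℤ)| < 2 ^ l := by
    have h1 : I.n < 2 ^ I.n := Nat.lt_two_pow_self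
    have h2 : (I.n : ℤ) < 2 ^ I.n := by exact_mod_cast h1
    have h3 := pow_slot_lt hp (t := 1) (by omega)
    rw [pow_one, abs_of_nonneg (by positivity)] at h3
    rw [abs_of_nonneg (by positivity)]
    exact h2.trans h3
  obtain ⟨hn, hW, hWL, hL, hE⟩ := id henv
  rw [searchCost]
  -- The initial configuration has code 0 and score 0/1. Its numerator and its graph code are
  -- already 0 in the untouched memory.
  refine Runs.cons_store (m := I.n * (N * (expandCost L ents.length + 8) + 7) + 7) (by decide)
    (by decide) (by simpa using h1l) (Runs.cons_store (by decide) (by decide) (by simp) ?_)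
  simp only [Ex.eval_tb, Ex.eval_zero, Ex.eval_one]
  refine Runs.cons_let (z := 0) (by decide) rfl (by simp) ?_
  simp only [St.set]
  refine Runs.cons_let (z := 1) (by decide) rfl (by simpa using h1l) ?_
  simp only [St.set]
  refine Runs.cons_let (z := I.n) (by decide) (by simpa [St.get] using hn) hnl ?_
  simp only [St.set]
  set mem := Function.update (Function.update s.mem (tab 1 0) 1) (tab 4 0) 0 with hmem
  have other : ∀ (f : ℕ) (x : ℤ), f < 16 → (f ≠ 1 ∨ x ≠ 0) → (f ≠ 4 ∨ x ≠ 0) →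
      mem (tab f x) = s.mem (tab f x) := by
    intro f x hf h1 h4
    rw [hmem, Function.update_of_ne, Function.update_of_ne]
    · rw [ne_eq, tab_inj hf (by norm_num)]; tauto
    · rw [ne_eq, tab_inj hf (by norm_num)]; tauto
  have h10 : mem (tab 1 0) = 1 := by
    rw [hmem, Function.update_of_ne (by unfold tab; omega), Function.update_self]
  have h20 : mem (tab 2 0) = 0 := by
    rw [other 2 0 (by norm_num) (by simp) (by simp)]; exact mod_cast hzero 2 (by simp) 0
  have h30 : mem (tab 3 0) = 0 := by
    rw [other 3 0 (by norm_num) (by simp) (by simp)]; exact mod_cast hzero 3 (by simp) 0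
  have hinv : DPInv I L ents mem [Cfg.start] := by
    refine ⟨fun t ht => ?_, by simp, fun t ht => ?_, fun c hc hQ => ?_, fun c hc => ?_⟩
    · iterate 5 rw [other _ _ (by norm_num) (by simp) (by simp)]
      exact htab t ht
    · obtain rfl : t = 0 := by simpa using ht
      simp [Cfg.code_start, hmem]
    · have : (c.code L : ℤ) ≠ (Cfg.start : Cfg (Fin I.n)).code L :=
        code_ne hc Reach.start.within (by simpa using hQ)
      rw [other 1 _ (by norm_num) (.inr (by simpa [Cfg.code_start] using this)) (by simp)]
      exact hzero 1 (by simp) _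
    · obtain rfl : c = Cfg.start := by simpa using hc
      rw [Cfg.code_start, Nat.cast_zero, h10, h20, h30]
      exact ⟨_, .start, by simp [graphCode_empty]⟩
  have hlay : Layer I L 0 mem [Cfg.start] 0 := by
    refine ⟨by simp, by simp, fun t ht _ => ?_, fun c H a b hr hc => ?_⟩
    · obtain rfl : t = 0 := by simpa using ht
      simp [Cfg.start]
    · cases hr with
      | start => exact ⟨by simp, by simp [value, Cfg.code_start, h10, h20]⟩
      | step _ _ _ _ ok => rw [Reach.card_S_step ok] at hc; omega
  clear_value mem
  refine Runs.cons (m₁ := I.n * (N * (expandCost L ents.length + 8) + 7) + 2) (m₂ := 1) ?_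
  refine (Runs.for (by decide) I.n (m := N * (expandCost L ents.length + 8) + 5) (fun r s' =>
    ∃ (Q : List (Cfg (Fin I.n))) (hd : ℕ), DPInv I L ents s'.mem Q ∧ Layer I L r s'.mem Q hd ∧
      Env L ents s' ∧ s'.head = hd ∧ s'.tail = Q.length ∧ s'.rd = (I.n : ℤ) - r) ?_ ?_ ?_).imp ?_
  · exact ⟨[Cfg.start], 0, hinv, hlay, henv, rfl, rfl, by simp⟩
  · rintro r s' hr ⟨Q, hd, g1, g2, g3, g4, g5, g6⟩ hb
    refine ⟨?_, ?_⟩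
    · simp only [Ex.eval_var, St.get, g6]
      have : (r : ℤ) < I.n := by exact_mod_cast hr
      linarith
    · refine Runs.cons_let (z := Q.length) (m := N * (expandCost L ents.length + 8) + 4) (by decide)
        (by simpa [St.get] using g5) (natCast_lt le_rfl (by linarith [hp.tail_lt g1])) ?_
      simp only [St.set]
      refine Runs.cons (m₁ := N * (expandCost L ents.length + 8) + 2) (m₂ := 2) ?_
      refine ((runs_layer hp (by exact g1) (by exact g2) (by exact g3) (by exact g4) (by exact g5)
        (by rfl)).imp ?_).weaken ?_
      · rintro s'' ⟨Q', k1, k2, k3, k4, k5, k6⟩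
        refine Runs.cons_let (z := I.n - (r + 1 : ℕ)) (by decide) ?_ ?_ (Runs.nil ?_)
        · simp only [Ex.eval_sub, Ex.eval_var, Ex.eval_one, St.get, k6, g6]
          push_cast; ring
        · have : ((r + 1 : ℕ) : ℤ) ≤ I.n := by exact_mod_cast hr
          rw [abs_of_nonneg (by positivity)] at hnl
          rw [abs_of_nonneg (by linarith)]
          have : (0 : ℤ) ≤ (r + 1 : ℕ) := by positivity
          linarith
        · exact ⟨Q', Q.length, k1, k2, k3, k4, k5, rfl⟩
      -- Each of the n rounds is charged for N configurations; the lost factor n is harmless.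
      · have := hN _ _ g1
        gcongr
        omega
  · rintro s' ⟨Q, hd, g1, g2, g3, g4, g5, g6⟩
    simp [St.get, g6]
  · rintro s' ⟨Q, hd, g1, g2, g3, -⟩
    exact Runs.nil ⟨Q, g1, g3, g2.complete⟩

end Search

end Polytree

/-! ### Loops over lists, lists in memory, and computing the constants. -/

namespace RAM

section ListLoop

variable {l : ℕ} {p : Prog} {s : St} {m : ℕ}

/-- The rule for loops over a list: `J pre rest` holds when `pre` has been processed. -/
theorem Runs.forList {α : Type*} {e : Ex} (he : e.sz ≤ 100) (xs : List α)
    (J : List α → List α → St → Prop) (h : J [] xs s)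
    (hpos : ∀ pre x rest s, xs = pre ++ x :: rest → J pre (x :: rest) s → s.Bdd l →
      0 < e.eval s ∧ Runs l p s m (J (pre ++ [x]) rest))
    (hzero : ∀ s, J xs [] s → ¬ 0 < e.eval s) :
    Runs l (whileP e p) s (xs.length * (m + 2) + 2) (J xs []) := by
  refine (Runs.for (m := m) he xs.length (fun t s => J (xs.take t) (xs.drop t) s) (by simpa using h)
    (fun t s ht hs hb => ?_) (fun s hs => hzero s (by simpa using hs))).imp
    fun s hs => by simpa using hs
  rw [List.drop_eq_getElem_cons ht] at hs
  have := hpos (xs.take t) xs[t] (xs.drop (t + 1)) s (by simp) hs hb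
  simpa using this

end ListLoop

/-- The memory contains the list `xs` from the address `p` on, and ends before `M`. -/
def Reads (M : ℕ) (mem : ℤ → ℤ) (p : ℕ) (xs : List ℤ) : Prop :=
  p + xs.length ≤ M ∧ ∀ (i : ℕ) (hi : i < xs.length), mem ((p + i : ℕ) : ℤ) = xs[i]

section Reads

variable {M : ℕ} {mem mem' : ℤ → ℤ} {p : ℕ} {x : ℤ} {xs ys : List ℤ}

theorem Reads.le (h : Reads M mem p xs) : p + xs.length ≤ M := h.1

theorem Reads.congr (h : Reads M mem p xs)
    (hm : ∀ a : ℕ, p ≤ a → a < p + xs.length → mem' a = mem a) : Reads M mem' p xs :=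
  ⟨h.1, fun i hi => by rw [hm (p + i) (by omega) (by omega), h.2 i hi]⟩

theorem reads_append :
    Reads M mem p (xs ++ ys) ↔ Reads M mem p xs ∧ Reads M mem (p + xs.length) ys := by
  constructor
  · rintro ⟨h1, h2⟩
    rw [List.length_append] at h1
    refine ⟨⟨by omega, fun i hi => ?_⟩, ⟨by omega, fun i hi => ?_⟩⟩
    · rw [h2 i (by rw [List.length_append]; omega), List.getElem_append_left hi]
    · have := h2 (xs.length + i) (by rw [List.length_append]; omega)
      rw [List.getElem_append_right (by omega)] at this
      simpa [add_assoc] using this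
  · rintro ⟨⟨_, h2⟩, ⟨h3, h4⟩⟩
    refine ⟨by rw [List.length_append]; omega, fun i hi => ?_⟩
    rcases lt_or_ge i xs.length with h | h
    · rw [h2 i h, List.getElem_append_left h]
    · rw [List.length_append] at hi
      have := h4 (i - xs.length) (by omega)
      rw [show p + xs.length + (i - xs.length) = p + i by omega] at this
      rw [this, List.getElem_append_right h]

theorem reads_singleton : Reads M mem p [x] ↔ p + 1 ≤ M ∧ mem p = x := by
  refine ⟨fun h => ⟨h.1, by simpa using h.2 0 (by simp)⟩, fun h => ⟨h.1, fun i hi => ?_⟩⟩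
  obtain rfl : i = 0 := by simpa using hi
  simpa using h.2

theorem reads_cons :
    Reads M mem p (x :: xs) ↔ mem p = x ∧ Reads M mem (p + 1) xs := by
  rw [← List.singleton_append, reads_append, reads_singleton, List.length_singleton]
  exact ⟨fun h => ⟨h.1.2, h.2⟩, fun h => ⟨⟨by have := h.2.1; omega, h.1⟩, h.2⟩⟩

end Reads

open Var in
/-- Multiply `pw` by a power of two. -/
def powP : Prog := whileP j (blk [setP pw (pw + pw), setP j (j - 1)])

open Var in
/-- Count the slots, and compute the position of the sets that they hold. -/
def sizeP : Prog := whileP (n + 1 - pw) (blk [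
  setP pw (pw + pw), setP WL (WL * W), setP L (L + 1)])

open Var in
/-- Initialize the constants. -/
def initP : Prog := blk [
  setP n (.ld 0), setP pw 1, setP j n, powP, setP W pw, setP pw 1, setP WL W, setP L 1, sizeP]

open Var in
/-- Read the nodes of a set. -/
def nodesP : Prog := whileP ln (blk [
  setP pw 1, setP j (.ld pos), powP, setP P (P + pw), setP pos (pos + 1), setP ln (ln - 1)])

open Var in
/-- Read a score, and record it. -/
def recordP : Prog := blk [
  storeP (tb 5 E) u, storeP (tb 6 E) P, storeP (tb 7 E) (.ld pos), storeP (tb 8 E) (.ld (pos + 1)),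
  storeP (tb 9 E) wv, setP pos (pos + 2), setP E (E + 1), setP cnt (cnt - 1)]

open Var in
/-- Read a potential parent set and its score. -/
def readP : Prog := blk [setP ln (.ld pos), setP pos (pos + 1), setP P 0, nodesP, recordP]

open Var in
/-- Read the instance. -/
def parseP : Prog := blk [
  setP pos 1, setP E 0, setP u 1, setP wv 1, setP i n,
  whileP i (blk [
    setP cnt (.ld pos), setP pos (pos + 1), whileP cnt readP,
    setP u (u + u), setP wv (wv * W), setP i (i - 1)])]

section Init

variable {l : ℕ} {s : St}

theorem runs_pow {v : ℕ} (hj : s.j = v) (hpw : s.pw = 1) (hl : (2 : ℤ) ^ v < 2 ^ l) :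
    Runs l powP s (v * 5 + 2) fun s' => s' = { s with pw := 2 ^ v, j := 0 } := by
  refine (Runs.for (by decide) v (m := 3) (fun t s' => s' = { s with pw := 2 ^ t, j := (v : ℤ) - t })
    ?_ ?_ ?_).imp ?_
  · simp [← hj, ← hpw]
  · rintro t s' ht rfl -
    have h1 : (t : ℤ) < v := by exact_mod_cast ht
    refine ⟨by simp [St.get, h1], ?_⟩
    refine Runs.cons_let (z := 2 ^ (t + 1)) (by decide) (by simp [St.get]; ring) ?_ ?_
    · rw [abs_of_nonneg (by positivity)]
      exact (pow_le_pow_right₀ (by norm_num) ht).trans_lt hl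
    simp only [St.set]
    refine Runs.cons_let (z := (v : ℤ) - (t + 1 : ℕ)) (by decide) (by simp [St.get]; ring) ?_
      (Runs.nil rfl)
    have h2 : v < 2 ^ v := Nat.lt_two_pow_self
    have h3 : (v : ℤ) < 2 ^ v := by exact_mod_cast h2
    rw [abs_of_nonneg (by push_cast; linarith)]
    push_cast; linarith
  · rintro s' rfl; simp [St.get]
  · rintro s' rfl; simp

/-- Doubling continues as long as 2^t ≤ n, which is equivalent to t < `n.size`. Starting from L = 1
gives `n.size` + 1 slots, the number needed by `exists_visits`. -/
theorem runs_size {n : ℕ} (hn : s.n = n) (hW : s.W = 2 ^ n) (hWL : s.WL = 2 ^ n) (hL : s.L = 1)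
    (hpw : s.pw = 1) (hl : ((2 : ℤ) ^ n) ^ (n + 1) < 2 ^ l) :
    Runs l sizeP s (n.size * 6 + 2) fun s' =>
      s' = { s with pw := 2 ^ n.size, WL := (2 ^ n) ^ (n.size + 1), L := (n.size + 1 : ℕ) } := by
  have hsz : n.size ≤ n := Nat.size_le.2 Nat.lt_two_pow_self
  have hle : (2 : ℤ) ^ n ≤ (2 ^ n) ^ (n + 1) :=
    le_self_pow₀ (one_le_pow₀ (by norm_num)) (by omega)
  refine (Runs.for (by decide) n.size (m := 4) (fun t s' => s' = { s with
    pw := 2 ^ t, WL := (2 ^ n) ^ (t + 1), L := (t + 1 : ℕ) }) ?_ ?_ ?_)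
  · cases s; simp_all
  · rintro t s' ht rfl -
    refine ⟨?_, ?_⟩
    · have h1 : (2 : ℤ) ^ t ≤ n := by exact_mod_cast Nat.lt_size.1 ht
      simp only [Ex.eval_sub, Ex.eval_add, Ex.eval_var, Ex.eval_one, St.get, hn]
      linarith
    · refine Runs.cons_let (z := 2 ^ (t + 1)) (by decide) (by simp [St.get]; ring) ?_ ?_
      · rw [abs_of_nonneg (by positivity)]
        exact ((pow_le_pow_right₀ (by norm_num) (by omega)).trans hle).trans_lt hl
      simp only [St.set]
      refine Runs.cons_let (z := (2 ^ n) ^ (t + 1 + 1)) (by decide)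
        (by simp [St.get, hW, pow_succ]) ?_ ?_
      · rw [abs_of_nonneg (by positivity)]
        exact (pow_le_pow_right₀ (one_le_pow₀ (by norm_num)) (by omega)).trans_lt hl
      simp only [St.set]
      refine Runs.cons_let (z := (t + 1 + 1 : ℕ)) (by decide) (by simp [St.get]) ?_ (Runs.nil rfl)
      have h2 : n < 2 ^ n := Nat.lt_two_pow_self
      have h3 : (n : ℤ) + 1 ≤ 2 ^ n := by exact_mod_cast h2
      rw [abs_of_nonneg (by positivity)]
      have : ((t + 1 + 1 : ℕ) : ℤ) ≤ n + 1 := by exact_mod_cast (by omega : t + 1 + 1 ≤ n + 1)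
      linarith
  · rintro s' rfl
    have h1 : n < 2 ^ n.size := Nat.lt_size_self n
    have h2 : (n : ℤ) + 1 ≤ 2 ^ n.size := by exact_mod_cast h1
    simp only [Ex.eval_sub, Ex.eval_add, Ex.eval_var, Ex.eval_one, St.get, hn]
    linarith

theorem runs_init {n : ℕ} (hn : s.mem 0 = n) (hl : ((2 : ℤ) ^ n) ^ (n + 1) < 2 ^ l) :
    Runs l initP s (n * 11 + 12) fun s' => s' = { s with
      n := n, W := 2 ^ n, pw := 2 ^ n.size, j := 0, WL := (2 ^ n) ^ (n.size + 1),
      L := (n.size + 1 : ℕ) } := by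
  have hsz : n.size ≤ n := Nat.size_le.2 Nat.lt_two_pow_self
  have h1l : (1 : ℤ) < 2 ^ l := by
    have : (1 : ℤ) ≤ (2 ^ n) ^ (n + 1) := one_le_pow₀ (one_le_pow₀ (by norm_num))
    linarith
  have hle : (2 : ℤ) ^ n < 2 ^ l :=
    (le_self_pow₀ (one_le_pow₀ (by norm_num)) (by omega : n + 1 ≠ 0)).trans_lt hl
  have h2 : n < 2 ^ n := Nat.lt_two_pow_self
  have h3 : (n : ℤ) < 2 ^ n := by exact_mod_cast h2
  have hnl : |(n : ℤ)| < 2 ^ l := by rw [abs_of_nonneg (by positivity)]; linarith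
  have hWl : |(2 : ℤ) ^ n| < 2 ^ l := by rwa [abs_of_nonneg (by positivity)]
  refine Runs.cons_let (z := n) (m := n * 11 + 11) (by decide) (by simpa using hn) hnl ?_
  simp only [St.set]
  refine Runs.cons_let (z := 1) (m := n * 11 + 10) (by decide) rfl (by simpa using h1l) ?_
  simp only [St.set]
  refine Runs.cons_let (z := n) (m := n * 11 + 9) (by decide) rfl hnl ?_
  simp only [St.set]
  refine Runs.weaken (m := (n * 5 + 2) + (n * 6 + 7)) (Runs.cons (Runs.imp
    (runs_pow rfl rfl hle) ?_)) (by omega)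
  rintro s' rfl
  refine Runs.cons_let (z := 2 ^ n) (m := n * 6 + 6) (by decide) rfl hWl ?_
  simp only [St.set]
  refine Runs.cons_let (z := 1) (m := n * 6 + 5) (by decide) rfl (by simpa using h1l) ?_
  simp only [St.set]
  refine Runs.cons_let (z := 2 ^ n) (m := n * 6 + 4) (by decide) rfl hWl ?_
  simp only [St.set]
  refine Runs.cons_let (z := 1) (m := n * 6 + 3) (by decide) rfl (by simpa using h1l) ?_
  simp only [St.set]
  refine Runs.weaken (m := (n.size * 6 + 2) + 1) (Runs.cons (Runs.imp
    (runs_size rfl rfl rfl rfl rfl hl) ?_)) (by omega)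
  rintro s' rfl
  exact Runs.nil rfl

end Init

end RAM

/-! ### Reading the instance. -/

namespace RAM

theorem Runs.cons_put {l m : ℕ} {s : St} {ps : List Prog} {Q : St → Prop} {a e : Ex} {x z : ℤ}
    (ha : a.sz ≤ 100) (he : e.sz ≤ 100) (hx : a.eval s = x) (hz : e.eval s = z) (hb : |z| < 2 ^ l)
    (h : Runs l (blk ps) { s with mem := Function.update s.mem x z } m Q) :
    Runs l (blk (storeP a e :: ps)) s (m + 1) Q := by
  subst hx hz; exact Runs.cons_store ha he hb h

end RAM

namespace Polytree

open RAM

/-- In the definition the list is first coerced to a list of natural numbers by a monadic bind; this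
restores a plain map. -/
theorem encodeNodes_eq {n : ℕ} (K : List (Fin n)) :
    encodeNodes K = (K.length : ℤ) :: K.map (fun i : Fin n => ((i : ℕ) : ℤ)) := by
  rw [encodeNodes]
  congr 1
  change List.map _ (K >>= fun a => pure (a : ℕ)) = _
  rw [List.bind_eq_flatMap, List.map_flatMap]
  induction K with
  | nil => rfl
  | cons x K ih => simpa using ih

section Parse

variable {I : Instance} {L l : ℕ} {ents : List (Fin I.n × Finset (Fin I.n) × ℚ)} {M : ℕ}

/-- The entries before `p` have been read, and the potential parent sets `ents` have been recorded. -/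
structure Parsed (I : Instance) (L : ℕ) (mem : ℤ → ℤ) (p : ℕ)
    (ents : List (Fin I.n × Finset (Fin I.n) × ℚ)) (s : St) : Prop where
  env : Env L ents s
  pos : s.pos = p
  le : ents.length ≤ p
  table : EntTable ents s.mem
  input : ∀ a : ℕ, s.mem a = mem a
  zero : ∀ f < 5, ∀ x, s.mem (tab f x) = mem (tab f x)

/-- The mask is accumulated by adding powers of two, which is correct because no node is listed
twice. -/
theorem runs_nodes {s : St} {n : ℕ} {K : List (Fin n)} (hK : K.Nodup) {p : ℕ} {tail : List ℤ}
    (hr : Reads M s.mem p (K.map (fun i : Fin n => ((i : ℕ) : ℤ)) ++ tail)) (hpos : s.pos = p)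
    (hln : s.ln = K.length) (hP : s.P = 0) (hl : (2 : ℤ) ^ n < 2 ^ l) (hM : (M : ℤ) < 2 ^ l) :
    Runs l nodesP s (n * (n * 5 + 10) + 2) fun s' => ∃ pw j : ℤ,
      s' = { s with pw := pw, j := j, P := mask K.toFinset, pos := (p + K.length : ℕ), ln := 0 } := by
  have hKn : K.length ≤ n := by simpa using hK.length_le_card
  have h1l : (1 : ℤ) < 2 ^ l := by
    have : (1 : ℤ) ≤ 2 ^ n := one_le_pow₀ (by norm_num)
    linarith
  have hpM := hr.le
  simp only [List.length_append, List.length_map] at hpM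
  refine ((Runs.forList (by decide) K (m := n * 5 + 8) (fun pre rest s' => ∃ pw j : ℤ,
    s' = { s with pw := pw, j := j, P := mask pre.toFinset, pos := (p + pre.length : ℕ),
                  ln := rest.length }) ?_ ?_ ?_).weaken ?_).imp ?_
  · exact ⟨s.pw, s.j, by simp [← hP, ← hpos, ← hln]⟩
  · rintro pre x rest s' hx ⟨pw, j, rfl⟩ -
    have hlen : K.length = pre.length + (rest.length + 1) := by simp [hx]
    have hxl : (2 : ℤ) ^ (x : ℕ) ≤ 2 ^ n := pow_le_pow_right₀ (by norm_num) x.2.le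
    have hread : s.mem ((p + pre.length : ℕ) : ℤ) = (x : ℕ) := by
      have := (reads_append.1 hr).1.2 pre.length (by rw [List.length_map]; omega)
      simpa [hx] using this
    refine ⟨by simp [St.get], ?_⟩
    refine Runs.cons_let (z := 1) (m := n * 5 + 7) (by decide) rfl (by simpa using h1l) ?_
    simp only [St.set]
    refine Runs.cons_let (z := (x : ℕ)) (m := n * 5 + 6) (by decide) hread
      (natCast_lt x.2.le ?_) ?_
    · have h2 : n < 2 ^ n := Nat.lt_two_pow_self
      have h3 : (n : ℤ) < 2 ^ n := by exact_mod_cast h2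
      linarith
    simp only [St.set]
    refine Runs.weaken (m := ((x : ℕ) * 5 + 2) + 4) (Runs.cons (Runs.imp
      (runs_pow rfl rfl (hxl.trans_lt hl)) ?_)) (by have := x.2; omega)
    rintro s' rfl
    have hxp : x ∉ pre.toFinset := by
      rw [hx] at hK
      have := List.nodup_append.1 hK
      intro h
      exact this.2.2 x (List.mem_toFinset.1 h) x (by simp) rfl
    refine Runs.cons_let (z := mask (pre ++ [x]).toFinset) (by decide) ?_ ?_ ?_
    · rw [List.toFinset_append, List.toFinset_cons, List.toFinset_nil, insert_empty_eq,
        Finset.union_comm, ← Finset.insert_eq, mask_insert hxp]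
      simp [St.get]; ring
    · rw [abs_of_nonneg (by positivity)]
      have : (mask (pre ++ [x]).toFinset : ℤ) < 2 ^ n := by exact_mod_cast mask_lt _
      linarith
    simp only [St.set]
    refine Runs.cons_let (z := (p + (pre ++ [x]).length : ℕ)) (by decide)
      (by simp [St.get, add_assoc]) (natCast_lt (show _ ≤ M by simp; omega) hM) ?_
    simp only [St.set]
    refine Runs.cons_let (z := rest.length) (by decide) (by simp [St.get])
      (natCast_lt (show _ ≤ M by omega) hM) (Runs.nil ⟨_, _, rfl⟩)
  · rintro s' ⟨pw, j, rfl⟩; simp [St.get]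
  · gcongr
  · rintro s' ⟨pw, j, rfl⟩; exact ⟨pw, j, by simp⟩

/-- The writes go to a fresh index of the tables 5 to 9, so they disturb neither the input, at
nonnegative addresses, nor the tables of the dynamic program, which have smaller numbers. -/
theorem EntTable.snoc {mem mem' : ℤ → ℤ} (h : EntTable ents mem) {v : Fin I.n}
    {P : Finset (Fin I.n)} {q : ℚ}
    (hm : mem' = Function.update (Function.update (Function.update (Function.update
      (Function.update mem (tab 5 ents.length) (2 ^ (v : ℕ))) (tab 6 ents.length) (mask P))
      (tab 7 ents.length) q.num) (tab 8 ents.length) q.den) (tab 9 ents.length)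
      ((2 ^ I.n) ^ (v : ℕ))) :
    EntTable (ents ++ [(v, P, q)]) mem' ∧ (∀ a : ℕ, mem' a = mem a) ∧
      ∀ f < 5, ∀ x, mem' (tab f x) = mem (tab f x) := by
  have other : ∀ a, (∀ f, 5 ≤ f → f < 10 → a ≠ tab f ents.length) → mem' a = mem a := by
    intro a ha
    rw [hm]
    iterate 5 rw [Function.update_of_ne (ha _ (by norm_num) (by norm_num))]
  have ne : ∀ f f' : ℕ, f < 16 → f' < 16 → f ≠ f' → tab f ents.length ≠ tab f' ents.length :=
    fun f f' h1 h2 h3 e => h3 ((tab_inj h1 h2).1 e).1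
  refine ⟨fun t ht => ?_, fun a => other _ fun f _ _ e => ?_, fun f hf x => other _ fun f' h1 h2 e => ?_⟩
  · by_cases e : t = ents.length
    · subst e
      simp [hm, Function.update_of_ne, ne]
    · have ht' : t < ents.length := by
        rw [List.length_append, List.length_singleton] at ht; omega
      have hne : ∀ f, f < 10 → mem' (tab f t) = mem (tab f t) := fun f hf =>
        other _ fun f' _ h2 e' => e (by exact_mod_cast ((tab_inj (by omega) (by omega)).1 e').2)
      rw [hne 5 (by norm_num), hne 6 (by norm_num), hne 7 (by norm_num), hne 8 (by norm_num),
        hne 9 (by norm_num), List.getElem_append_left ht']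
      exact h t ht'
  · have : (0 : ℤ) ≤ ents.length := by positivity
    unfold tab at e; omega
  · have := ((tab_inj (by omega) (by omega)).1 e).1
    omega

theorem runs_record {s : St} {p : ℕ} {v : Fin I.n} {K : Finset (Fin I.n)} {q : ℚ} {k : ℕ}
    (hE : s.E = ents.length) (hpos : s.pos = p) (hu : s.u = 2 ^ (v : ℕ))
    (hwv : s.wv = (2 ^ I.n) ^ (v : ℕ)) (hP : s.P = mask K) (hnum : s.mem p = q.num)
    (hden : s.mem (p + 1 : ℕ) = q.den) (hcnt : s.cnt = k + 1) (hM : (M : ℤ) < 2 ^ l)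
    (hpM : p + 2 ≤ M) (hle : ents.length < p) :
    Runs l recordP s 9 fun s' => s' = { s with
      pos := (p + 2 : ℕ), E := (ents.length + 1 : ℕ), cnt := k
      mem := Function.update (Function.update (Function.update (Function.update
        (Function.update s.mem (tab 5 ents.length) (2 ^ (v : ℕ))) (tab 6 ents.length) (mask K))
        (tab 7 ents.length) q.num) (tab 8 ents.length) q.den) (tab 9 ents.length)
        ((2 ^ I.n) ^ (v : ℕ)) } := by
  have rd : ∀ (f : ℕ) (y : ℤ) (a : ℕ) (mem' : ℤ → ℤ), 0 < f →
      Function.update mem' (tab f ents.length) y (a : ℤ) = mem' a := by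
    intro f y a mem' h1
    refine Function.update_of_ne ?_ _ _
    unfold tab; omega
  refine Runs.with_bdd fun hb => ?_
  refine Runs.cons_put (x := tab 5 ents.length) (z := 2 ^ (v : ℕ)) (by decide) (by decide)
    (by simp [St.get, hE]) hu (by have := hb.1 .u; rwa [St.get, hu] at this) ?_
  refine Runs.cons_put (x := tab 6 ents.length) (z := mask K) (by decide) (by decide)
    (by simp [St.get, hE]) hP (by have := hb.1 .P; rwa [St.get, hP] at this) ?_
  refine Runs.cons_put (x := tab 7 ents.length) (z := q.num) (by decide) (by decide)
    (by simp [St.get, hE]) ?_ (hnum ▸ hb.2 _) ?_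
  · simp only [Ex.eval_ld, Ex.eval_var, St.get]
    rw [hpos, rd _ _ _ _ (by norm_num), rd _ _ _ _ (by norm_num), hnum]
  refine Runs.cons_put (x := tab 8 ents.length) (z := q.den) (by decide) (by decide)
    (by simp [St.get, hE]) ?_ (hden ▸ hb.2 _) ?_
  · simp only [Ex.eval_ld, Ex.eval_add, Ex.eval_one, Ex.eval_var, St.get]
    rw [hpos, ← Nat.cast_succ, rd _ _ _ _ (by norm_num), rd _ _ _ _ (by norm_num),
      rd _ _ _ _ (by norm_num), hden]
  refine Runs.cons_put (x := tab 9 ents.length) (z := (2 ^ I.n) ^ (v : ℕ)) (by decide) (by decide)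
    (by simp [St.get, hE]) hwv (by have := hb.1 .wv; rwa [St.get, hwv] at this) ?_
  refine Runs.cons_let (z := (p + 2 : ℕ)) (by decide) (by simp [St.get, hpos])
    (natCast_lt (show _ ≤ M by omega) hM) ?_
  simp only [St.set]
  refine Runs.cons_let (z := (ents.length + 1 : ℕ)) (by decide) (by simp [St.get, hE])
    (natCast_lt (show _ ≤ M by omega) hM) ?_
  simp only [St.set]
  refine Runs.cons_let (z := k) (by decide) (by simp [St.get, hcnt]) ?_ (Runs.nil rfl)
  have := hb.1 .cnt
  simp only [St.get, hcnt] at this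
  rw [abs_of_nonneg (by positivity)] at this ⊢
  linarith

theorem runs_read {mem : ℤ → ℤ} {p : ℕ} {s : St} (hs : Parsed I L mem p ents s) {v : Fin I.n}
    {K : List (Fin I.n)} (hK : K.Nodup) {q : ℚ} {tail : List ℤ}
    (hr : Reads M mem p (encodeEntry K q ++ tail)) (hu : s.u = 2 ^ (v : ℕ))
    (hwv : s.wv = (2 ^ I.n) ^ (v : ℕ)) {k : ℕ} (hcnt : s.cnt = k + 1) (hl : (2 : ℤ) ^ I.n < 2 ^ l)
    (hM : (M : ℤ) < 2 ^ l) :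
    Runs l readP s (I.n * (I.n * 5 + 10) + 15) fun s' => ∃ p' : ℕ,
      Parsed I L mem p' (ents ++ [(v, K.toFinset, q)]) s' ∧ Reads M mem p' tail ∧
      s'.u = s.u ∧ s'.wv = s.wv ∧ s'.cnt = k ∧ s'.i = s.i := by
  have hrM := hr.le
  simp only [encodeEntry, encodeNodes_eq, List.cons_append, List.append_assoc, List.nil_append,
    reads_cons] at hr
  obtain ⟨h1, hr⟩ := hr
  have hr' := (reads_append.1 hr).2
  rw [List.length_map, reads_cons, reads_cons] at hr'
  obtain ⟨h2, h3, h4⟩ := hr'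
  have hpM := h4.le
  obtain ⟨henv, hpos, hle, htab, hin, hz⟩ := hs
  have hhrs := hr.congr fun a _ _ => hin a
  obtain ⟨hn, hW, hWL, hL, hE⟩ := id henv
  refine Runs.cons_let (z := K.length) (m := I.n * (I.n * 5 + 10) + 14) (by decide)
    (by simp [St.get, hpos, hin, h1]) (natCast_lt (show _ ≤ M by omega) hM) ?_
  simp only [St.set]
  refine Runs.cons_let (z := (p + 1 : ℕ)) (m := I.n * (I.n * 5 + 10) + 13) (by decide)
    (by simp [St.get, hpos]) (natCast_lt (show _ ≤ M by omega) hM) ?_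
  simp only [St.set]
  refine Runs.cons_let (z := 0) (m := I.n * (I.n * 5 + 10) + 12) (by decide) rfl (by simp) ?_
  simp only [St.set]
  refine Runs.cons (m₁ := I.n * (I.n * 5 + 10) + 2) (m₂ := 10)
    ((runs_nodes hK (by exact hhrs) rfl rfl rfl hl hM).imp ?_)
  rintro s' ⟨pw, j, rfl⟩
  dsimp only
  refine Runs.cons (m₁ := 9) (m₂ := 1) ((runs_record (ents := ents) (p := p + 1 + K.length) (v := v)
    (K := K.toFinset) (q := q) (k := k) (by exact hE) rfl (by exact hu) (by exact hwv) rfl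
    (by rw [← h2]; exact hin _) (by rw [← h3]; exact hin _) (by exact hcnt) hM (by omega)
    (by omega)).imp ?_)
  rintro s' rfl
  dsimp only
  obtain ⟨t1, t2, t3⟩ := htab.snoc (v := v) (P := K.toFinset) (q := q) rfl
  refine Runs.nil ⟨p + 1 + K.length + 2, ⟨⟨hn, hW, hWL, hL, by simp⟩, rfl, ?_, t1,
    fun a => (t2 a).trans (hin a), fun f hf x => (t3 f hf x).trans (hz f hf x)⟩, h4, rfl, rfl, rfl, rfl⟩
  rw [List.length_append, List.length_singleton]
  omega

theorem runs_fam {mem : ℤ → ℤ} {p : ℕ} {s : St} (hs : Parsed I L mem p ents s) {v : Fin I.n}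
    {Ks : List (List (Fin I.n))} (hK : ∀ K ∈ Ks, K.Nodup) (q : Finset (Fin I.n) → ℚ) {tail : List ℤ}
    (hr : Reads M mem p ((Ks.flatMap fun K => encodeEntry K (q K.toFinset)) ++ tail))
    (hu : s.u = 2 ^ (v : ℕ)) (hwv : s.wv = (2 ^ I.n) ^ (v : ℕ)) (hcnt : s.cnt = Ks.length)
    (hl : (2 : ℤ) ^ I.n < 2 ^ l) (hM : (M : ℤ) < 2 ^ l) :
    Runs l (whileP (Ex.var .cnt) readP) s (Ks.length * (I.n * (I.n * 5 + 10) + 15 + 2) + 2) fun s' =>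
      ∃ p' : ℕ, Parsed I L mem p' (ents ++ Ks.map fun K => (v, K.toFinset, q K.toFinset)) s' ∧
        Reads M mem p' tail ∧ s'.u = s.u ∧ s'.wv = s.wv ∧ s'.i = s.i := by
  refine ((Runs.forList (by decide) Ks (m := I.n * (I.n * 5 + 10) + 15) (fun pre rest s' =>
    ∃ p' : ℕ, Parsed I L mem p' (ents ++ pre.map fun K => (v, K.toFinset, q K.toFinset)) s' ∧
      Reads M mem p' ((rest.flatMap fun K => encodeEntry K (q K.toFinset)) ++ tail) ∧
        s'.u = s.u ∧ s'.wv = s.wv ∧ s'.cnt = rest.length ∧ s'.i = s.i) ?_ ?_ ?_).imp ?_)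
  · exact ⟨p, by simpa using hs, hr, rfl, rfl, hcnt, rfl⟩
  · rintro pre K rest s' hx ⟨p', h1, h2, h3, h4, h5, h6⟩ -
    rw [List.length_cons] at h5
    rw [List.flatMap_cons, List.append_assoc] at h2
    refine ⟨by simp only [Ex.eval_var, St.get, h5]; positivity, ?_⟩
    refine (runs_read (v := v) h1 (hK K (by simp [hx])) h2 (h3.trans hu) (h4.trans hwv)
      (k := rest.length) (by simpa using h5) hl hM).imp ?_
    rintro s'' ⟨p'', g1, g2, g3, g4, g5, g6⟩
    exact ⟨p'', by simpa using g1, g2, g3.trans h3, g4.trans h4, g5, g6.trans h6⟩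
  · rintro s' ⟨p', h1, h2, h3, h4, h5, h6⟩
    simp [St.get, h5]
  · rintro s' ⟨p', h1, h2, h3, h4, h5, h6⟩
    exact ⟨p', h1, by simpa using h2, h3, h4, h6⟩

theorem val_eq_length {n : ℕ} {pre rest : List (Fin n)} {x : Fin n}
    (h : List.finRange n = pre ++ x :: rest) : (x : ℕ) = pre.length := by
  have h1 : pre.length < (List.finRange n).length := by rw [h]; simp
  have h2 : (List.finRange n)[pre.length]'h1 = x := by simp [h]
  rw [← h2]; simp

theorem length_finRange_eq {n : ℕ} {pre rest : List (Fin n)} {x : Fin n}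
    (h : List.finRange n = pre ++ x :: rest) : n = pre.length + (rest.length + 1) := by
  have := congrArg List.length h
  simpa using this

theorem runs_parse {s : St} (henv : s.n = I.n ∧ s.W = 2 ^ I.n ∧ s.WL = (2 ^ I.n) ^ L ∧ s.L = L)
    {fam : Fin I.n → List (List (Fin I.n))} (hK : ∀ v, ∀ K ∈ fam v, K.Nodup)
    (q : Fin I.n → Finset (Fin I.n) → ℚ)
    (hr : Reads M s.mem 1 ((List.finRange I.n).flatMap fun v => ((fam v).length : ℤ) ::
      (fam v).flatMap fun K => encodeEntry K (q v K.toFinset)))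
    (hl : ((2 : ℤ) ^ I.n) ^ (I.n + 1) < 2 ^ l) (hM : (M : ℤ) < 2 ^ l) {F : ℕ}
    (hF : ∀ v, (fam v).length ≤ F) :
    Runs l parseP s (I.n * (F * (I.n * (I.n * 5 + 10) + 17) + 10) + 8) fun s' =>
      ∃ p, Parsed I L s.mem p ((List.finRange I.n).flatMap fun v =>
        (fam v).map fun K => (v, K.toFinset, q v K.toFinset)) s' := by
  have h1l : (1 : ℤ) < 2 ^ l := by
    have : (1 : ℤ) ≤ (2 ^ I.n) ^ (I.n + 1) := one_le_pow₀ (one_le_pow₀ (by norm_num))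
    linarith
  have hle : (2 : ℤ) ^ I.n < 2 ^ l :=
    (le_self_pow₀ (one_le_pow₀ (by norm_num)) (by omega : I.n + 1 ≠ 0)).trans_lt hl
  have hnl : (I.n : ℤ) < 2 ^ l := by
    have h2 : I.n < 2 ^ I.n := Nat.lt_two_pow_self
    have h3 : (I.n : ℤ) < 2 ^ I.n := by exact_mod_cast h2
    linarith
  obtain ⟨hn, hW, hWL, hL⟩ := henv
  have hr1 := hr.le
  refine Runs.cons_let (z := 1) (m := I.n * (F * (I.n * (I.n * 5 + 10) + 17) + 10) + 7) (by decide) rfl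
    (by simpa using h1l) ?_
  simp only [St.set]
  refine Runs.cons_let (z := 0) (by decide) rfl (by simp) ?_
  simp only [St.set]
  refine Runs.cons_let (z := 1) (by decide) rfl (by simpa using h1l) ?_
  simp only [St.set]
  refine Runs.cons_let (z := 1) (by decide) rfl (by simpa using h1l) ?_
  simp only [St.set]
  refine Runs.cons_let (z := I.n) (by decide) hn (natCast_lt le_rfl hnl) ?_
  simp only [St.set]
  refine Runs.cons (m₁ := I.n * (F * (I.n * (I.n * 5 + 10) + 17) + 10) + 2) (m₂ := 1) ?_
  refine ((Runs.forList (by decide) (List.finRange I.n)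
    (m := F * (I.n * (I.n * 5 + 10) + 17) + 8) (fun pre rest s' =>
    ∃ p' : ℕ, Parsed I L s.mem p' (pre.flatMap fun v =>
        (fam v).map fun K => (v, K.toFinset, q v K.toFinset)) s' ∧
      Reads M s.mem p' (rest.flatMap fun v => ((fam v).length : ℤ) ::
        (fam v).flatMap fun K => encodeEntry K (q v K.toFinset)) ∧
      s'.u = 2 ^ pre.length ∧ s'.wv = (2 ^ I.n) ^ pre.length ∧ s'.i = rest.length) ?_ ?_ ?_).imp ?_
      ).weaken (by simp)
  · exact ⟨1, ⟨⟨hn, hW, hWL, hL, by simp⟩, rfl, by simp, fun t ht => absurd ht (by simp),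
      fun _ => rfl, fun _ _ _ => rfl⟩, hr, by simp, by simp, by simp⟩
  · rintro pre v rest s' hx ⟨p', ⟨g1, g2, g3, g4, g5, g6⟩, h2, h3, h4, h5⟩ -
    have hv := val_eq_length hx
    have hlen := length_finRange_eq hx
    rw [List.length_cons] at h5
    rw [List.flatMap_cons, List.cons_append, reads_cons] at h2
    obtain ⟨k1, k2⟩ := h2
    have k3 := k2.le
    -- Every listed set occupies at least one input cell, so the counter is bounded by the input
    -- length.
    have k4 : (fam v).length ≤ M := by
      have : (fam v).length ≤ ((fam v).flatMap fun K => encodeEntry K (q v K.toFinset)).length := by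
        generalize fam v = Ks
        induction Ks with
        | nil => simp
        | cons K Ks ih =>
          rw [List.flatMap_cons, List.length_append, List.length_cons, encodeEntry,
            List.length_append, List.length_cons]
          omega
      rw [List.length_append] at k3
      omega
    refine ⟨by simp only [Ex.eval_var, St.get, h5]; positivity, ?_⟩
    refine Runs.cons_let (z := (fam v).length) (m := F * (I.n * (I.n * 5 + 10) + 17) + 7) (by decide)
      (by simp [St.get, g2, g5, k1]) (natCast_lt k4 hM) ?_
    simp only [St.set]
    refine Runs.cons_let (z := (p' + 1 : ℕ)) (m := F * (I.n * (I.n * 5 + 10) + 17) + 6) (by decide)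
      (by simp [St.get, g2]) (natCast_lt (show _ ≤ M by omega) hM) ?_
    simp only [St.set]
    refine Runs.weaken (m := ((fam v).length * (I.n * (I.n * 5 + 10) + 15 + 2) + 2) + 4)
      (Runs.cons (Runs.imp (runs_fam (v := v) (ents := pre.flatMap fun v =>
        (fam v).map fun K => (v, K.toFinset, q v K.toFinset)) (p := p' + 1)
        ⟨by exact g1, rfl, by omega, by exact g4, by exact g5, by exact g6⟩
        (hK v) (q v) k2 (by rw [hv]; exact h3) (by rw [hv]; exact h4) rfl hle hM) ?_)) ?_
    · rintro s'' ⟨p'', ⟨f1, f2, f3, f4, f5, f6⟩, e2, e3, e4, e5⟩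
      simp only at e3 e4 e5
      refine Runs.cons_let (z := 2 ^ (pre.length + 1)) (by decide)
        (by simp [St.get, e3, h3]; ring) ?_ ?_
      · rw [abs_of_nonneg (by positivity)]
        exact (pow_le_pow_right₀ (by norm_num) (by omega)).trans_lt hle
      simp only [St.set]
      refine Runs.cons_let (z := (2 ^ I.n) ^ (pre.length + 1)) (by decide)
        (by simp [St.get, e4, h4, f1.2.1, pow_succ]) ?_ ?_
      · rw [abs_of_nonneg (by positivity)]
        exact (pow_le_pow_right₀ (one_le_pow₀ (by norm_num)) (by omega)).trans_lt hl
      simp only [St.set]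
      refine Runs.cons_let (z := rest.length) (by decide) (by simp [St.get, e5, h5])
        (natCast_lt (show rest.length ≤ I.n by omega) hnl) (Runs.nil ?_)
      simp only [St.set]
      rw [List.flatMap_append, List.flatMap_singleton, List.length_append, List.length_singleton]
      exact ⟨p'', ⟨by exact f1, f2, f3, f4, f5, f6⟩, e2, rfl, rfl, trivial⟩
    · have := hF v
      have : (fam v).length * (I.n * (I.n * 5 + 10) + 15 + 2) ≤ F * (I.n * (I.n * 5 + 10) + 17) :=
        Nat.mul_le_mul_right _ this
      omega
  · rintro s' ⟨p', h1, h2, h3, h4, h5⟩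
    simp [St.get, h5]
  · rintro s' ⟨p', h1, h2, h3, h4, h5⟩
    exact Runs.nil ⟨p', h1⟩

end Parse

end Polytree

/-! ### Writing the output. -/

namespace RAM

open Var in
/-- Write the nodes of the set with the mask `y`. -/
def maskP : Prog := whileP (n - j) (blk [
  iteP (md y 2) (blk [setP cnt (cnt + 1), storeP (o + cnt) j]) .skip, setP y (y / 2), setP j (j + 1)])

open Var in
/-- Write the graph recorded for the set of all nodes. -/
def outP : Prog := blk [
  setP hx (.ld (tb 3 (W - 1))), setP o 0, setP i n,
  whileP i (blk [
    setP y (md hx W), setP hx (hx / W), setP cnt 0, setP j 0, maskP,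
    storeP o cnt, setP o (o + cnt + 1), setP i (i - 1)])]

end RAM

namespace Polytree

open RAM

theorem reads_update {M : ℕ} {mem : ℤ → ℤ} {p : ℕ} {xs : List ℤ} (h : Reads M mem p xs) {a : ℕ}
    (ha : p + xs.length ≤ a) (z : ℤ) : Reads M (Function.update mem a z) p xs :=
  h.congr fun b _ h2 => Function.update_of_ne (by exact_mod_cast (by omega : b ≠ a)) _ _

theorem reads_snoc {M : ℕ} {mem : ℤ → ℤ} {p : ℕ} {xs : List ℤ} (h : Reads M mem p xs)
    (hM : p + xs.length + 1 ≤ M) {a : ℕ} (ha : a = p + xs.length) (z : ℤ) :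
    Reads M (Function.update mem a z) p (xs ++ [z]) := by
  subst ha
  rw [reads_append, reads_singleton]
  exact ⟨reads_update h le_rfl z, hM, Function.update_self _ _ _⟩

/-- The elements of `P` in increasing order. -/
def nodesOf {n : ℕ} (P : Finset (Fin n)) : List (Fin n) := (List.finRange n).filter (· ∈ P)

open Var in
theorem runs_bit {l : ℕ} {s : St} {p k t Y : ℕ} (ho : s.o = p) (hcnt : s.cnt = k) (hj : s.j = t)
    (hy : s.y = Y) (hl : ((k + 1 : ℕ) : ℤ) < 2 ^ l) :
    Runs l (iteP (md y 2) (blk [setP cnt (cnt + 1), storeP (o + cnt) j]) .skip) s 4 fun s' =>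
      s' = if Y % 2 = 1 then
        { s with cnt := (k + 1 : ℕ), mem := Function.update s.mem (p + 1 + k : ℕ) t } else s := by
  have h0 : (md (Ex.var Var.y) 2).eval s = (Y % 2 : ℕ) := by
    simp [St.get, hy]
  refine Runs.with_bdd fun hb => ?_
  refine Runs.ite (m := 3) (by decide) (fun h => ?_) fun h => ?_
  · rw [h0] at h
    rw [if_pos (by have := Nat.mod_two_eq_zero_or_one Y; omega)]
    refine Runs.cons_let (z := (k + 1 : ℕ)) (by decide) (by simp [St.get, hcnt]) (natCast_lt le_rfl hl) ?_
    simp only [St.set]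
    exact Runs.cons_put (x := (p + 1 + k : ℕ)) (z := t) (by decide) (by decide)
      (by simp [St.get, ho]; ring) hj (by have := hb.1 .j; rwa [St.get, hj] at this) (Runs.nil rfl)
  · rw [h0] at h
    rw [if_neg (by omega)]
    exact Runs.weaken (Runs.skip (Q := fun s' => s' = s) rfl) (by norm_num)

/-- The nodes are written from p + 1 on. Cell p is left for their number, which is only known
afterwards. -/
theorem runs_mask {l M n : ℕ} {s : St} {P : Finset (Fin n)} {p : ℕ} {pre : List ℤ} (hn : s.n = n)
    (hj : s.j = 0) (hy : s.y = mask P) (hcnt : s.cnt = 0) (ho : s.o = p)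
    (hr : Reads M s.mem 0 pre) (hp : pre.length = p) (hpM : p + n + 1 ≤ M) (hM : (M : ℤ) < 2 ^ l) :
    Runs l maskP s (n * 9 + 2) fun s' => ∃ (y : ℤ) (mem : ℤ → ℤ),
      s' = { s with y := y, j := n, cnt := (nodesOf P).length, mem := mem } ∧ Reads M mem 0 pre ∧
        Reads M mem (p + 1) ((nodesOf P).map fun i : Fin n => ((i : ℕ) : ℤ)) := by
  refine ((Runs.forList (by decide) (List.finRange n) (m := 7) (fun done rest s' =>
    ∃ mem : ℤ → ℤ, s' = { s with
      y := (mask P / 2 ^ done.length : ℕ), j := done.length, cnt := (done.filter (· ∈ P)).length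
      mem := mem } ∧ Reads M mem 0 pre ∧
        Reads M mem (p + 1) ((done.filter (· ∈ P)).map fun i : Fin n => ((i : ℕ) : ℤ))) ?_ ?_ ?_).imp
      ?_).weaken (by simp)
  · refine ⟨s.mem, by cases s; simp_all, hr, by constructor <;> simp; omega⟩
  · rintro done x rest s' hx ⟨mem, rfl, h1, h2⟩ -
    have hv := val_eq_length hx
    have hlen := length_finRange_eq hx
    have hfl := List.length_filter_le (· ∈ P) done
    have hbit := mask_bit P x
    rw [hv] at hbit
    have hdiv : mask P / 2 ^ (done ++ [x]).length = mask P / 2 ^ done.length / 2 := by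
      rw [List.length_append, List.length_singleton, pow_succ, Nat.div_div_eq_div_mul]
    have hd1 : (done ++ [x]).length = done.length + 1 := by simp
    refine ⟨?_, ?_⟩
    · have : (done.length : ℤ) < n := by exact_mod_cast (by omega : done.length < n)
      simp only [Ex.eval_sub, Ex.eval_var, St.get, hn]
      linarith
    refine Runs.with_bdd fun hb => ?_
    have hyb := hb.1 .y
    simp only [St.get] at hyb
    refine Runs.cons (m₁ := 4) (m₂ := 3) ((runs_bit (p := p)
      (k := (done.filter (· ∈ P)).length) (t := done.length) (Y := mask P / 2 ^ done.length)
      (by exact ho) (by rfl) (by rfl) (by rfl) ?_).imp fun s' hs' => ?_)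
    · have := natCast_lt (show (done.filter (· ∈ P)).length + 1 ≤ M by omega) hM
      rwa [abs_of_nonneg (by positivity)] at this
    have key : ∃ mem' : ℤ → ℤ, s' = { s with
        y := (mask P / 2 ^ done.length : ℕ), j := done.length
        cnt := ((done ++ [x]).filter (· ∈ P)).length, mem := mem' } ∧ Reads M mem' 0 pre ∧
        Reads M mem' (p + 1) (((done ++ [x]).filter (· ∈ P)).map fun i : Fin n => ((i : ℕ) : ℤ)) := by
      rw [hs', hbit]
      by_cases hx : x ∈ P
      · rw [if_pos hx, if_pos rfl]
        refine ⟨Function.update mem (p + 1 + (done.filter (· ∈ P)).length : ℕ) done.length, ?_,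
          reads_update h1 (by omega) _, ?_⟩
        · simp [List.filter_append, hx]
        · have := reads_snoc h2 (by rw [List.length_map]; omega) (by rw [List.length_map])
            (x : ℕ)
          rw [hv] at this
          simpa [List.filter_append, hx, hv] using this
      · rw [if_neg hx, if_neg (by norm_num)]
        exact ⟨mem, by simp [List.filter_append, hx], h1, by simpa [List.filter_append, hx] using h2⟩
    obtain ⟨mem', rfl, g1, g2⟩ := key
    refine Runs.cons_let (z := (mask P / 2 ^ (done ++ [x]).length : ℕ)) (by decide)
      (by rw [hdiv]; simp [St.get]) ?_ ?_
    · rw [hdiv]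
      rw [abs_of_nonneg (by positivity)] at hyb ⊢
      refine lt_of_le_of_lt ?_ hyb
      exact_mod_cast Nat.div_le_self _ _
    simp only [St.set]
    refine Runs.cons_let (z := (done ++ [x]).length) (by decide) (by simp [St.get])
      (natCast_lt (show _ ≤ M by omega) hM) (Runs.nil ?_)
    simp only [St.set]
    exact ⟨mem', rfl, g1, g2⟩
  · rintro s' ⟨mem, rfl, -⟩
    simp [St.get, hn]
  · rintro s' ⟨mem, rfl, h1, h2⟩
    exact ⟨(mask P / 2 ^ n : ℕ), mem, by simp [nodesOf], h1, h2⟩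

/-- The encoding of the parent sets of the nodes in a list. -/
def outOf {n : ℕ} (H : Fin n → Finset (Fin n)) (vs : List (Fin n)) : List ℤ :=
  vs.flatMap fun v => encodeNodes (nodesOf (H v))

theorem length_nodesOf {n : ℕ} (P : Finset (Fin n)) : (nodesOf P).length ≤ n := by
  simpa [nodesOf] using List.length_filter_le (· ∈ P) (List.finRange n)

theorem length_outOf {n : ℕ} (H : Fin n → Finset (Fin n)) (vs : List (Fin n)) :
    (outOf H vs).length ≤ vs.length * (n + 1) := by
  induction vs with
  | nil => simp [outOf]
  | cons v vs ih =>
    have := length_nodesOf (H v)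
    rw [outOf, List.flatMap_cons, List.length_append, ← outOf, encodeNodes_eq, List.length_cons,
      List.length_map, List.length_cons, Nat.succ_mul]
    omega

theorem encodesGraph_outOf {n : ℕ} (H : Fin n → Finset (Fin n)) :
    EncodesGraph H (outOf H (List.finRange n)) :=
  ⟨fun v => nodesOf (H v), fun v => ⟨(List.nodup_finRange n).filter _, by ext; simp [nodesOf]⟩, rfl⟩

/-- The parent sets are the base 2^n digits of the graph code, split off one by one from the low
end. -/
theorem runs_out {l n : ℕ} {s : St} {H : Fin n → Finset (Fin n)} (hn : s.n = n) (hW : s.W = 2 ^ n)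
    (hH : s.mem (tab 3 (2 ^ n - 1)) = graphCode H) (hl : ((n * (n + 1) : ℕ) : ℤ) < 2 ^ l) :
    Runs l outP s (n * (n * 9 + 12) + 6) fun s' =>
      s'.o = (outOf H (List.finRange n)).length ∧
        Reads (n * (n + 1)) s'.mem 0 (outOf H (List.finRange n)) := by
  have hnl : n ≤ n * (n + 1) := Nat.le_mul_of_pos_right _ (by omega)
  refine Runs.with_bdd fun hb => ?_
  refine Runs.cons_let (z := graphCode H) (m := n * (n * 9 + 12) + 5) (by decide)
    (by simp [St.get, hW, hH]) (hH ▸ hb.2 _) ?_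
  simp only [St.set]
  refine Runs.cons_let (z := 0) (by decide) rfl (by simp) ?_
  simp only [St.set]
  refine Runs.cons_let (z := n) (by decide) hn (natCast_lt hnl hl) ?_
  simp only [St.set]
  refine Runs.cons (m₁ := n * (n * 9 + 12) + 2) (m₂ := 1) ?_
  refine ((Runs.forList (by decide) (List.finRange n) (m := n * 9 + 10) (fun done rest s' =>
    s'.n = n ∧ s'.W = 2 ^ n ∧ s'.hx = (graphCode H / (2 ^ n) ^ done.length : ℕ) ∧
      s'.o = (outOf H done).length ∧ s'.i = rest.length ∧
      Reads (n * (n + 1)) s'.mem 0 (outOf H done)) ?_ ?_ ?_).imp ?_).weaken (by simp)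
  · exact ⟨hn, hW, by simp, by simp [outOf], by simp, by constructor <;> simp [outOf]⟩
  · rintro done v rest s' hx ⟨h1, h2, h3, h4, h5, h6⟩ hb
    have hv := val_eq_length hx
    have hlen := length_finRange_eq hx
    have hout := length_outOf H done
    have hm := graphCode_digit H v
    rw [hv] at hm
    have hbx := hb.1 .hx
    simp only [St.get, h3] at hbx
    have hsz : (outOf H done).length + n + 1 ≤ n * (n + 1) := by
      have : (done.length + 1) * (n + 1) ≤ n * (n + 1) := Nat.mul_le_mul_right _ (by omega)
      rw [Nat.succ_mul] at this
      omega
    have hsnoc : outOf H (done ++ [v]) = outOf H done ++ encodeNodes (nodesOf (H v)) := by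
      simp [outOf]
    have hnode := length_nodesOf (H v)
    rw [List.length_cons] at h5
    refine ⟨by simp only [Ex.eval_var, St.get, h5]; positivity, ?_⟩
    have hmask : |(mask (H v) : ℤ)| < 2 ^ l := by
      rw [← hm]
      rw [abs_of_nonneg (by positivity)] at hbx
      rw [abs_of_nonneg (Int.emod_nonneg _ (by positivity))]
      refine lt_of_le_of_lt ?_ hbx
      push_cast
      exact_mod_cast Nat.mod_le _ _
    refine Runs.cons_let (z := mask (H v)) (m := n * 9 + 9) (by decide)
      (by rw [← hm]; simp [St.get, h2, h3]) hmask ?_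
    simp only [St.set]
    refine Runs.cons_let (z := (graphCode H / (2 ^ n) ^ (done.length + 1) : ℕ)) (m := n * 9 + 8)
      (by decide) (by rw [pow_succ, ← Nat.div_div_eq_div_mul]; simp [St.get, h2, h3]) ?_ ?_
    · rw [abs_of_nonneg (by positivity)] at hbx ⊢
      refine lt_of_le_of_lt ?_ hbx
      rw [pow_succ, ← Nat.div_div_eq_div_mul]
      exact_mod_cast Nat.div_le_self _ _
    simp only [St.set]
    refine Runs.cons_let (z := 0) (m := n * 9 + 7) (by decide) rfl (by simp) ?_
    simp only [St.set]
    refine Runs.cons_let (z := 0) (m := n * 9 + 6) (by decide) rfl (by simp) ?_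
    simp only [St.set]
    refine Runs.cons (m₁ := n * 9 + 2) (m₂ := 4) ((runs_mask (P := H v)
      (p := (outOf H done).length) (by exact h1) (by rfl) (by rfl) (by rfl) (by exact h4)
      (by exact h6) rfl hsz hl).imp ?_)
    rintro s'' ⟨y, mem, rfl, g1, g2⟩
    dsimp only
    refine Runs.cons_put (x := (outOf H done).length) (z := (nodesOf (H v)).length) (by decide)
      (by decide) h4 rfl (natCast_lt (show _ ≤ n * (n + 1) by omega) hl) ?_
    refine Runs.cons_let (z := ((outOf H done).length + (nodesOf (H v)).length + 1 : ℕ)) (by decide)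
      (by simp [St.get, h4]) (natCast_lt (show _ ≤ n * (n + 1) by omega) hl) ?_
    simp only [St.set]
    refine Runs.cons_let (z := rest.length) (by decide) (by simp [St.get, h5])
      (natCast_lt (show _ ≤ n * (n + 1) by omega) hl) (Runs.nil ?_)
    simp only [St.set]
    refine ⟨h1, h2, by simp, ?_, trivial, ?_⟩
    · rw [hsnoc, List.length_append, encodeNodes_eq, List.length_cons, List.length_map]
      push_cast; ring
    · rw [hsnoc, reads_append, encodeNodes_eq, reads_cons, zero_add]
      refine ⟨reads_update g1 (by simp) _, Function.update_self _ _ _, g2.congr fun a h _ => ?_⟩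
      exact Function.update_of_ne (by exact_mod_cast (by omega : a ≠ (outOf H done).length)) _ _
  · rintro s' ⟨h1, h2, h3, h4, h5, h6⟩
    simp [St.get, h5]
  · rintro s' ⟨h1, h2, h3, h4, h5, h6⟩
    exact Runs.nil ⟨h4, h6⟩

end Polytree

/-! ### The complete program and its initial state. -/

namespace RAM

/-- A program for Polytree Learning. -/
def polytreeP : Prog := blk [initP, parseP, searchP, outP]

/-- The values in the initial state. -/
def St.init (w : List ℤ) : St where
  o := w.length
  n := 0
  W := 0
  WL := 0
  L := 0
  E := 0
  head := 0
  tail := 0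
  bd := 0
  rd := 0
  x := 0
  dx := 0
  nx := 0
  hx := 0
  e := 0
  u := 0
  P := 0
  en := 0
  ed := 0
  wv := 0
  i := 0
  wi := 0
  j := 0
  wj := 0
  a := 0
  b := 0
  c := 0
  d := 0
  y := 0
  g := 0
  pos := 0
  cnt := 0
  ln := 0
  pw := 0
  mem := (State.init w).mem

theorem rep_init (w : List ℤ) : Rep (St.init w) (State.init w) := by
  refine ⟨fun v => ?_, rfl⟩
  cases v <;> rfl

theorem length_le_size (w : List ℤ) : w.length ≤ size w := by
  induction w with
  | nil => simp
  | cons x w ih =>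
    have := len_pos x
    simp only [size, List.map_cons, List.sum_cons, List.length_cons] at ih ⊢
    omega

theorem abs_lt_of_mem {w : List ℤ} {z : ℤ} (hz : z ∈ w) : |z| < 2 ^ size w := by
  have h : len z ≤ size w := List.le_sum_of_mem (List.mem_map_of_mem hz)
  exact (abs_lt_of_len z).trans_le (pow_le_pow_right₀ (by norm_num) h)

theorem bdd_init {w : List ℤ} {l : ℕ} (hl : size w ≤ l) : (St.init w).Bdd l := by
  have h0 : |(0 : ℤ)| < 2 ^ l := by simp
  have hw : |(w.length : ℤ)| < 2 ^ l := by
    have h1 : size w < 2 ^ size w := Nat.lt_two_pow_self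
    have h2 : 2 ^ size w ≤ 2 ^ l := Nat.pow_le_pow_right (by norm_num) hl
    have h3 := length_le_size w
    rw [abs_of_nonneg (by positivity)]
    exact_mod_cast (by omega : w.length < 2 ^ l)
  refine ⟨fun v => ?_, fun a => ?_⟩
  · cases v <;> first | exact h0 | exact hw
  · show |if 0 ≤ a then w.getD a.toNat 0 else 0| < 2 ^ l
    split_ifs with h
    · rcases lt_or_ge a.toNat w.length with h1 | h1
      · rw [List.getD_eq_getElem _ _ h1]
        exact (abs_lt_of_mem (List.getElem_mem h1)).trans_le (pow_le_pow_right₀ (by norm_num) hl)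
      · rw [List.getD_eq_default _ _ h1]; exact h0
    · exact h0

theorem reads_init (w : List ℤ) : Reads w.length (State.init w).mem 0 w := by
  refine ⟨by simp, fun i hi => ?_⟩
  simp [State.init, hi]

end RAM

/-! ### Optimality of the recorded graph, and correctness of the program. -/

namespace Polytree

open RAM

section Optimal

variable {I : Instance} {L l h : ℕ} {ents : List (Fin I.n × Finset (Fin I.n) × ℚ)}

theorem isPolytree_empty {n : ℕ} : IsPolytree fun _ : Fin n => (∅ : Finset (Fin n)) := by
  refine ⟨isDAG_of_rank (fun _ => 0) (by simp), ?_⟩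
  have : skeleton (fun _ : Fin n => (∅ : Finset (Fin n))) = ⊥ := by
    ext u v; simp [skeleton_adj]
  rw [this]
  exact SimpleGraph.isAcyclic_bot

/-- The record of the final configuration comes from an actual partial solution, hence from a
polytree with that score; every polytree of finite score reaches the same configuration, so its
score is dominated. -/
theorem exists_isOptimal {mem : ℤ → ℤ} {Q : List (Cfg (Fin I.n))} {d : ℕ} (hd : I.n < 2 ^ d)
    (hinv : DPInv I (d + 1) ents mem Q)
    (hc : ∀ c H a b, Reach I (d + 1) c H a b → c.S.card = I.n → Dom (d + 1) mem Q c (a / b)) :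
    ∃ H, mem (tab 3 (2 ^ I.n - 1)) = graphCode H ∧ I.IsOptimal H := by
  have hcard : (Cfg.fin : Cfg (Fin I.n)).S.card = I.n := by simp [Cfg.fin]
  -- The graph without arcs has score 0, so the final configuration is certainly recorded.
  obtain ⟨a, b, hr⟩ := exists_reach (I := I) isPolytree_empty (g := fun _ => 0)
    (fun v => by rw [I.f_empty]; rfl) hd
  obtain ⟨H, hH, hm⟩ := hinv.sound _ (hc _ _ _ _ hr hcard).1
  rw [Cfg.code_fin] at hm
  refine ⟨H, hm, hH.realized.isPolytree, fun D hD => ?_⟩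
  by_cases hbot : ∃ v, I.f v (D v) = ⊥
  · obtain ⟨v, hv⟩ := hbot
    rw [Instance.score, ← Finset.add_sum_erase _ _ (Finset.mem_univ v), hv, WithBot.bot_add]
    exact bot_le
  · push Not at hbot
    choose g hg using fun v => WithBot.ne_bot_iff_exists.1 (hbot v)
    obtain ⟨a', b', hr'⟩ := exists_reach hD (g := g) (fun v => (hg v).symm) hd
    have h1 := (hc _ _ _ _ hr' hcard).2
    have h2 : I.score D = ((a' / b' : ℚ) : WithBot ℚ) := hr'.sum_eq
    have h3 : I.score H = (value (d + 1) mem Cfg.fin : WithBot ℚ) := hH.sum_eq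
    rw [h2, h3]
    exact_mod_cast h1

end Optimal

/-- The potential parent sets with their scores. -/
def entries (I : Instance) (fam : Fin I.n → List (List (Fin I.n))) :
    List (Fin I.n × Finset (Fin I.n) × ℚ) :=
  (List.finRange I.n).flatMap fun v =>
    (fam v).map fun K => (v, K.toFinset, (I.f v K.toFinset).unbotD 0)

theorem mem_entries {I : Instance} {fam : Fin I.n → List (List (Fin I.n))}
    (hf : ∀ v S, S ∈ (fam v).map List.toFinset ↔ I.f v S ≠ ⊥) (v P) (x : ℚ) :
    (v, P, x) ∈ entries I fam ↔ I.f v P = x := by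
  have : (v, P, x) ∈ entries I fam ↔ P ∈ (fam v).map List.toFinset ∧ (I.f v P).unbotD 0 = x := by
    simp only [entries, List.mem_flatMap, List.mem_finRange, true_and, List.mem_map, Prod.mk.injEq]
    constructor
    · rintro ⟨v', K, hK, rfl, rfl, rfl⟩; exact ⟨⟨K, hK, rfl⟩, rfl⟩
    · rintro ⟨⟨K, hK, rfl⟩, rfl⟩; exact ⟨v, K, hK, rfl, rfl, rfl⟩
  -- The default value 0 does no harm: listed sets have a score different from ⊥.
  rw [this, hf]
  induction I.f v P with
  | bot => simp
  | coe y => simp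

/-- The encoding of an instance. -/
def encoding (I : Instance) (fam : Fin I.n → List (List (Fin I.n))) : List ℤ :=
  (List.finRange I.n).flatMap fun v => ((fam v).length : ℤ) ::
    (fam v).flatMap fun K => encodeEntry K ((I.f v K.toFinset).unbotD 0)

theorem length_encoding (I : Instance) (fam : Fin I.n → List (List (Fin I.n))) :
    I.n + (entries I fam).length ≤ (encoding I fam).length := by
  have key : ∀ (Ks : List (List (Fin I.n))) (q : Finset (Fin I.n) → ℚ),
      Ks.length ≤ (Ks.flatMap fun K => encodeEntry K (q K.toFinset)).length := by
    intro Ks q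
    induction Ks with
    | nil => simp
    | cons K Ks ih =>
      rw [List.flatMap_cons, List.length_append, List.length_cons, encodeEntry, List.length_append,
        List.length_cons]
      omega
  have : ∀ vs : List (Fin I.n), vs.length + (vs.flatMap fun v =>
      (fam v).map fun K => (v, K.toFinset, (I.f v K.toFinset).unbotD 0)).length ≤
      (vs.flatMap fun v => ((fam v).length : ℤ) ::
        (fam v).flatMap fun K => encodeEntry K ((I.f v K.toFinset).unbotD 0)).length := by
    intro vs
    induction vs with
    | nil => simp
    | cons v vs ih =>
      have := key (fam v) fun S => (I.f v S).unbotD 0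
      simp only [List.flatMap_cons, List.length_append, List.length_cons, List.length_map] at ih ⊢
      omega
  have := this (List.finRange I.n)
  rwa [List.length_finRange] at this

theorem mem_encoding {I : Instance} {fam : Fin I.n → List (List (Fin I.n))} {v P} {x : ℚ}
    (h : (v, P, x) ∈ entries I fam) : x.num ∈ encoding I fam ∧ (x.den : ℤ) ∈ encoding I fam := by
  simp only [entries, List.mem_flatMap, List.mem_finRange, true_and, List.mem_map, Prod.mk.injEq] at h
  obtain ⟨v, K, hK, rfl, rfl, rfl⟩ := h
  simp only [encoding, List.mem_flatMap, List.mem_finRange, true_and, List.mem_cons]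
  exact ⟨⟨v, .inr ⟨K, hK, by simp [encodeEntry]⟩⟩, ⟨v, .inr ⟨K, hK, by simp [encodeEntry]⟩⟩⟩

theorem two_pow_lt {a b : ℕ} (h : a < b) : (2 : ℤ) ^ a < 2 ^ b := pow_lt_pow_right₀ (by norm_num) h

theorem two_pow_le {a b : ℕ} (h : a ≤ b) : (2 : ℤ) ^ a ≤ 2 ^ b := pow_le_pow_right₀ (by norm_num) h

theorem natCast_lt_two_pow {a b : ℕ} (h : a ≤ b) : (a : ℤ) < 2 ^ b := by
  have : b < 2 ^ b := Nat.lt_two_pow_self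
  exact_mod_cast h.trans_lt this

/-- Quadratically many bits suffice: codes have n(2L + 1) bits with L ≤ n + 1, graph codes n², and
scores about An; cross multiplication doubles the last. -/
theorem params {I : Instance} {ents : List (Fin I.n × Finset (Fin I.n) × ℚ)} {A : ℕ}
    (hm : ∀ v P (x : ℚ), (v, P, x) ∈ ents ↔ I.f v P = x)
    (hx : ∀ v P (x : ℚ), (v, P, x) ∈ ents → |x.num| < 2 ^ A ∧ (x.den : ℤ) < 2 ^ A)
    (hlen : I.n + ents.length ≤ A) :
    Params I (I.n.size + 1) (2 * (A + 1) ^ 2 + 1) ((A + 1) ^ 2) ents := by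
  have hsz : I.n.size ≤ I.n := Nat.size_le.2 Nat.lt_two_pow_self
  have hA : (A + 1) ^ 2 = A * A + 2 * A + 1 := by ring
  have hnn : I.n * I.n ≤ A * A := Nat.mul_le_mul (by omega) (by omega)
  have hAn : A * I.n ≤ A * A := Nat.mul_le_mul_left _ (by omega)
  refine ⟨hm, ?_, ?_, ?_, ?_, ?_, ?_⟩
  · rw [show (4 : ℤ) = 2 ^ 2 by norm_num, ← pow_mul, ← pow_add]
    refine two_pow_le ?_
    have : I.n * (2 * (I.n.size + 1) + 2) ≤ I.n * (2 * I.n + 4) := Nat.mul_le_mul_left _ (by omega)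
    nlinarith
  · rw [← pow_mul]
    exact two_pow_le (by nlinarith)
  · intro c H a b hr
    obtain ⟨h1, h2⟩ := hr.bounds (A := A) fun v P x h => hx v P x ((hm v P x).2 h)
    have hS : c.S.card ≤ I.n := by simpa using Finset.card_le_univ c.S
    have h3 : ((2 : ℤ) ^ A) ^ c.S.card ≤ 2 ^ (A * I.n) := by
      rw [← pow_mul]; exact two_pow_le (Nat.mul_le_mul_left _ hS)
    refine ⟨?_, (h2.trans h3).trans_lt (two_pow_lt (by omega))⟩
    have h4 := natCast_lt_two_pow hS
    calc |a| ≤ c.S.card * (2 ^ A) ^ c.S.card := h1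
      _ ≤ c.S.card * 2 ^ (A * I.n) := by gcongr
      _ < 2 ^ I.n * 2 ^ (A * I.n) := by gcongr
      _ = 2 ^ (I.n + A * I.n) := (pow_add _ _ _).symm
      _ ≤ 2 ^ ((A + 1) ^ 2) := two_pow_le (by omega)
  · rw [← pow_add, ← pow_succ']
    exact two_pow_le (by omega)
  · exact natCast_lt_two_pow (by omega)
  · exact natCast_lt_two_pow (by omega)

/-- The number of steps of the program on an instance of size `A`, with `n` nodes, and with at most
`N` configurations. -/
def totalCost (n A E N : ℕ) : ℕ :=
  (n * 11 + 12) + ((n * (A * (n * (n * 5 + 10) + 17) + 10) + 8) +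
    (searchCost n (n.size + 1) E N + ((n * (n * 9 + 12) + 6) + 1)))

theorem exec_polytreeP {I : Instance} {k : ℕ} (hk : I.InDegreeLE k) {w : List ℤ}
    (hw : I.Encodes w) :
    ∃ (E t : ℕ) (s : State) (D : Fin I.n → Finset (Fin I.n)) (out : List ℤ),
      Exec polytreeP (State.init w) t s ∧ s.HasOutput out ∧ EncodesGraph D out ∧ I.IsOptimal D ∧
      I.n + E + 1 ≤ size w ∧ t ≤ totalCost I.n (size w) E (cfgBound I.n k (I.n.size + 1)) *
        unit (2 * (size w + 1) ^ 2 + 1) := by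
  obtain ⟨fam, h1, h2, h3, hw⟩ := hw
  change w = (I.n : ℤ) :: encoding I fam at hw
  have hlen : I.n + (entries I fam).length + 1 ≤ size w := by
    have := length_encoding I fam
    have := length_le_size w
    have : w.length = (encoding I fam).length + 1 := by rw [hw]; rfl
    omega
  have hm := mem_entries h3
  have hp : Params I (I.n.size + 1) (2 * (size w + 1) ^ 2 + 1) ((size w + 1) ^ 2) (entries I fam) := by
    refine params hm (fun v P x h => ?_) (by omega)
    obtain ⟨g1, g2⟩ := mem_encoding h
    exact ⟨abs_lt_of_mem (by rw [hw]; exact List.mem_cons_of_mem _ g1),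
      (le_abs_self _).trans_lt (abs_lt_of_mem (by rw [hw]; exact List.mem_cons_of_mem _ g2))⟩
  have hA : (size w + 1) ^ 2 = size w * size w + 2 * size w + 1 := by ring
  have hnn : I.n * I.n ≤ size w * size w := Nat.mul_le_mul (by omega) (by omega)
  generalize hl : 2 * (size w + 1) ^ 2 + 1 = l at hp ⊢
  have hinit : ((2 : ℤ) ^ I.n) ^ (I.n + 1) < 2 ^ l := by
    rw [← pow_mul]
    exact two_pow_lt (by rw [Nat.mul_succ]; omega)
  have hM : (w.length : ℤ) < 2 ^ l :=
    natCast_lt_two_pow ((length_le_size w).trans (by omega))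
  have hr : Reads w.length (St.init w).mem 0 ((I.n : ℤ) :: encoding I fam) := by
    have := reads_init w
    nth_rw 3 [hw] at this
    exact this
  rw [reads_cons] at hr
  have hF : ∀ v, (fam v).length ≤ size w := by
    intro v
    refine le_trans ?_ (show (entries I fam).length ≤ size w by omega)
    rw [entries, List.length_flatMap]
    refine le_trans ?_ (List.le_sum_of_mem (List.mem_map_of_mem (List.mem_finRange v)))
    simp
  have run : Runs l polytreeP (St.init w) (totalCost I.n (size w) (entries I fam).length
      (cfgBound I.n k (I.n.size + 1))) fun s' => ∃ H, I.IsOptimal H ∧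
        s'.o = (outOf H (List.finRange I.n)).length ∧
        Reads (I.n * (I.n + 1)) s'.mem 0 (outOf H (List.finRange I.n)) := by
    refine Runs.cons ((runs_init hr.1 hinit).imp ?_)
    rintro s₁ rfl
    refine Runs.cons ((runs_parse (L := I.n.size + 1) ⟨rfl, rfl, rfl, rfl⟩ h1
      (fun v S => (I.f v S).unbotD 0) (by exact hr.2) hinit hM hF).imp ?_)
    rintro s₂ ⟨p, hs₂⟩
    refine Runs.cons ((runs_search hp (fun mem Q h => h.length_le_cfgBound hk) hs₂.env hs₂.table
      fun f hf x => ?_).imp ?_)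
    · have hf' : 1 ≤ f ∧ f < 5 := by simp at hf; omega
      rw [hs₂.zero f hf'.2 x]
      -- The tables lie at negative addresses, where the initial memory is 0.
      exact if_neg (by unfold tab; omega)
    rintro s₃ ⟨Q, hinv, henv, hc⟩
    obtain ⟨H, hH, hopt⟩ := exists_isOptimal (Nat.lt_size_self I.n) hinv hc
    refine Runs.cons ((runs_out (H := H) henv.1 henv.2.1 hH (natCast_lt_two_pow ?_)).imp ?_)
    · rw [Nat.mul_succ]; omega
    exact fun s₄ hs₄ => Runs.nil ⟨H, hopt, hs₄⟩
  obtain ⟨t, σ, s, g1, g2, -, g4, H, g5, g6, g7⟩ :=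
    run (bdd_init (by omega)) _ (rep_init w)
  refine ⟨_, t, σ, H, outOf H (List.finRange I.n), g1, ⟨(g2.1 .o).trans g6, fun i hi => ?_⟩,
    encodesGraph_outOf H, g5, hlen, g4⟩
  rw [g2.2]
  simpa using g7.2 i hi

end Polytree

/-! ### Estimating the total cost. -/

namespace Polytree

open RAM

theorem totalCost_le {n A E N : ℕ} (h : n + E + 1 ≤ A) (hN : 1 ≤ N) :
    totalCost n A E N ≤ 300 * N * (A + 1) ^ 4 := by
  have hsz : n.size ≤ n := Nat.size_le.2 Nat.lt_two_pow_self
  obtain ⟨B, rfl⟩ : ∃ B, A + 1 = B := ⟨_, rfl⟩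
  have hexp : expandCost (n.size + 1) E ≤ 55 * (A + 1) ^ 3 := by
    have h1 : (n.size + 1) * ((n.size + 1) * 29 + 9) ≤ (A + 1) * ((A + 1) * 29 + 9) := by
      gcongr <;> omega
    calc expandCost (n.size + 1) E ≤ (A + 1) * ((A + 1) * ((A + 1) * 29 + 9) + 13) + 4 := by
          unfold expandCost; gcongr; omega
      _ ≤ 55 * (A + 1) ^ 3 := by nlinarith [Nat.zero_le A, Nat.zero_le (A ^ 2), Nat.zero_le (A ^ 3)]
  have hsearch : searchCost n (n.size + 1) E N ≤ N * (78 * (A + 1) ^ 4) := by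
    calc searchCost n (n.size + 1) E N ≤ (A + 1) * (N * (55 * (A + 1) ^ 3 + 8) + 7) + 8 := by
          unfold searchCost; gcongr; omega
      _ ≤ (A + 1) * (N * (55 * (A + 1) ^ 3 + 8) + N * 7) + N * 8 := by gcongr <;> omega
      _ = N * ((A + 1) * (55 * (A + 1) ^ 3 + 15) + 8) := by ring
      _ ≤ N * (78 * (A + 1) ^ 4) := by
          gcongr
          nlinarith [Nat.zero_le A, Nat.zero_le (A ^ 2), Nat.zero_le (A ^ 3), Nat.zero_le (A ^ 4)]
  have hrest : (n * 11 + 12) + (n * (A * (n * (n * 5 + 10) + 17) + 10) + 8) +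
      (n * (n * 9 + 12) + 6) + 1 ≤ 200 * (A + 1) ^ 4 := by
    have hn : n ≤ A := by omega
    calc _ ≤ (A * 11 + 12) + (A * (A * (A * (A * 5 + 10) + 17) + 10) + 8) +
          (A * (A * 9 + 12) + 6) + 1 := by gcongr
      _ ≤ 200 * (A + 1) ^ 4 := by
          nlinarith [Nat.zero_le A, Nat.zero_le (A ^ 2), Nat.zero_le (A ^ 3), Nat.zero_le (A ^ 4)]
  have : 200 * (A + 1) ^ 4 ≤ N * (200 * (A + 1) ^ 4) := Nat.le_mul_of_pos_left _ hN
  unfold totalCost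
  calc _ = searchCost n (n.size + 1) E N + ((n * 11 + 12) +
        (n * (A * (n * (n * 5 + 10) + 17) + 10) + 8) + (n * (n * 9 + 12) + 6) + 1) := by ring
    _ ≤ N * (78 * (A + 1) ^ 4) + N * (200 * (A + 1) ^ 4) := by omega
    _ ≤ 300 * N * (A + 1) ^ 4 := by nlinarith [Nat.zero_le (N * (A + 1) ^ 4)]

theorem unit_le (A : ℕ) : unit (2 * (A + 1) ^ 2 + 1) ≤ 12 * 100 ^ 3 * 16 * (A + 1) ^ 4 := by
  have h : 2 * (A + 1) ^ 2 + 1 + 1 ≤ 4 * (A + 1) ^ 2 := by nlinarith [Nat.zero_le A]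
  calc unit (2 * (A + 1) ^ 2 + 1) ≤ 12 * 100 ^ 3 * (4 * (A + 1) ^ 2) ^ 2 := by
        unfold unit; gcongr
    _ = _ := by ring

/-- A polynomial in the length of `n` grows more slowly than `n`. -/
theorem exists_size_bound (K δ : ℝ) (hK : 0 ≤ K) (hδ : 0 < δ) :
    ∃ C : ℝ, ∀ n : ℕ, K * (n.size * (n.size + 1)) ≤ δ * n + C := by
  have h1 : Filter.Tendsto (fun s : ℕ => 2 * K * ((s : ℝ) ^ 2 / 2 ^ s)) Filter.atTop
      (nhds (2 * K * 0)) :=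
    (tendsto_pow_const_div_const_pow_of_one_lt 2 (by norm_num : (1 : ℝ) < 2)).const_mul _
  rw [mul_zero] at h1
  obtain ⟨s₀, hs₀⟩ := Filter.eventually_atTop.1 (h1.eventually_le_const (half_pos hδ))
  -- The second summand covers numbers of length at most s₀; δ absorbs the additive 1 in 2^s ≤ 2n +
  -- 1.
  refine ⟨δ + K * (s₀ * (s₀ + 1)), fun n => ?_⟩
  have h2 : (2 : ℝ) ^ n.size ≤ 2 * n + 1 := by
    rcases h : n.size with _ | m
    · simp
    · have : 2 ^ m ≤ n := Nat.lt_size.1 (by omega)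
      have : (2 : ℝ) ^ m ≤ n := by exact_mod_cast this
      rw [pow_succ]; linarith
  rcases le_total s₀ n.size with h | h
  · have h3 := hs₀ _ h
    rw [← mul_div_assoc, div_le_iff₀ (by positivity)] at h3
    have h4 : (n.size : ℝ) * (n.size + 1) ≤ 2 * (n.size : ℝ) ^ 2 := by
      rcases Nat.eq_zero_or_pos n.size with h | h
      · simp [h]
      · have : (1 : ℝ) ≤ n.size := by exact_mod_cast h
        nlinarith
    have h5 : δ / 2 * 2 ^ n.size ≤ δ / 2 * (2 * n + 1) := by gcongr
    have h6 : K * (n.size * (n.size + 1)) ≤ K * (2 * (n.size : ℝ) ^ 2) := by gcongr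
    have h7 : 0 ≤ K * (s₀ * (s₀ + 1)) := by positivity
    nlinarith
  · have h3 : (n.size : ℝ) ≤ s₀ := by exact_mod_cast h
    have h4 : K * (n.size * (n.size + 1)) ≤ K * (s₀ * (s₀ + 1)) := by gcongr
    have h5 : 0 ≤ δ * n := by positivity
    linarith

/-- With s the length of n, the slots contribute at most 2^((k+1)s(s+1)). The exponent is
polylogarithmic in n, so this is at most a constant times (1+ε/2)^n. -/
theorem exists_cfgBound (k : ℕ) {ε : ℝ} (hε : 0 < ε) :
    ∃ C : ℝ, 0 < C ∧ ∀ n : ℕ, (cfgBound n k (n.size + 1) : ℝ) ≤ C * (2 + ε) ^ n := by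
  have hlog : 0 < Real.log (1 + ε / 2) := Real.log_pos (by linarith)
  obtain ⟨C, hC⟩ := exists_size_bound ((k + 1) * Real.log 2) (Real.log (1 + ε / 2)) (by positivity) hlog
  refine ⟨Real.exp C, Real.exp_pos _, fun n => ?_⟩
  have h1 : ((n : ℝ) + 1) ≤ 2 ^ n.size := by
    have : n < 2 ^ n.size := Nat.lt_size_self n
    exact_mod_cast this
  have h2 : (((n : ℝ) + 1) ^ (k + 1)) ^ (n.size + 1) ≤ Real.exp C * (1 + ε / 2) ^ n := by
    calc (((n : ℝ) + 1) ^ (k + 1)) ^ (n.size + 1) ≤ ((2 ^ n.size) ^ (k + 1)) ^ (n.size + 1) := by gcongr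
      _ = Real.exp ((k + 1) * Real.log 2 * (n.size * (n.size + 1))) := by
          rw [← pow_mul, ← pow_mul, ← Real.rpow_natCast, Real.rpow_def_of_pos (by norm_num)]
          congr 1; push_cast; ring
      _ ≤ Real.exp (Real.log (1 + ε / 2) * n + C) := Real.exp_le_exp.2 (hC n)
      _ = Real.exp C * (1 + ε / 2) ^ n := by
          rw [Real.exp_add, mul_comm, ← Real.rpow_natCast, Real.rpow_def_of_pos (by linarith)]
  calc (cfgBound n k (n.size + 1) : ℝ) = 2 ^ n * (((n : ℝ) + 1) ^ (k + 1)) ^ (n.size + 1) := by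
        unfold cfgBound; push_cast; rfl
    _ ≤ 2 ^ n * (Real.exp C * (1 + ε / 2) ^ n) := by gcongr
    _ = Real.exp C * (2 + ε) ^ n := by
        rw [show 2 + ε = 2 * (1 + ε / 2) by ring, mul_pow]; ring

end Polytree

theorem mainTheorem2 :
    ∃ c : ℕ, ∀ (k : ℕ) (ε : ℝ), 0 < ε →
      ∃ (p : RAM.Prog) (C : ℝ), ∀ (I : Polytree.Instance) (w : List ℤ),
        I.InDegreeLE k → I.Encodes w →
          ∃ (t : ℕ) (s : RAM.State) (D : Fin I.n → Finset (Fin I.n)) (out : List ℤ),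
            RAM.Exec p (RAM.State.init w) t s ∧
            s.HasOutput out ∧ Polytree.EncodesGraph D out ∧ I.IsOptimal D ∧
            (t : ℝ) ≤ C * (2 + ε) ^ I.n * (RAM.size w : ℝ) ^ c := by
  -- Four powers of the input size come from the number of steps per configuration, and four from
  -- the cost of a step, quadratic in a quadratic bit length.
  refine ⟨8, fun k ε hε => ?_⟩
  obtain ⟨C, hC, hN⟩ := Polytree.exists_cfgBound k hε
  refine ⟨RAM.polytreeP, 300 * (12 * 100 ^ 3 * 16) * 2 ^ 8 * C, fun I w hk hw => ?_⟩
  obtain ⟨E, t, s, D, out, h1, h2, h3, h4, h5, h6⟩ := Polytree.exec_polytreeP hk hw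
  refine ⟨t, s, D, out, h1, h2, h3, h4, ?_⟩
  have hpos : 1 ≤ Polytree.cfgBound I.n k (I.n.size + 1) := by
    unfold Polytree.cfgBound; exact Nat.one_le_iff_ne_zero.2 (by positivity)
  have h7 := h6.trans (Nat.mul_le_mul (Polytree.totalCost_le h5 hpos) (Polytree.unit_le _))
  -- An encoding is never empty, so the additive 1 is traded for the factor 2^8 in the constant.
  have h8 : (RAM.size w : ℝ) + 1 ≤ 2 * RAM.size w := by
    have : (1 : ℝ) ≤ RAM.size w := by exact_mod_cast (by omega : 1 ≤ RAM.size w)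
    linarith
  have h9 := hN I.n
  calc (t : ℝ) ≤ 300 * (Polytree.cfgBound I.n k (I.n.size + 1)) * ((RAM.size w : ℝ) + 1) ^ 4 *
        (12 * 100 ^ 3 * 16 * ((RAM.size w : ℝ) + 1) ^ 4) := by exact_mod_cast h7
    _ = 300 * (12 * 100 ^ 3 * 16) * (Polytree.cfgBound I.n k (I.n.size + 1)) *
        ((RAM.size w : ℝ) + 1) ^ 8 := by ring
    _ ≤ 300 * (12 * 100 ^ 3 * 16) * (C * (2 + ε) ^ I.n) * (2 * RAM.size w) ^ 8 := by gcongr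
    _ = 300 * (12 * 100 ^ 3 * 16) * 2 ^ 8 * C * (2 + ε) ^ I.n * (RAM.size w : ℝ) ^ 8 := by ring
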